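/- **Conventions.** A smooth manifold is a smooth ($C^\infty$) manifold modelled on a Hausdorff locally convex real topological vector space, possibly of infinite dimension; a Lie group is a group object in this sense. Let $G$ be a Lie group acting smoothly from the left on a smooth manifold $M$, and let $N\ge 0$ be an integer. *The simplicial manifold.* $G^\bullet\times M=\{G^p\times M\}_{p\ge 0}$ is the simplicial manifold with face maps $\partial_i:G^{p+1}\times M\to G^{p}\times M$, $$\partial_0(g_1,\dots,g_{p+1},x)=(g_2,\dots,g_{p+1},x),\qquad \partial_i(g_1,\dots,g_{p+1},x)=(g_1,\dots,g_ig_{i+1},\dots,g_{p+1},x)\ (1\le i\le p),$$ $$\partial_{p+1}(g_1,\dots,g_{p+1},x)=(g_1,\dots,g_p,g_{p+1}x),$$ and degeneracy maps inserting the unit of $G$. *The Deligne complexes.* On a smooth manifold $X$ let $\mathcal F(N)$ be the complex of sheaves $$\underline{\mathbb T}\xrightarrow{\ \frac{1}{2\pi i}d\log\ }\underline A^1\xrightarrow{\ d\ }\underline A^2\xrightarrow{\ d\ }\cdots\xrightarrow{\ d\ }\underline A^N\to 0\to\cdots,$$ where $\underline{\mathbb T}$, placed in degree $0$, is the sheaf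 of smooth functions with values in the unit circle and $\underline A^q$ is the sheaf of real-valued smooth $q$-forms. On $G^p\times M$ let $F^1\mathcal F(N)\subset\mathcal F(N)$ be the subcomplex which is $0$ in degree $0$ and which in degree $q$, $1\le q\le N$, consists of the $q$-forms $\omega$ with $\omega(V_1,\dots,V_q)=0$ whenever $V_1,\dots,V_q$ are tangent vectors at one point that are vertical for the projection $G^p\times M\to G^p$. Put $\bar{\mathcal F}(N)=\mathcal F(N)/F^1\mathcal F(N)$. For varying $p$ these form a complex of simplicial sheaves on $G^\bullet\times M$. *Hypercohomology.* $H^q(X,-)$ is the hypercohomology of a complex of sheaves, computed from an injective resolution. If $\bar{\mathcal F}(N)\to I^{*}$ is an injective resolution by simplicial sheaves, with component $I^{p,*}$ on $G^p\times M$, then $H^m(G^\bullet\times M,\bar{\mathcal F}(N))$ is the $m$-th cohomology group of the total complex of the double complex $$K^{p,q}=\Gamma(G^p\times M,I^{p,q}),\qquad \partial=\sum_{i=0}^{p+1}(-1)^i\partial_i^*,\qquad \delta=\text{the differential of } I^*,$$ with total differential $\partial+(-1)^p\delta$. Let $F^pH^m(G^\bullet\times M,\bar{\mathcal F}(N))$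 be the subgroup of the classes of cocycles lying in $\bigoplus_{i\ge p}K^{i,m-i}$; then $H^m=F^0H^m\supseteq F^1H^m\supseteq\cdots\supseteq F^{m+1}H^m=0$. **Proposition.** There is a first quadrant cohomological spectral sequence $(E_r^{p,q},d_r)_{r\ge 1}$ (with $d_r:E_r^{p,q}\to E_r^{p+r,q-r+1}$) of abelian groups such that: 1. $E_1^{p,q}\cong H^q(G^p\times M,\bar{\mathcal F}(N))$, and under these isomorphisms the differential $d_1:E_1^{p,q}\to E_1^{p+1,q}$ is $\partial=\sum_{i=0}^{p+1}(-1)^i\partial_i^*$; 2. the natural map $H^q(M,\mathcal F(N))\to H^q(G^0\times M,\bar{\mathcal F}(N))$, induced by the projection $G^0\times M\to M$ and by $\mathcal F(N)\to\bar{\mathcal F}(N)$, is an isomorphism for every $q$. Consequently $\partial\circ\partial=0$ and $E_2^{p,q}$ is isomorphic to the $p$-th cohomology group of the complex $$H^q(M,\mathcal F(N))\xrightarrow{\ \partial\ }H^q(G\times M,\bar{\mathcal F}(N))\xrightarrow{\ \partial\ }H^q(G^2\times M,\bar{\mathcal F}(N))\xrightarrow{\ \partial\ }\cdots;$$ 3.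 it converges to $H^{p+q}(G^\bullet\times M,\bar{\mathcal F}(N))$: for all $p,q\ge0$ and all $r>\max(p,q+1)$, $$E_r^{p,q}\;\cong\;F^pH^{p+q}(G^\bullet\times M,\bar{\mathcal F}(N))\,/\,F^{p+1}H^{p+q}(G^\bullet\times M,\bar{\mathcal F}(N)).$$ -/

import Mathlib

open CategoryTheory TopologicalSpace Filter Topology

universe u v w

namespace EquivDeligne

/-! ### Smooth maps between locally convex spaces -/

set_option linter.unusedSectionVars false

section Calculus

/-- `f` is of class `C^k` on `U` in the sense of Bertram, Gloeckner and Neeb: `f` is continuous, and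
for `k ≥ 1` the difference quotient `(f (x + t • v) - f x) / t` extends to a map of class `C^(k-1)`
on `{(x, v, t) | x ∈ U, x + t • v ∈ U}`. For open subsets of real locally convex spaces this agrees
with the notion of Michal and Bastiani (existence and joint continuity of the iterated directional
derivatives), and with the usual one in finite dimension. -/
def CkOn {F : Type v} [AddCommGroup F] [Module ℝ F] [TopologicalSpace F] :
    ℕ → ∀ {E : Type u} [AddCommGroup E] [Module ℝ E] [TopologicalSpace E], (E → F) → Set E → Prop
  | 0, _, _, _, _, f, U => ContinuousOn f U
  | k + 1, E, _, _, _, f, U => ContinuousOn f U ∧ ∃ g : E × E × ℝ → F,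
      (∀ x v : E, ∀ t : ℝ, x ∈ U → x + t • v ∈ U → f (x + t • v) - f x = t • g (x, v, t)) ∧
      CkOn k g {p : E × E × ℝ | p.1 ∈ U ∧ p.1 + p.2.2 • p.2.1 ∈ U}

/-- `f` is smooth near `x`. -/
def SmoothAt {E : Type u} {F : Type v} [AddCommGroup E] [Module ℝ E] [TopologicalSpace E]
    [AddCommGroup F] [Module ℝ F] [TopologicalSpace F] (f : E → F) (x : E) : Prop :=
  ∃ U : Set E, IsOpen U ∧ x ∈ U ∧ ∀ k, CkOn k f U

/-- The derivative of `f` at `x` in the direction `v`. -/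
noncomputable def D {E : Type u} {F : Type v} [AddCommGroup E] [Module ℝ E]
    [AddCommGroup F] [Module ℝ F] [TopologicalSpace F] (f : E → F) (x v : E) : F :=
  limUnder (𝓝[≠] (0 : ℝ)) fun t => t⁻¹ • (f (x + t • v) - f x)

variable {E : Type u} [AddCommGroup E] [Module ℝ E] [TopologicalSpace E]
variable {F : Type v} [AddCommGroup F] [Module ℝ F] [TopologicalSpace F]
variable {G : Type w} [AddCommGroup G] [Module ℝ G] [TopologicalSpace G]

theorem CkOn.continuousOn {k : ℕ} {f : E → F} {U : Set E} (h : CkOn k f U) : ContinuousOn f U := by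
  cases k with
  | zero => exact h
  | succ k => exact h.1

theorem CkOn.mono {k : ℕ} {f : E → F} {U V : Set E} (h : CkOn k f U) (hV : V ⊆ U) :
    CkOn k f V := by
  induction k generalizing E with
  | zero => exact ContinuousOn.mono h hV
  | succ k ih =>
    obtain ⟨hc, g, hg, hk⟩ := h
    exact ⟨hc.mono hV, g, fun x v t hx hxt => hg x v t (hV hx) (hV hxt),
      ih hk fun p hp => ⟨hV hp.1, hV hp.2⟩⟩

theorem CkOn.congr {k : ℕ} {f g : E → F} {U : Set E} (h : CkOn k f U) (he : Set.EqOn g f U) :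
    CkOn k g U := by
  cases k with
  | zero => exact ContinuousOn.congr h he
  | succ k =>
    obtain ⟨hc, f1, hf, hk⟩ := h
    exact ⟨hc.congr he, f1, fun x v t hx hxt => by rw [he hx, he hxt, hf x v t hx hxt], hk⟩

theorem CkOn.of_succ {k : ℕ} {f : E → F} {U : Set E} (h : CkOn (k + 1) f U) : CkOn k f U := by
  induction k generalizing E with
  | zero => exact h.1
  | succ k ih =>
    obtain ⟨hc, g, hg, hk⟩ := h
    exact ⟨hc, g, hg, ih hk⟩

theorem CkOn.linear {k : ℕ} (L : E →L[ℝ] F) (U : Set E) : CkOn k L U := by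
  induction k generalizing E with
  | zero => exact L.continuous.continuousOn
  | succ k ih =>
    exact ⟨L.continuous.continuousOn, fun p => L p.2.1, fun x v t _ _ => by simp,
      ih (L.comp ((ContinuousLinearMap.fst ℝ E ℝ).comp (ContinuousLinearMap.snd ℝ E (E × ℝ)))) _⟩

theorem CkOn.const {k : ℕ} (c : F) (U : Set E) : CkOn k (fun _ : E => c) U := by
  induction k generalizing E c with
  | zero => exact continuousOn_const
  | succ k ih => exact ⟨continuousOn_const, fun _ => 0, fun x v t _ _ => by simp, ih 0 _⟩

theorem CkOn.prodMk {k : ℕ} {f : E → F} {g : E → G} {U : Set E} (hf : CkOn k f U)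
    (hg : CkOn k g U) : CkOn k (fun x => (f x, g x)) U := by
  induction k generalizing E with
  | zero => exact ContinuousOn.prodMk hf hg
  | succ k ih =>
    obtain ⟨hfc, f1, hf1, hfk⟩ := hf
    obtain ⟨hgc, g1, hg1, hgk⟩ := hg
    exact ⟨hfc.prodMk hgc, fun p => (f1 p, g1 p), fun x v t hx hxt => by
      ext
      · exact hf1 x v t hx hxt
      · exact hg1 x v t hx hxt, ih hfk hgk⟩

theorem CkOn.pi {k : ℕ} {ι : Type} {H : ι → Type v} [∀ i, AddCommGroup (H i)]
    [∀ i, Module ℝ (H i)] [∀ i, TopologicalSpace (H i)] {f : E → ∀ i, H i} {U : Set E}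
    (hf : ∀ i, CkOn k (fun x => f x i) U) : CkOn k f U := by
  induction k generalizing E with
  | zero => exact continuousOn_pi.2 hf
  | succ k ih =>
    choose hc g hg hk using hf
    exact ⟨continuousOn_pi.2 hc, fun p i => g i p, fun x v t hx hxt => by
      ext i; exact hg i x v t hx hxt, ih hk⟩

theorem CkOn.comp_linear {k : ℕ} {E' : Type u} [AddCommGroup E'] [Module ℝ E']
    [TopologicalSpace E'] {f : E → F} {U : Set E} (hf : CkOn k f U) (L : E' →L[ℝ] E) :
    CkOn k (fun x => f (L x)) (L ⁻¹' U) := by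
  induction k generalizing E E' with
  | zero => exact ContinuousOn.comp hf L.continuous.continuousOn fun _ h => h
  | succ k ih =>
    obtain ⟨hfc, g, hg, hk⟩ := hf
    exact ⟨hfc.comp L.continuous.continuousOn fun _ h => h, _,
      fun x v t hx hxt => by simpa using hg (L x) (L v) t hx (by simpa using hxt),
      (ih hk (L.prodMap (L.prodMap (ContinuousLinearMap.id ℝ ℝ)))).mono
        fun p hp => by simpa using hp⟩

theorem CkOn.comp {k : ℕ} {f : E → F} {g : F → G} {U : Set E} {V : Set F} (hg : CkOn k g V)
    (hf : CkOn k f U) (h : Set.MapsTo f U V) : CkOn k (fun x => g (f x)) U := by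
  induction k generalizing E F with
  | zero => exact ContinuousOn.comp hg hf h
  | succ k ih =>
    have hf' := hf.of_succ
    obtain ⟨hfc, f1, hf1, hfk⟩ := hf
    obtain ⟨hgc, g1, hg1, hgk⟩ := hg
    have key : ∀ x v : E, ∀ t : ℝ, x ∈ U → x + t • v ∈ U →
        f x + t • f1 (x, v, t) = f (x + t • v) := fun x v t hx hxt => by
      rw [← hf1 x v t hx hxt]; abel
    refine ⟨hgc.comp hfc h, fun p => g1 (f p.1, f1 p, p.2.2), fun x v t hx hxt => ?_,
      ih hgk (f := fun p : E × E × ℝ => (f p.1, f1 p, p.2.2)) ?_ ?_⟩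
    · have := hg1 (f x) (f1 (x, v, t)) t (h hx) (by rw [key x v t hx hxt]; exact h hxt)
      rw [key x v t hx hxt] at this
      exact this
    · refine CkOn.prodMk ((hf'.comp_linear (ContinuousLinearMap.fst ℝ E (E × ℝ))).mono
        fun p hp => hp.1) (CkOn.prodMk hfk (CkOn.linear ((ContinuousLinearMap.snd ℝ E ℝ).comp
        (ContinuousLinearMap.snd ℝ E (E × ℝ))) _))
    · rintro ⟨x, v, t⟩ ⟨hx, hxt⟩
      exact ⟨h hx, by simpa [key x v t hx hxt] using h hxt⟩

theorem SmoothAt.eventually {f : E → F} {x : E} (h : SmoothAt f x) :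
    ∀ᶠ y in 𝓝 x, SmoothAt f y := by
  obtain ⟨U, hU, hx, hk⟩ := h
  filter_upwards [hU.mem_nhds hx] with y hy using ⟨U, hU, hy, hk⟩

theorem SmoothAt.continuousAt {f : E → F} {x : E} (h : SmoothAt f x) : ContinuousAt f x := by
  obtain ⟨U, hU, hx, hk⟩ := h
  exact (hk 0).continuousOn.continuousAt (hU.mem_nhds hx)

theorem SmoothAt.congr {f g : E → F} {x : E} (h : SmoothAt f x) (he : g =ᶠ[𝓝 x] f) :
    SmoothAt g x := by
  obtain ⟨U, hU, hx, hk⟩ := h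
  obtain ⟨V, hV, hVo, hxV⟩ := eventually_nhds_iff.1 he
  exact ⟨U ∩ V, hU.inter hVo, ⟨hx, hxV⟩, fun k =>
    ((hk k).mono Set.inter_subset_left).congr fun y hy => hV y hy.2⟩

theorem SmoothAt.linear (L : E →L[ℝ] F) (x : E) : SmoothAt L x :=
  ⟨Set.univ, isOpen_univ, trivial, fun _ => CkOn.linear L _⟩

theorem SmoothAt.const (c : F) (x : E) : SmoothAt (fun _ : E => c) x :=
  ⟨Set.univ, isOpen_univ, trivial, fun _ => CkOn.const c _⟩

theorem SmoothAt.prodMk {f : E → F} {g : E → G} {x : E} (hf : SmoothAt f x) (hg : SmoothAt g x) :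
    SmoothAt (fun x => (f x, g x)) x := by
  obtain ⟨U, hU, hx, hk⟩ := hf
  obtain ⟨V, hV, hx', hk'⟩ := hg
  exact ⟨U ∩ V, hU.inter hV, ⟨hx, hx'⟩, fun k =>
    ((hk k).mono Set.inter_subset_left).prodMk ((hk' k).mono Set.inter_subset_right)⟩

theorem SmoothAt.pi {ι : Type} [Finite ι] {H : ι → Type v} [∀ i, AddCommGroup (H i)]
    [∀ i, Module ℝ (H i)] [∀ i, TopologicalSpace (H i)] {f : E → ∀ i, H i} {x : E}
    (hf : ∀ i, SmoothAt (fun x => f x i) x) : SmoothAt f x := by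
  choose U hU hx hk using hf
  exact ⟨⋂ i, U i, isOpen_iInter_of_finite hU, Set.mem_iInter.2 hx, fun k =>
    CkOn.pi fun i => (hk i k).mono (Set.iInter_subset _ i)⟩

theorem SmoothAt.comp {f : E → F} {g : F → G} {x : E} (hg : SmoothAt g (f x))
    (hf : SmoothAt f x) : SmoothAt (fun x => g (f x)) x := by
  obtain ⟨U, hU, hx, hk⟩ := hf
  obtain ⟨V, hV, hx', hk'⟩ := hg
  exact ⟨U ∩ f ⁻¹' V, (hk 0).continuousOn.isOpen_inter_preimage hU hV, ⟨hx, hx'⟩, fun k =>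
    (hk' k).comp ((hk k).mono Set.inter_subset_left) fun y hy => hy.2⟩

variable [IsTopologicalAddGroup E] [ContinuousSMul ℝ E]

theorem tendsto_add_smul (x v : E) : Tendsto (fun t : ℝ => x + t • v) (𝓝 0) (𝓝 x) := by
  have : Continuous fun t : ℝ => x + t • v := by fun_prop
  simpa using this.tendsto 0

theorem isOpen_quot {U : Set E} (hU : IsOpen U) :
    IsOpen {p : E × E × ℝ | p.1 ∈ U ∧ p.1 + p.2.2 • p.2.1 ∈ U} :=
  (hU.preimage continuous_fst).inter (hU.preimage (by fun_prop))

/-- A quotient map as in the definition of `CkOn` computes the derivative. -/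
theorem tendsto_quot {f : E → F} {U : Set E} (hU : IsOpen U) {g : E × E × ℝ → F}
    (hg : ∀ x v : E, ∀ t : ℝ, x ∈ U → x + t • v ∈ U → f (x + t • v) - f x = t • g (x, v, t))
    (hc : ContinuousOn g {p : E × E × ℝ | p.1 ∈ U ∧ p.1 + p.2.2 • p.2.1 ∈ U}) {x : E}
    (hx : x ∈ U) (v : E) :
    Tendsto (fun t : ℝ => t⁻¹ • (f (x + t • v) - f x)) (𝓝[≠] 0) (𝓝 (g (x, v, 0))) := by
  have h1 : ContinuousAt g (x, v, 0) :=
    hc.continuousAt ((isOpen_quot hU).mem_nhds ⟨hx, by simpa using hx⟩)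
  have h2 : Tendsto (fun t : ℝ => g (x, v, t)) (𝓝[≠] 0) (𝓝 (g (x, v, 0))) := by
    have h3 : ContinuousAt (fun t : ℝ => g (x, v, t)) 0 :=
      ContinuousAt.comp (f := fun t : ℝ => (x, v, t)) h1 (by fun_prop)
    exact h3.tendsto.mono_left nhdsWithin_le_nhds
  refine h2.congr' ?_
  have h4 : ∀ᶠ t in 𝓝[≠] (0 : ℝ), x + t • v ∈ U :=
    ((tendsto_add_smul x v).eventually (hU.mem_nhds hx)).filter_mono nhdsWithin_le_nhds
  filter_upwards [h4, self_mem_nhdsWithin] with t ht ht0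
  rw [hg x v t hx ht, smul_smul, inv_mul_cancel₀ ht0, one_smul]

variable [T2Space F]

theorem D_eq {f : E → F} {x v : E} {y : F}
    (h : Tendsto (fun t : ℝ => t⁻¹ • (f (x + t • v) - f x)) (𝓝[≠] 0) (𝓝 y)) : D f x v = y :=
  h.limUnder_eq

theorem SmoothAt.tendsto {f : E → F} {x : E} (h : SmoothAt f x) (v : E) :
    Tendsto (fun t : ℝ => t⁻¹ • (f (x + t • v) - f x)) (𝓝[≠] 0) (𝓝 (D f x v)) := by
  obtain ⟨U, hU, hx, hk⟩ := h
  obtain ⟨_, g, hg, hc⟩ := hk 1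
  have := tendsto_quot hU hg hc hx v
  rwa [D_eq this]

theorem D_congr {f g : E → F} {x : E} (he : f =ᶠ[𝓝 x] g) (v : E) : D f x v = D g x v := by
  have : (fun t : ℝ => t⁻¹ • (f (x + t • v) - f x)) =ᶠ[𝓝[≠] 0]
      fun t : ℝ => t⁻¹ • (g (x + t • v) - g x) := by
    have := ((tendsto_add_smul x v).eventually he).filter_mono
      (nhdsWithin_le_nhds (s := {(0 : ℝ)}ᶜ))
    filter_upwards [this] with t ht
    rw [ht, he.self_of_nhds]
  unfold D limUnder
  rw [Filter.map_congr this]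

theorem D_linear [ContinuousSMul ℝ F] (L : E →L[ℝ] F) (x v : E) : D L x v = L v := by
  refine D_eq (Tendsto.congr' ?_ tendsto_const_nhds)
  filter_upwards [self_mem_nhdsWithin] with t ht
  simp [smul_smul, inv_mul_cancel₀ (show t ≠ 0 from ht)]

theorem D_const (c : F) (x v : E) : D (fun _ : E => c) x v = 0 :=
  D_eq (by simp)

theorem D_comp [IsTopologicalAddGroup F] [ContinuousSMul ℝ F] [T2Space G] {f : E → F} {g : F → G}
    {x : E} (hg : SmoothAt g (f x)) (hf : SmoothAt f x) (v : E) :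
    D (fun x => g (f x)) x v = D g (f x) (D f x v) := by
  obtain ⟨U, hU, hx, hk⟩ := hf
  obtain ⟨V, hV, hx', hk'⟩ := hg
  obtain ⟨hfc, f1, hf1, hfk⟩ := hk 1
  obtain ⟨hgc, g1, hg1, hgk⟩ := hk' 1
  rw [D_eq (tendsto_quot hU hf1 hfk hx v), D_eq (tendsto_quot hV hg1 hgk hx' _)]
  refine D_eq ?_
  have h1 : ContinuousAt f1 (x, v, 0) :=
    hfk.continuousOn.continuousAt ((isOpen_quot hU).mem_nhds ⟨hx, by simpa using hx⟩)
  have h2 : ContinuousAt g1 (f x, f1 (x, v, 0), 0) :=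
    hgk.continuousOn.continuousAt ((isOpen_quot hV).mem_nhds ⟨hx', by simpa using hx'⟩)
  have h3 : ContinuousAt (fun t : ℝ => f1 (x, v, t)) 0 :=
    ContinuousAt.comp (f := fun t : ℝ => (x, v, t)) h1 (by fun_prop)
  have h4 : ContinuousAt (fun t : ℝ => g1 (f x, f1 (x, v, t), t)) 0 :=
    ContinuousAt.comp (f := fun t : ℝ => (f x, f1 (x, v, t), t)) h2
      (continuousAt_const.prodMk (h3.prodMk continuousAt_id))
  refine (h4.tendsto.mono_left nhdsWithin_le_nhds).congr' ?_
  have h5 : ∀ᶠ t in 𝓝[≠] (0 : ℝ), x + t • v ∈ U ∩ f ⁻¹' V :=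
    ((tendsto_add_smul x v).eventually ((hfc.isOpen_inter_preimage hU hV).mem_nhds
      ⟨hx, hx'⟩)).filter_mono nhdsWithin_le_nhds
  filter_upwards [h5, self_mem_nhdsWithin] with t ht ht0
  have key : f x + t • f1 (x, v, t) = f (x + t • v) := by rw [← hf1 x v t hx ht.1]; abel
  have := hg1 (f x) (f1 (x, v, t)) t hx' (by rw [key]; exact ht.2)
  rw [key] at this
  rw [this, smul_smul, inv_mul_cancel₀ ht0, one_smul]

theorem D_prodMk [T2Space G] {f : E → F} {g : E → G} {x : E} (hf : SmoothAt f x)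
    (hg : SmoothAt g x) (v : E) : D (fun x => (f x, g x)) x v = (D f x v, D g x v) :=
  D_eq ((hf.tendsto v).prodMk_nhds (hg.tendsto v))

theorem D_pi {ι : Type} {H : ι → Type v} [∀ i, AddCommGroup (H i)]
    [∀ i, Module ℝ (H i)] [∀ i, TopologicalSpace (H i)] [∀ i, T2Space (H i)] {f : E → ∀ i, H i}
    {x : E} (hf : ∀ i, SmoothAt (fun x => f x i) x) (v : E) :
    D f x v = fun i => D (fun x => f x i) x v :=
  D_eq (tendsto_pi_nhds.2 fun i => (hf i).tendsto v)

theorem D_zero (f : E → F) (x : E) : D f x 0 = 0 :=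
  D_eq (by simp)

theorem SmoothAt.D_smul {f : E → F} {x : E} [ContinuousSMul ℝ F] (h : SmoothAt f x) (c : ℝ)
    (v : E) : D f x (c • v) = c • D f x v := by
  obtain ⟨U, hU, hx, hk⟩ := h
  obtain ⟨_, g, hg, hc⟩ := hk 1
  have hv := tendsto_quot hU hg hc hx v
  rw [D_eq hv]
  by_cases hc0 : c = 0
  · subst hc0
    simpa using D_zero f x
  refine D_eq ?_
  have h1 : Tendsto (fun t : ℝ => t * c) (𝓝[≠] 0) (𝓝[≠] 0) := by
    refine tendsto_nhdsWithin_iff.2 ⟨?_, ?_⟩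
    · have : Continuous fun t : ℝ => t * c := by fun_prop
      simpa using (this.tendsto 0).mono_left nhdsWithin_le_nhds
    · filter_upwards [self_mem_nhdsWithin] with t ht using mul_ne_zero ht hc0
  refine ((hv.comp h1).const_smul c).congr fun t => ?_
  simp only [Function.comp, smul_smul, mul_inv]
  rw [show c * (t⁻¹ * c⁻¹) = t⁻¹ by field_simp]

theorem SmoothAt.D_add {f : E → F} {x : E} [ContinuousAdd F] (h : SmoothAt f x) (v w : E) :
    D f x (v + w) = D f x v + D f x w := by
  obtain ⟨U, hU, hx, hk⟩ := h
  obtain ⟨hfc, g, hg, hc⟩ := hk 1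
  rw [D_eq (tendsto_quot hU hg hc hx v), D_eq (tendsto_quot hU hg hc hx w)]
  refine D_eq ?_
  have h1 : ContinuousAt g (x, v, 0) :=
    hc.continuousOn.continuousAt ((isOpen_quot hU).mem_nhds ⟨hx, by simpa using hx⟩)
  have h2 : ContinuousAt g (x + (0 : ℝ) • v, w, 0) :=
    hc.continuousOn.continuousAt ((isOpen_quot hU).mem_nhds ⟨by simpa, by simpa using hx⟩)
  have h3 : ContinuousAt (fun t : ℝ => g (x, v, t)) 0 :=
    ContinuousAt.comp (f := fun t : ℝ => (x, v, t)) h1 (by fun_prop)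
  have h4 : ContinuousAt (fun t : ℝ => g (x + t • v, w, t)) 0 :=
    ContinuousAt.comp (f := fun t : ℝ => (x + t • v, w, t)) h2 (by fun_prop)
  have h5 := (h3.add h4).tendsto.mono_left (nhdsWithin_le_nhds (s := {(0 : ℝ)}ᶜ))
  simp only [Pi.add_apply, zero_smul, add_zero] at h5
  refine h5.congr' ?_
  have h6 : ∀ u : E, ∀ᶠ t in 𝓝[≠] (0 : ℝ), x + t • u ∈ U := fun u =>
    ((tendsto_add_smul x u).eventually (hU.mem_nhds hx)).filter_mono nhdsWithin_le_nhds
  filter_upwards [h6 v, h6 (v + w), self_mem_nhdsWithin] with t ht ht' ht0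
  have e : x + t • (v + w) = x + t • v + t • w := by rw [smul_add, add_assoc]
  rw [e] at ht' ⊢
  have : f (x + t • v + t • w) - f x = t • (g (x, v, t) + g (x + t • v, w, t)) := by
    rw [smul_add, ← hg x v t hx ht, ← hg (x + t • v) w t ht ht']; abel
  rw [this, smul_smul, inv_mul_cancel₀ ht0, one_smul, Pi.add_apply]

theorem SmoothAt.D {f : E → F} {x : E} (h : SmoothAt f x) (v : E) :
    SmoothAt (fun p : E × E => D f p.1 p.2) (x, v) := by
  obtain ⟨U, hU, hx, hk⟩ := h
  refine ⟨U ×ˢ Set.univ, hU.prod isOpen_univ, ⟨hx, trivial⟩, fun k => ?_⟩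
  obtain ⟨_, g, hg, hc⟩ := hk (k + 1)
  let L : E × E →L[ℝ] E × E × ℝ := (ContinuousLinearMap.fst ℝ E E).prod
    ((ContinuousLinearMap.snd ℝ E E).prod 0)
  refine ((CkOn.comp (f := L) hc (CkOn.linear L (U ×ˢ Set.univ)) ?_)).congr ?_
  · rintro ⟨y, w⟩ hy
    exact ⟨hy.1, by simpa [L] using hy.1⟩
  · rintro ⟨y, w⟩ hy
    exact D_eq (tendsto_quot hU hg hc.continuousOn hy.1 w)

theorem SmoothAt.D_right {f : E → F} {x : E} (h : SmoothAt f x) (v : E) :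
    SmoothAt (fun y => EquivDeligne.D f y v) x :=
  (h.D v).comp (f := fun y => (y, v))
    ((SmoothAt.linear (ContinuousLinearMap.id ℝ E) x).prodMk (SmoothAt.const v x))

theorem SmoothAt.D_symm {f : E → F} {x : E} (h : SmoothAt f x) (v w : E) :
    EquivDeligne.D (fun y => EquivDeligne.D f y w) x v =
      EquivDeligne.D (fun y => EquivDeligne.D f y v) x w := by
  obtain ⟨U, hU, hx, hk⟩ := h
  obtain ⟨hfc, g, hg, hgk⟩ := hk 2
  obtain ⟨hgc, g2, hg2, hg2c⟩ := hgk
  have hU1 := isOpen_quot hU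
  have hD : ∀ y ∈ U, ∀ u : E, EquivDeligne.D f y u = g (y, u, 0) := fun y hy u =>
    D_eq (tendsto_quot hU hg hgc hy u)
  have hD2 : ∀ u u' : E, EquivDeligne.D (fun y => EquivDeligne.D f y u') x u =
      g2 ((x, u', 0), (u, 0, 0), 0) := by
    intro u u'
    have h1 := tendsto_quot hU1 hg2 hg2c (x := (x, u', 0)) ⟨hx, by simpa using hx⟩ (u, 0, 0)
    rw [← D_eq h1]
    have h2 : (fun y => EquivDeligne.D f y u') =ᶠ[𝓝 x] fun y => g (y, u', 0) := by
      filter_upwards [hU.mem_nhds hx] with y hy using hD y hy u'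
    rw [D_congr h2]
    simp [EquivDeligne.D]
  rw [hD2, hD2]
  have hlim : ∀ u u' : E, Tendsto (fun t : ℝ => g2 ((x, u', t), (u, 0, 0), t)) (𝓝[≠] 0)
      (𝓝 (g2 ((x, u', 0), (u, 0, 0), 0))) := by
    intro u u'
    have h1 : ContinuousAt g2 ((x, u', 0), (u, 0, 0), 0) :=
      ContinuousOn.continuousAt hg2c ((isOpen_quot hU1).mem_nhds
        ⟨⟨hx, by simpa using hx⟩, by simpa using hx⟩)
    have h3 : ContinuousAt (fun t : ℝ => g2 ((x, u', t), (u, 0, 0), t)) 0 :=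
      ContinuousAt.comp (f := fun t : ℝ => ((x, u', t), ((u, 0, 0) : E × E × ℝ), t)) h1
        (by fun_prop)
    exact h3.tendsto.mono_left nhdsWithin_le_nhds
  refine tendsto_nhds_unique (hlim v w) ((hlim w v).congr' ?_)
  have h6 : ∀ u u' : E, ∀ᶠ t in 𝓝[≠] (0 : ℝ), x + t • u + t • u' ∈ U := fun u u' => by
    have : Continuous fun t : ℝ => x + t • u + t • u' := by fun_prop
    have h := this.tendsto 0
    simp only [zero_smul, add_zero] at h
    exact (h.eventually (hU.mem_nhds hx)).filter_mono nhdsWithin_le_nhds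
  filter_upwards [h6 v 0, h6 w 0, h6 v w, self_mem_nhdsWithin] with t hv hw hvw ht0
  simp only [smul_zero, add_zero] at hv hw
  have main : ∀ u u' : E, x + t • u ∈ U → x + t • u' ∈ U → x + t • u + t • u' ∈ U →
      (t * t) • g2 ((x, u', t), (u, 0, 0), t) =
        f (x + t • u + t • u') - f (x + t • u) - (f (x + t • u') - f x) := by
    intro u u' hu hu' huu'
    have h1 := hg2 (x, u', t) (u, 0, 0) t ⟨hx, hu'⟩ (by simpa using ⟨hu, huu'⟩)
    rw [mul_smul, ← h1, smul_sub, hg x u' t hx hu']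
    simp only [Prod.smul_mk, smul_zero, Prod.mk_add_mk, add_zero]
    rw [hg (x + t • u) u' t hu huu']
  have hc : x + t • w + t • v = x + t • v + t • w := by abel
  have e := (main w v hw hv (hc ▸ hvw)).trans ((by rw [hc]; abel :
    _ = f (x + t • v + t • w) - f (x + t • v) - (f (x + t • w) - f x))) |>.trans
    (main v w hv hw hvw).symm
  exact smul_right_injective F (mul_ne_zero ht0 ht0) e

end Calculus

/-! ### Differential forms on open subsets of the model space -/

section LocalForms

variable {E : Type u} [AddCommGroup E] [Module ℝ E] [TopologicalSpace E]
  [IsTopologicalAddGroup E] [ContinuousSMul ℝ E]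
variable {F : Type v} [AddCommGroup F] [Module ℝ F] [TopologicalSpace F]
  [IsTopologicalAddGroup F] [ContinuousSMul ℝ F] [T2Space F]

/-- The function `f` is an alternating multilinear form. -/
def IsAlt {E : Type u} [AddCommGroup E] [Module ℝ E] {q : ℕ} (f : (Fin q → E) → ℝ) : Prop :=
  ∃ β : E [⋀^Fin q]→ₗ[ℝ] ℝ, ∀ v, β v = f v

/-- The exterior derivative
`dω(x; v₀, …, v_q) = ∑ᵢ (-1)ⁱ D_x ω(x; v₀, …, v̂ᵢ, …, v_q) vᵢ` of a form on `E`. -/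
noncomputable def dRaw {E : Type u} [AddCommGroup E] [Module ℝ E] {q : ℕ}
    (a : E → (Fin q → E) → ℝ) (x : E) (v : Fin (q + 1) → E) : ℝ :=
  ∑ i : Fin (q + 1), (-1 : ℝ) ^ (i : ℕ) * D (fun y => a y (i.removeNth v)) x (v i)

theorem D_fun_add {f g : E → F} {x : E} (hf : SmoothAt f x) (hg : SmoothAt g x) (v : E) :
    D (fun y => f y + g y) x v = D f x v + D g x v :=
  D_eq (((hf.tendsto v).add (hg.tendsto v)).congr fun t => by
    rw [← smul_add]; congr 1; abel)

theorem D_fun_smul {f : E → F} {x : E} (c : ℝ) (hf : SmoothAt f x) (v : E) :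
    D (fun y => c • f y) x v = c • D f x v :=
  D_eq (((hf.tendsto v).const_smul c).congr fun t => by rw [smul_comm, smul_sub])

theorem SmoothAt.add {f g : E → F} {x : E} (hf : SmoothAt f x) (hg : SmoothAt g x) :
    SmoothAt (fun y => f y + g y) x :=
  (SmoothAt.linear (ContinuousLinearMap.fst ℝ F F + ContinuousLinearMap.snd ℝ F F) _).comp
    (f := fun y => (f y, g y)) (hf.prodMk hg)

theorem SmoothAt.smul {f : E → F} {x : E} (c : ℝ) (hf : SmoothAt f x) :
    SmoothAt (fun y => c • f y) x :=
  (SmoothAt.linear (c • ContinuousLinearMap.id ℝ F) _).comp hf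

theorem SmoothAt.sum {ι : Type} (s : Finset ι) {f : ι → E → F} {x : E}
    (hf : ∀ i, SmoothAt (f i) x) : SmoothAt (fun y => ∑ i ∈ s, f i y) x := by
  classical
  induction s using Finset.induction_on with
  | empty => simpa using SmoothAt.const (0 : F) x
  | insert i s hi ih => simpa [Finset.sum_insert hi] using (hf i).add ih

theorem D_fun_sum {ι : Type} (s : Finset ι) {f : ι → E → F} {x : E}
    (hf : ∀ i, SmoothAt (f i) x) (v : E) :
    D (fun y => ∑ i ∈ s, f i y) x v = ∑ i ∈ s, D (f i) x v := by
  classical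
  induction s using Finset.induction_on with
  | empty => simpa using D_const (0 : F) x v
  | insert i s hi ih =>
    simp only [Finset.sum_insert hi]
    rw [D_fun_add (hf i) (SmoothAt.sum s hf), ih]

theorem SmoothAt.D_sum {ι : Type} (s : Finset ι) {f : E → F} {x : E}
    (hf : SmoothAt f x) (v : ι → E) : EquivDeligne.D f x (∑ i ∈ s, v i) =
      ∑ i ∈ s, EquivDeligne.D f x (v i) := by
  classical
  induction s using Finset.induction_on with
  | empty => simpa using D_zero f x
  | insert i s hi ih => simp only [Finset.sum_insert hi]; rw [hf.D_add, ih]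

variable {q : ℕ}

theorem IsAlt.comp {f : (Fin q → F) → ℝ} (h : IsAlt f) (L : E → F)
    (hadd : ∀ v w, L (v + w) = L v + L w) (hsmul : ∀ (c : ℝ) v, L (c • v) = c • L v) :
    IsAlt fun v : Fin q → E => f fun i => L (v i) := by
  obtain ⟨β, hβ⟩ := h
  exact ⟨β.compLinearMap ⟨⟨L, hadd⟩, hsmul⟩, fun v => hβ _⟩

theorem IsAlt.add {f g : (Fin q → E) → ℝ} (hf : IsAlt f) (hg : IsAlt g) :
    IsAlt fun v => f v + g v := by
  obtain ⟨β, hβ⟩ := hf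
  obtain ⟨γ, hγ⟩ := hg
  exact ⟨β + γ, fun v => by simp [hβ, hγ]⟩

theorem IsAlt.neg {f : (Fin q → E) → ℝ} (hf : IsAlt f) : IsAlt fun v => -f v := by
  obtain ⟨β, hβ⟩ := hf
  exact ⟨-β, fun v => by simp [hβ]⟩

theorem isAlt_zero : IsAlt fun _ : Fin q → E => 0 := ⟨0, fun _ => rfl⟩

theorem sum_removeNth_eq_zero {E : Type u} {n : ℕ} (S : E → E → (Fin n → E) → ℝ)
    (hS : ∀ u w z, S u w z = S w u z) (v : Fin (n + 2) → E) :
    ∑ i : Fin (n + 2), (-1 : ℝ) ^ (i : ℕ) * ∑ j : Fin (n + 1), (-1 : ℝ) ^ (j : ℕ) *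
      S (v i) (i.removeNth v j) (j.removeNth (i.removeNth v)) = 0 := by
  simp only [Finset.mul_sum]
  rw [Fin.sum_sum_eq_sum_triangle_add]
  refine Finset.sum_eq_zero fun i _ => Finset.sum_eq_zero fun j hj => ?_
  rw [Finset.mem_Ici] at hj
  have H₁ : i.castSucc.removeNth v j = v j.succ := by
    simp [Fin.removeNth_apply, Fin.succAbove_of_le_castSucc, hj]
  have H₂ : j.succ.removeNth v i = v i.castSucc := by
    simp [Fin.removeNth_apply, Fin.succAbove_of_castSucc_lt, hj]
  have H₃ : i.removeNth (j.succ.removeNth v) = j.removeNth (i.castSucc.removeNth v) := by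
    rw [Fin.removeNth_removeNth_eq_swap]
    simp [Fin.predAbove, hj, Fin.succAbove]
  rw [H₁, H₂, H₃, hS (v j.succ)]
  simp only [Fin.val_succ, Fin.val_castSucc, pow_succ]
  ring

theorem dRaw_congr {a b : E → (Fin q → E) → ℝ} {x : E} (h : ∀ᶠ y in 𝓝 x, a y = b y) :
    dRaw a x = dRaw b x := by
  ext v
  refine Finset.sum_congr rfl fun i _ => ?_
  congr 1
  exact D_congr (h.mono fun y hy => by simp only [hy]) _

section

variable {a : E → (Fin q → E) → ℝ} {x : E}

theorem smooth_left
    (ha : ∀ v, SmoothAt (fun p : E × (Fin q → E) => a p.1 p.2) (x, v))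
    (v : Fin q → E) : SmoothAt (fun y => a y v) x :=
  (ha v).comp (f := fun y => (y, v))
    ((SmoothAt.linear (ContinuousLinearMap.id ℝ E) x).prodMk (SmoothAt.const v x))

theorem D_left
    (v : Fin q → E) (w : E) :
    D (fun y => a y v) x w = D (fun p : E × (Fin q → E) => a p.1 p.2) (x, v) (w, 0) := by
  simp [D]

theorem dRaw_smooth
    (ha : ∀ v, SmoothAt (fun p : E × (Fin q → E) => a p.1 p.2) (x, v))
    (v : Fin (q + 1) → E) :
    SmoothAt (fun p : E × (Fin (q + 1) → E) => dRaw a p.1 p.2) (x, v) := by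
  have h : ∀ i : Fin (q + 1), SmoothAt (fun p : E × (Fin (q + 1) → E) =>
      D (fun r : E × (Fin q → E) => a r.1 r.2) (p.1, i.removeNth p.2) (p.2 i, 0)) (x, v) := by
    intro i
    let L : E × (Fin (q + 1) → E) →L[ℝ] (E × (Fin q → E)) × (E × (Fin q → E)) :=
      ((ContinuousLinearMap.fst ℝ _ _).prod (ContinuousLinearMap.pi fun j =>
        (ContinuousLinearMap.proj (i.succAbove j)).comp (ContinuousLinearMap.snd ℝ _ _))).prod
      (((ContinuousLinearMap.proj i).comp (ContinuousLinearMap.snd ℝ _ _)).prod 0)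
    exact SmoothAt.comp (f := L) ((ha (i.removeNth v)).D (v i, 0)) (SmoothAt.linear L (x, v))
  have h2 := SmoothAt.sum Finset.univ fun i => (h i).smul ((-1 : ℝ) ^ (i : ℕ))
  refine h2.congr ?_
  have h3 : ∀ᶠ p in 𝓝 (x, v), ∀ i : Fin (q + 1), SmoothAt
      (fun r : E × (Fin q → E) => a r.1 r.2) (p.1, i.removeNth p.2) := by
    refine eventually_all.2 fun i => ?_
    have hc : Continuous fun p : E × (Fin (q + 1) → E) => (p.1, i.removeNth p.2) := by
      refine continuous_fst.prodMk (continuous_pi fun j => ?_)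
      exact (continuous_apply (i.succAbove j)).comp continuous_snd
    exact (hc.tendsto (x, v)).eventually (ha (i.removeNth v)).eventually
  filter_upwards [h3] with p hp
  refine Finset.sum_congr rfl fun i _ => ?_
  simp [D]

theorem dRaw_dRaw
    (ha : ∀ v, SmoothAt (fun p : E × (Fin q → E) => a p.1 p.2) (x, v))
    (v : Fin (q + 2) → E) : dRaw (dRaw a) x v = 0 := by
  rw [← sum_removeNth_eq_zero (fun u w z => D (fun y => D (fun y' => a y' z) y w) x u)
    (fun u w z => (smooth_left ha z).D_symm u w) v]
  refine Finset.sum_congr rfl fun i _ => ?_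
  congr 1
  unfold dRaw
  have hs : ∀ j : Fin (q + 1), SmoothAt (fun y => D (fun y' => a y' (j.removeNth
      (i.removeNth v))) y (i.removeNth v j)) x := fun j => (smooth_left ha _).D_right _
  rw [show (fun y => ∑ j : Fin (q + 1), (-1 : ℝ) ^ (j : ℕ) * D (fun y' => a y' (j.removeNth
      (i.removeNth v))) y (i.removeNth v j)) = fun y => ∑ j : Fin (q + 1), (-1 : ℝ) ^ (j : ℕ) •
      D (fun y' => a y' (j.removeNth (i.removeNth v))) y (i.removeNth v j) from rfl,
    D_fun_sum _ fun j => (hs j).smul _]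
  exact Finset.sum_congr rfl fun j _ => D_fun_smul _ (hs j) _

theorem dRaw_isAlt
    (ha : ∀ v, SmoothAt (fun p : E × (Fin q → E) => a p.1 p.2) (x, v))
    (hA : ∀ᶠ y in 𝓝 x, IsAlt (a y)) : IsAlt (dRaw a x) := by
  classical
  have hs := smooth_left ha
  let L : E →ₗ[ℝ] E [⋀^Fin q]→ₗ[ℝ] ℝ :=
    { toFun := fun w =>
        { toFun := fun v => D (fun y => a y v) x w
          map_update_add' := fun v i b c => by
            rw [← D_fun_add (hs _) (hs _)]
            refine D_congr (hA.mono fun y hy => ?_) w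
            obtain ⟨β, hβ⟩ := hy
            simp only [← hβ, β.map_update_add]
          map_update_smul' := fun v i b c => by
            rw [← D_fun_smul _ (hs _)]
            refine D_congr (hA.mono fun y hy => ?_) w
            obtain ⟨β, hβ⟩ := hy
            simp only [← hβ, β.map_update_smul]
          map_eq_zero_of_eq' := fun v i j hij hne => by
            rw [← D_const (0 : ℝ) x w]
            refine D_congr (hA.mono fun y hy => ?_) w
            obtain ⟨β, hβ⟩ := hy
            simp only [← hβ, β.map_eq_zero_of_eq v hij hne] }
      map_add' := fun w w' => by ext v; exact (hs v).D_add w w'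
      map_smul' := fun c w => by ext v; exact (hs v).D_smul c w }
  refine ⟨AlternatingMap.alternatizeUncurryFin L, fun v => ?_⟩
  rw [AlternatingMap.alternatizeUncurryFin_apply]
  refine Finset.sum_congr rfl fun i _ => ?_
  rw [zsmul_eq_mul]
  push_cast
  rfl

theorem D_alt
    (ha : ∀ v, SmoothAt (fun p : E × (Fin q → E) => a p.1 p.2) (x, v))
    (hA : IsAlt (a x)) (v w : Fin q → E) :
    D (fun p : E × (Fin q → E) => a p.1 p.2) (x, v) (0, w) =
      ∑ k, a x (Function.update v k (w k)) := by
  have hw : ((0, w) : E × (Fin q → E)) = ∑ k, (0, Pi.single k (w k)) :=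
    Prod.ext (by simp [Prod.fst_sum]) (by simp [Prod.snd_sum, Finset.univ_sum_single])
  rw [hw, (ha v).D_sum]
  refine Finset.sum_congr rfl fun k _ => D_eq (Tendsto.congr' ?_ tendsto_const_nhds)
  obtain ⟨β, hβ⟩ := hA
  filter_upwards [self_mem_nhdsWithin] with t ht
  have h1 : v + t • (Pi.single k (w k) : Fin q → E) = Function.update v k (v k + t • w k) := by
    ext j
    by_cases hj : j = k
    · subst hj; simp
    · simp [hj]
  simp only [Prod.smul_mk, Prod.mk_add_mk, smul_zero, add_zero, h1, ← hβ, β.map_update_add,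
    β.map_update_smul, Function.update_eq_self, add_sub_cancel_left, smul_smul,
    inv_mul_cancel₀ (show t ≠ 0 from ht), one_smul]

end

theorem dRaw_pullback [T2Space E] {a : F → (Fin q → F) → ℝ} {f : E → F} {x : E}
    (ha : ∀ v, SmoothAt (fun p : F × (Fin q → F) => a p.1 p.2) (f x, v)) (hA : IsAlt (a (f x)))
    (hf : SmoothAt f x) (v : Fin (q + 1) → E) :
    dRaw (fun y w => a (f y) fun i => D f y (w i)) x v = dRaw a (f x) fun i => D f x (v i) := by
  have h1 : ∀ (z : Fin q → E) (w : E), D (fun y => a (f y) fun i => D f y (z i)) x w =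
      D (fun y => a y fun i => D f x (z i)) (f x) (D f x w) +
        ∑ k, a (f x) (Function.update (fun i => D f x (z i)) k
          (D (fun y => D f y (z k)) x w)) := by
    intro z w
    have hz : ∀ i, SmoothAt (fun y => D f y (z i)) x := fun i => hf.D_right _
    have hpi : SmoothAt (fun y => fun i => D f y (z i)) x := SmoothAt.pi hz
    rw [D_comp (f := fun y => (f y, fun i => D f y (z i)))
      (g := fun p : F × (Fin q → F) => a p.1 p.2) (ha _) (hf.prodMk hpi), D_prodMk hf hpi,
      D_pi hz, D_left, ← D_alt ha hA (fun i => D f x (z i)) (fun i => D (fun y => D f y (z i)) x w),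
      ← (ha _).D_add]
    simp
  have h2 : ∑ i : Fin (q + 1), (-1 : ℝ) ^ (i : ℕ) * ∑ k, a (f x) (Function.update
      (fun j => D f x (i.removeNth v j)) k (D (fun y => D f y (i.removeNth v k)) x (v i))) = 0 := by
    obtain ⟨β, hβ⟩ := hA
    cases q with
    | zero => simp
    | succ n =>
      rw [← sum_removeNth_eq_zero (fun u w z => β (Matrix.vecCons
        (D (fun y => D f y w) x u) fun i => D f x (z i)))
        (fun u w z => by simp only [hf.D_symm u w]) v]
      refine Finset.sum_congr rfl fun i _ => ?_
      congr 1
      refine Finset.sum_congr rfl fun k _ => ?_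
      rw [← hβ, ← Fin.insertNth_removeNth, β.map_insertNth, zsmul_eq_mul]
      push_cast
      rfl
  unfold dRaw
  simp only [h1, mul_add, Finset.sum_add_distrib, h2, add_zero]
  rfl

end LocalForms

/-! ### Smooth functions with values in the circle -/

section Products

variable {E : Type u} [AddCommGroup E] [Module ℝ E] [TopologicalSpace E]

theorem CkOn.mul {k : ℕ} {f g : E → ℂ} {U : Set E} (hf : CkOn k f U) (hg : CkOn k g U) :
    CkOn k (fun x => f x * g x) U := by
  induction k generalizing E with
  | zero => exact ContinuousOn.mul hf hg
  | succ k ih =>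
    have hf0 := hf.of_succ
    have hg0 := hg.of_succ
    obtain ⟨hfc, f1, hf1, hfk⟩ := hf
    obtain ⟨hgc, g1, hg1, hgk⟩ := hg
    have hfst : ∀ {h : E → ℂ}, CkOn k h U → CkOn k (fun p : E × E × ℝ => h p.1)
        {p : E × E × ℝ | p.1 ∈ U ∧ p.1 + p.2.2 • p.2.1 ∈ U} := fun hh =>
      (hh.comp_linear (ContinuousLinearMap.fst ℝ E (E × ℝ))).mono fun p hp => hp.1
    have ht : CkOn k (fun p : E × E × ℝ => (p.2.2 : ℂ))
        {p : E × E × ℝ | p.1 ∈ U ∧ p.1 + p.2.2 • p.2.1 ∈ U} :=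
      CkOn.linear (Complex.ofRealCLM.comp ((ContinuousLinearMap.snd ℝ E ℝ).comp
        (ContinuousLinearMap.snd ℝ E (E × ℝ)))) _
    have hsum : ∀ {a b : E × E × ℝ → ℂ} {V : Set (E × E × ℝ)}, CkOn k a V → CkOn k b V →
        CkOn k (fun p => a p + b p) V := fun ha hb =>
      (CkOn.linear (ContinuousLinearMap.fst ℝ ℂ ℂ + ContinuousLinearMap.snd ℝ ℂ ℂ)
        Set.univ).comp (ha.prodMk hb) fun _ _ => trivial
    refine ⟨hfc.mul hgc, fun p => f1 p * g p.1 + f p.1 * g1 p + p.2.2 * (f1 p * g1 p),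
      fun x v t hx hxt => ?_, hsum (hsum (ih hfk (hfst hg0)) (ih (hfst hf0) hgk))
        (ih ht (ih hfk hgk))⟩
    have e1 := hf1 x v t hx hxt
    have e2 := hg1 x v t hx hxt
    rw [sub_eq_iff_eq_add] at e1 e2
    simp only [Complex.real_smul] at e1 e2 ⊢
    rw [e1, e2]
    ring

theorem SmoothAt.mul {f g : E → ℂ} {x : E} (hf : SmoothAt f x) (hg : SmoothAt g x) :
    SmoothAt (fun y => f y * g y) x := by
  obtain ⟨U, hU, hx, hk⟩ := hf
  obtain ⟨V, hV, hx', hk'⟩ := hg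
  exact ⟨U ∩ V, hU.inter hV, ⟨hx, hx'⟩, fun k =>
    ((hk k).mono Set.inter_subset_left).mul ((hk' k).mono Set.inter_subset_right)⟩

theorem D_mul [IsTopologicalAddGroup E] [ContinuousSMul ℝ E] {f g : E → ℂ} {x : E}
    (hf : SmoothAt f x) (hg : SmoothAt g x) (v : E) :
    D (fun y => f y * g y) x v = D f x v * g x + f x * D g x v := by
  have h0 : Tendsto (fun t : ℝ => g (x + t • v)) (𝓝[≠] 0) (𝓝 (g x)) :=
    (hg.continuousAt.tendsto.comp (tendsto_add_smul x v)).mono_left nhdsWithin_le_nhds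
  refine D_eq ((((hf.tendsto v).mul h0).add ((hg.tendsto v).const_mul (f x))).congr fun t => ?_)
  simp only [Complex.real_smul]
  ring

end Products

section Circle

variable {E : Type u} [AddCommGroup E] [Module ℝ E] [TopologicalSpace E]
  [IsTopologicalAddGroup E] [ContinuousSMul ℝ E]

/-- The form `(1 / 2πi) d log h` for a function `h` of absolute value one. -/
noncomputable def dlogRaw {E : Type u} [AddCommGroup E] [Module ℝ E] (h : E → ℂ) (x : E)
    (v : Fin 1 → E) : ℝ :=
  (1 / (2 * Real.pi * Complex.I) * ((h x)⁻¹ * D h x (v 0))).re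

theorem dlogRaw_eq {h : E → ℂ} {x : E} (h1 : ‖h x‖ = 1) (v : Fin 1 → E) :
    dlogRaw h x v = (2 * Real.pi)⁻¹ * (starRingEnd ℂ (h x) * D h x (v 0)).im := by
  have e : (1 / (2 * Real.pi * Complex.I) : ℂ) = (((2 * Real.pi)⁻¹ : ℝ) : ℂ) * (-Complex.I) := by
    have : (Real.pi : ℂ) ≠ 0 := by exact_mod_cast Real.pi_ne_zero
    push_cast
    field_simp
    simp
  rw [dlogRaw, e, Complex.inv_eq_conj h1, mul_assoc, Complex.re_ofReal_mul]
  simp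

theorem dlogRaw_smooth {h : E → ℂ} {x : E} (hs : SmoothAt h x) (h1 : ∀ y, ‖h y‖ = 1)
    (v : Fin 1 → E) : SmoothAt (fun p : E × (Fin 1 → E) => dlogRaw h p.1 p.2) (x, v) := by
  have e : (fun p : E × (Fin 1 → E) => dlogRaw h p.1 p.2) = fun p =>
      ((2 * Real.pi)⁻¹ • Complex.imCLM) (starRingEnd ℂ (h p.1) * D h p.1 (p.2 0)) := by
    ext p
    rw [dlogRaw_eq (h1 _)]
    simp
  rw [e]
  refine (SmoothAt.linear ((2 * Real.pi)⁻¹ • Complex.imCLM) _).comp (SmoothAt.mul ?_ ?_)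
  · exact (SmoothAt.linear (Complex.conjCLE : ℂ →L[ℝ] ℂ) _).comp
      (f := fun p : E × (Fin 1 → E) => h p.1)
      (SmoothAt.comp (f := fun p : E × (Fin 1 → E) => p.1) hs
        (SmoothAt.linear (ContinuousLinearMap.fst ℝ E (Fin 1 → E)) _))
  · exact SmoothAt.comp (g := fun p : E × E => D h p.1 p.2) (x := (x, v))
      (f := fun p : E × (Fin 1 → E) => (p.1, p.2 0)) (hs.D (v 0))
      (SmoothAt.linear ((ContinuousLinearMap.fst ℝ E (Fin 1 → E)).prod
        ((ContinuousLinearMap.proj 0).comp (ContinuousLinearMap.snd ℝ E (Fin 1 → E)))) _)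

theorem dlogRaw_isAlt {h : E → ℂ} {x : E} (hs : SmoothAt h x) : IsAlt (dlogRaw h x) := by
  refine ⟨AlternatingMap.ofSubsingleton ℝ E ℝ (0 : Fin 1)
    { toFun := fun v => (1 / (2 * Real.pi * Complex.I) * ((h x)⁻¹ * D h x v)).re
      map_add' := fun v w => by rw [hs.D_add, mul_add, mul_add, Complex.add_re]
      map_smul' := fun c v => by
        rw [hs.D_smul, mul_smul_comm, mul_smul_comm, Complex.smul_re]; rfl }, fun v => rfl⟩

theorem dlogRaw_mul {h k : E → ℂ} {x : E} (hs : SmoothAt h x) (ks : SmoothAt k x)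
    (h1 : ‖h x‖ = 1) (k1 : ‖k x‖ = 1) (v : Fin 1 → E) :
    dlogRaw (fun y => h y * k y) x v = dlogRaw h x v + dlogRaw k x v := by
  have hh : h x ≠ 0 := fun e => by simp [e] at h1
  have kk : k x ≠ 0 := fun e => by simp [e] at k1
  unfold dlogRaw
  rw [D_mul hs ks, ← Complex.add_re, ← mul_add]
  congr 2
  field_simp

theorem dRaw_dlogRaw {h : E → ℂ} {x : E} (hs : SmoothAt h x) (h1 : ∀ y, ‖h y‖ = 1)
    (v : Fin 2 → E) : dRaw (dlogRaw h) x v = 0 := by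
  have hc : SmoothAt (fun y => starRingEnd ℂ (h y)) x :=
    (SmoothAt.linear (Complex.conjCLE : ℂ →L[ℝ] ℂ) _).comp hs
  have hcD : ∀ u : E, D (fun y => starRingEnd ℂ (h y)) x u = starRingEnd ℂ (D h x u) := fun u =>
    (D_comp (SmoothAt.linear (Complex.conjCLE : ℂ →L[ℝ] ℂ) _) hs u).trans
      (D_linear (Complex.conjCLE : ℂ →L[ℝ] ℂ) _ _)
  have hD : ∀ u w : E, D (fun y => dlogRaw h y fun _ : Fin 1 => w) x u =
      (2 * Real.pi)⁻¹ * (starRingEnd ℂ (D h x u) * D h x w +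
        starRingEnd ℂ (h x) * D (fun y => D h y w) x u).im := by
    intro u w
    have e : (fun y => dlogRaw h y fun _ : Fin 1 => w) = fun y =>
        ((2 * Real.pi)⁻¹ • Complex.imCLM) (starRingEnd ℂ (h y) * D h y w) := by
      ext y
      rw [dlogRaw_eq (h1 _)]
      simp
    rw [e, D_comp (SmoothAt.linear _ _) (hc.mul (hs.D_right w)), D_linear,
      D_mul hc (hs.D_right w), hcD]
    simp
  have hv : ∀ i : Fin 2, i.removeNth v = fun _ : Fin 1 => v (i.succAbove 0) := fun i => by
    ext j
    rw [Subsingleton.elim j 0]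
    rfl
  -- the derivative of `h` is orthogonal to `h`
  have ho : ∀ u : E, (starRingEnd ℂ (h x) * D h x u).re = 0 := by
    intro u
    have e : (fun y => starRingEnd ℂ (h y) * h y) = fun _ => 1 := by
      ext y
      rw [← Complex.normSq_eq_conj_mul_self, Complex.normSq_eq_norm_sq, h1]
      simp
    have e2 := D_mul hc hs u
    rw [e, D_const, hcD] at e2
    have e3 := congrArg Complex.re e2
    simp only [Complex.zero_re, Complex.add_re, Complex.mul_re, Complex.conj_re,
      Complex.conj_im] at e3 ⊢
    linarith
  have hn : (starRingEnd ℂ (h x) * h x) = 1 := by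
    rw [← Complex.normSq_eq_conj_mul_self, Complex.normSq_eq_norm_sq, h1]
    simp
  have hz : ∀ u w : E, (starRingEnd ℂ (D h x u) * D h x w).im = 0 := by
    intro u w
    have e : starRingEnd ℂ (D h x u) * D h x w =
        starRingEnd ℂ (starRingEnd ℂ (h x) * D h x u) * (starRingEnd ℂ (h x) * D h x w) := by
      rw [map_mul, Complex.conj_conj]
      linear_combination (-(starRingEnd ℂ (D h x u) * D h x w)) * hn
    rw [e, Complex.mul_im, Complex.conj_re, ho u, ho w]
    simp
  unfold dRaw
  rw [Fin.sum_univ_two, hv, hv, hD, hD, Complex.add_im, Complex.add_im, hz, hz,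
    hs.D_symm _ (v (Fin.succAbove 1 0))]
  simp [Fin.succAbove]

end Circle

/-! ### Manifolds with vertical directions -/

/-- A smooth manifold `X` modelled on a Hausdorff locally convex space `E`, with an atlas of charts
(one chart `chart x` is chosen around each point `x`), and with a subspace `vert` of *vertical*
vectors of `E` that the coordinate changes preserve: charts adapted to a submersion onto a base,
`vert` being the kernel of its differential. -/
structure FMfd : Type (u + 1) where
  E : Type u
  [grp : AddCommGroup E]
  [mod : Module ℝ E]
  [top : TopologicalSpace E]
  [tgrp : IsTopologicalAddGroup E]
  [csmul : ContinuousSMul ℝ E]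
  [t2 : T2Space E]
  [lc : LocallyConvexSpace ℝ E]
  X : Type u
  [topX : TopologicalSpace X]
  chart : X → OpenPartialHomeomorph X E
  mem_source : ∀ x, x ∈ (chart x).source
  compat : ∀ x y, ∀ z ∈ ((chart x).symm.trans (chart y)).source,
    SmoothAt (fun z => chart y ((chart x).symm z)) z
  vert : Submodule ℝ E
  vert_mem : ∀ x y, ∀ z ∈ ((chart x).symm.trans (chart y)).source, ∀ v ∈ vert,
    D (fun z => chart y ((chart x).symm z)) z v ∈ vert

attribute [instance] FMfd.grp FMfd.mod FMfd.top FMfd.tgrp FMfd.csmul FMfd.t2 FMfd.lc FMfd.topX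

namespace FMfd

section Plots

variable {X Y Z : FMfd.{u}}
variable {E : Type u} [AddCommGroup E] [Module ℝ E] [TopologicalSpace E]

/-- The map `p` from a locally convex space to the manifold `X` is smooth near `z`. -/
def PlotAt (X : FMfd.{u}) {E : Type u} [AddCommGroup E] [Module ℝ E] [TopologicalSpace E]
    (p : E → X.X) (z : E) : Prop :=
  ContinuousAt p z ∧ SmoothAt (fun y => X.chart (p z) (p y)) z

theorem compat_at (x y w : X.X) (hx : w ∈ (X.chart x).source) (hy : w ∈ (X.chart y).source) :
    SmoothAt (fun z => X.chart y ((X.chart x).symm z)) (X.chart x w) :=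
  X.compat x y _ (by simp [hx, hy])

theorem PlotAt.smoothAt_chart {p : E → X.X} {z : E} (h : X.PlotAt p z) (x : X.X)
    (hx : p z ∈ (X.chart x).source) : SmoothAt (fun y => X.chart x (p y)) z := by
  refine ((compat_at (p z) x (p z) (X.mem_source _) hx).comp
    (f := fun y => X.chart (p z) (p y)) h.2).congr ?_
  filter_upwards [h.1 ((X.chart (p z)).open_source.mem_nhds (X.mem_source _))] with y hy
  rw [(X.chart (p z)).left_inv hy]

theorem plotAt_of_chart {p : E → X.X} {z : E} (hc : ContinuousAt p z) (x : X.X)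
    (hx : p z ∈ (X.chart x).source) (h : SmoothAt (fun y => X.chart x (p y)) z) :
    X.PlotAt p z := by
  refine ⟨hc, ((compat_at x (p z) (p z) hx (X.mem_source _)).comp
    (f := fun y => X.chart x (p y)) h).congr ?_⟩
  filter_upwards [hc ((X.chart x).open_source.mem_nhds hx)] with y hy
  rw [(X.chart x).left_inv hy]

theorem PlotAt.eventually {p : E → X.X} {z : E} (h : X.PlotAt p z) :
    ∀ᶠ y in 𝓝 z, X.PlotAt p y := by
  have h1 := h.1 ((X.chart (p z)).open_source.mem_nhds (X.mem_source _))
  filter_upwards [eventually_eventually_nhds.2 h1, h.2.eventually] with y hy hs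
  have hy' : p y ∈ (X.chart (p z)).source := hy.self_of_nhds
  refine plotAt_of_chart (x := p z) ?_ hy' hs
  refine ContinuousAt.congr (f := fun w => (X.chart (p z)).symm (X.chart (p z) (p w))) ?_ ?_
  · exact ContinuousAt.comp (f := fun w => X.chart (p z) (p w))
      ((X.chart (p z)).continuousAt_symm ((X.chart (p z)).map_source hy')) hs.continuousAt
  · filter_upwards [hy] with w hw using (X.chart (p z)).left_inv hw

theorem plotAt_symm (x : X.X) {z : X.E} (hz : z ∈ (X.chart x).target) :
    X.PlotAt (X.chart x).symm z := by
  refine plotAt_of_chart ((X.chart x).continuousAt_symm hz) x ((X.chart x).map_target hz) ?_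
  refine (SmoothAt.linear (ContinuousLinearMap.id ℝ X.E) z).congr ?_
  filter_upwards [(X.chart x).open_target.mem_nhds hz] with y hy using (X.chart x).right_inv hy

theorem chart_mem_target (x : X.X) : X.chart x x ∈ (X.chart x).target :=
  (X.chart x).map_source (X.mem_source x)

theorem symm_chart (x : X.X) : (X.chart x).symm (X.chart x x) = x :=
  (X.chart x).left_inv (X.mem_source x)

/-- The differential at `x` of a map `f : X → Y`; the tangent spaces of `X` at `x` and of `Y` at
`f x` are identified with the model spaces by the chosen charts. -/
noncomputable def T (f : X.X → Y.X) (x : X.X) (v : X.E) : Y.E :=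
  D (fun z => Y.chart (f x) (f ((X.chart x).symm z))) (X.chart x x) v

/-- The map `f : X → Y` is smooth. -/
def Smooth (f : X.X → Y.X) : Prop := ∀ x, Y.PlotAt (fun z => f ((X.chart x).symm z)) (X.chart x x)

theorem Smooth.plotAt {f : X.X → Y.X} (hf : Smooth f) {p : E → X.X} {z : E} (hp : X.PlotAt p z) :
    Y.PlotAt (fun y => f (p y)) z := by
  have h1 := hf (p z)
  have h2 : ∀ᶠ y in 𝓝 z, p y ∈ (X.chart (p z)).source :=
    hp.1 ((X.chart (p z)).open_source.mem_nhds (X.mem_source _))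
  have e : (fun y => f (p y)) =ᶠ[𝓝 z] fun y => f ((X.chart (p z)).symm (X.chart (p z) (p y))) := by
    filter_upwards [h2] with y hy using by rw [(X.chart (p z)).left_inv hy]
  refine plotAt_of_chart (x := f (p z)) (ContinuousAt.congr ?_ e.symm) (Y.mem_source _) ?_
  · exact ContinuousAt.comp (f := fun y => X.chart (p z) (p y))
      (g := fun w => f ((X.chart (p z)).symm w)) h1.1 hp.2.continuousAt
  · have h3 := h1.smoothAt_chart (f (p z)) (by rw [symm_chart]; exact Y.mem_source _)
    refine (SmoothAt.comp (f := fun y => X.chart (p z) (p y)) h3 hp.2).congr ?_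
    filter_upwards [e] with y hy using by rw [hy]

theorem Smooth.continuous {f : X.X → Y.X} (hf : Smooth f) : Continuous f := by
  refine continuous_iff_continuousAt.2 fun x => ?_
  refine ContinuousAt.congr (f := fun y => f ((X.chart x).symm (X.chart x y))) ?_ ?_
  · exact ContinuousAt.comp (g := fun w => f ((X.chart x).symm w)) (hf x).1
      ((X.chart x).continuousAt (X.mem_source x))
  · filter_upwards [(X.chart x).open_source.mem_nhds (X.mem_source x)] with y hy
    rw [(X.chart x).left_inv hy]

theorem Smooth.comp {f : X.X → Y.X} {g : Y.X → Z.X} (hg : Smooth g) (hf : Smooth f) :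
    Smooth fun x => g (f x) := fun x => hg.plotAt (hf x)

theorem smooth_id : Smooth fun x : X.X => x := fun x => plotAt_symm x (chart_mem_target x)

variable [IsTopologicalAddGroup E] [ContinuousSMul ℝ E]

/-- The chain rule. -/
theorem Smooth.D_plot {f : X.X → Y.X} (hf : Smooth f) {p : E → X.X} {z : E} (hp : X.PlotAt p z)
    (v : E) : D (fun y => Y.chart (f (p z)) (f (p y))) z v =
      T f (p z) (D (fun y => X.chart (p z) (p y)) z v) := by
  have h2 : ∀ᶠ y in 𝓝 z, p y ∈ (X.chart (p z)).source :=
    hp.1 ((X.chart (p z)).open_source.mem_nhds (X.mem_source _))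
  have h3 := (hf (p z)).smoothAt_chart (f (p z)) (by rw [symm_chart]; exact Y.mem_source _)
  rw [T, ← D_comp (f := fun y => X.chart (p z) (p y)) h3 hp.2]
  refine D_congr ?_ v
  filter_upwards [h2] with y hy using by rw [(X.chart (p z)).left_inv hy]

theorem T_id (x : X.X) (v : X.E) : T (fun x : X.X => x) x v = v := by
  refine Eq.trans (D_congr (g := ContinuousLinearMap.id ℝ X.E) ?_ v) (D_linear _ _ _)
  filter_upwards [(X.chart x).open_target.mem_nhds (chart_mem_target x)] with y hy
    using (X.chart x).right_inv hy

theorem T_comp {f : X.X → Y.X} {g : Y.X → Z.X} (hg : Smooth g) (hf : Smooth f) (x : X.X)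
    (v : X.E) : T (fun x => g (f x)) x v = T g (f x) (T f x v) := by
  have := hg.D_plot (hf x) v
  rw [symm_chart] at this
  exact this

theorem Smooth.T_add {f : X.X → Y.X} (hf : Smooth f) (x : X.X) (v w : X.E) :
    T f x (v + w) = T f x v + T f x w :=
  ((hf x).smoothAt_chart (f x) (by rw [symm_chart]; exact Y.mem_source _)).D_add v w

theorem Smooth.T_smul {f : X.X → Y.X} (hf : Smooth f) (x : X.X) (c : ℝ) (v : X.E) :
    T f x (c • v) = c • T f x v :=
  ((hf x).smoothAt_chart (f x) (by rw [symm_chart]; exact Y.mem_source _)).D_smul c v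

end Plots

/-- Smooth maps whose differentials preserve vertical vectors. -/
@[ext]
structure Hom (X Y : FMfd.{u}) : Type u where
  f : X.X → Y.X
  smooth : Smooth f
  vert : ∀ x, ∀ v ∈ X.vert, T f x v ∈ Y.vert

instance : Category.{u} FMfd.{u} where
  Hom := Hom
  id X := ⟨fun x => x, smooth_id, fun x v hv => by rwa [T_id]⟩
  comp F G := ⟨fun x => G.f (F.f x), G.smooth.comp F.smooth, fun x v hv => by
    rw [T_comp G.smooth F.smooth]
    exact G.vert _ _ (F.vert _ _ hv)⟩

/-! ### Germs of differential forms -/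

section Forms

variable {X Y : FMfd.{u}} {q : ℕ}
variable {E : Type u} [AddCommGroup E] [Module ℝ E] [TopologicalSpace E]

/-- The pull-back of a `q`-form `w` on `X` along a map `p` from a locally convex space. -/
noncomputable def pb (p : E → X.X) (w : X.X → (Fin q → X.E) → ℝ) (z : E) (v : Fin q → E) : ℝ :=
  w (p z) fun i => D (fun y => X.chart (p z) (p y)) z (v i)

/-- Near `x`, the function `w` is a smooth `q`-form: its local expression in the chart at `x` is
smooth, and it is alternating and multilinear at each point. It is required to vanish if `N < q`,
and, if `vertical` holds, to vanish on any `q` vertical vectors. -/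
def FormAt (N : ℕ) (vertical : Prop) (q : ℕ) (X : FMfd.{u}) (w : X.X → (Fin q → X.E) → ℝ)
    (x : X.X) : Prop :=
  (∀ v, SmoothAt (fun p : X.E × (Fin q → X.E) => pb (X.chart x).symm w p.1 p.2)
    (X.chart x x, v)) ∧ IsAlt (w x) ∧ (N < q → w x = 0) ∧
  (vertical → ∀ v, (∀ i, v i ∈ X.vert) → w x v = 0)

/-- The exterior derivative, computed at each point in the chart at that point. -/
noncomputable def dForm (w : X.X → (Fin q → X.E) → ℝ) (x : X.X) : (Fin (q + 1) → X.E) → ℝ :=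
  dRaw (pb (X.chart x).symm w) (X.chart x x)

/-- The pull-back of a form along `f : X → Y`. -/
noncomputable def pullForm (f : X.X → Y.X) (w : Y.X → (Fin q → Y.E) → ℝ) (x : X.X)
    (v : Fin q → X.E) : ℝ := w (f x) fun i => T f x (v i)

variable [IsTopologicalAddGroup E] [ContinuousSMul ℝ E]

theorem pb_chart (w : X.X → (Fin q → X.E) → ℝ) {p : E → X.X} {z : E} (hp : X.PlotAt p z)
    (x : X.X) (hx : p z ∈ (X.chart x).source) (v : Fin q → E) :
    pb p w z v = pb (X.chart x).symm w (X.chart x (p z))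
      fun i => D (fun y => X.chart x (p y)) z (v i) := by
  have hp' := hp.smoothAt_chart x hx
  unfold pb
  rw [(X.chart x).left_inv hx]
  congr 1
  ext i
  rw [← D_comp (f := fun y => X.chart x (p y)) (compat_at x (p z) (p z) hx (X.mem_source _)) hp']
  refine D_congr ?_ _
  filter_upwards [hp.1 ((X.chart x).open_source.mem_nhds hx)] with y hy
  rw [(X.chart x).left_inv hy]

theorem pb_smooth (w : X.X → (Fin q → X.E) → ℝ) {p : E → X.X} {z : E} (hp : X.PlotAt p z)
    (hw : ∀ v, SmoothAt (fun r : X.E × (Fin q → X.E) => pb (X.chart (p z)).symm w r.1 r.2)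
      (X.chart (p z) (p z), v)) (v : Fin q → E) :
    SmoothAt (fun r : E × (Fin q → E) => pb p w r.1 r.2) (z, v) := by
  have hfst : SmoothAt (fun r : E × (Fin q → E) => X.chart (p z) (p r.1)) (z, v) :=
    SmoothAt.comp (x := (z, v)) (f := fun r : E × (Fin q → E) => r.1)
      (g := fun y => X.chart (p z) (p y)) hp.2
      (SmoothAt.linear (ContinuousLinearMap.fst ℝ E (Fin q → E)) _)
  have hsnd : SmoothAt (fun r : E × (Fin q → E) => fun i =>
      D (fun y => X.chart (p z) (p y)) r.1 (r.2 i)) (z, v) := SmoothAt.pi fun i =>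
    SmoothAt.comp (x := (z, v)) (f := fun r : E × (Fin q → E) => (r.1, r.2 i))
      (g := fun r : E × E => D (fun y => X.chart (p z) (p y)) r.1 r.2) (hp.2.D (v i))
      (SmoothAt.linear ((ContinuousLinearMap.fst ℝ E (Fin q → E)).prod
        ((ContinuousLinearMap.proj i).comp (ContinuousLinearMap.snd ℝ E (Fin q → E)))) _)
  refine (SmoothAt.comp (x := (z, v)) (f := fun r : E × (Fin q → E) =>
    (X.chart (p z) (p r.1), fun i => D (fun y => X.chart (p z) (p y)) r.1 (r.2 i)))
    (g := fun r : X.E × (Fin q → X.E) => pb (X.chart (p z)).symm w r.1 r.2)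
    (hw _) (hfst.prodMk hsnd)).congr ?_
  have h1 : ∀ᶠ y in 𝓝 z, X.PlotAt p y ∧ p y ∈ (X.chart (p z)).source :=
    hp.eventually.and (hp.1 ((X.chart (p z)).open_source.mem_nhds (X.mem_source _)))
  filter_upwards [(continuous_fst.tendsto (z, v)).eventually h1] with r hr
  exact pb_chart w hr.1 (p z) hr.2 r.2

theorem pb_isAlt {w : X.X → (Fin q → X.E) → ℝ} {p : E → X.X} {z : E} (hp : X.PlotAt p z)
    (hw : IsAlt (w (p z))) : IsAlt (pb p w z) :=
  hw.comp _ (fun v w => hp.2.D_add v w) fun c v => hp.2.D_smul c v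

theorem pb_pull (w : Y.X → (Fin q → Y.E) → ℝ) {f : X.X → Y.X} (hf : Smooth f) {p : E → X.X}
    {z : E} (hp : X.PlotAt p z) : pb p (pullForm f w) z = pb (fun y => f (p y)) w z := by
  ext v
  unfold pb pullForm
  congr 1
  ext i
  rw [hf.D_plot hp]

theorem dRaw_pb {w : X.X → (Fin q → X.E) → ℝ} {p : E → X.X} {z : E} [T2Space E]
    (hp : X.PlotAt p z)
    (hw : ∀ v, SmoothAt (fun r : X.E × (Fin q → X.E) => pb (X.chart (p z)).symm w r.1 r.2)
      (X.chart (p z) (p z), v)) (hA : IsAlt (w (p z))) :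
    dRaw (pb p w) z = pb p (dForm w) z := by
  ext v
  have hA' : IsAlt (pb (X.chart (p z)).symm w (X.chart (p z) (p z))) :=
    pb_isAlt (plotAt_symm _ (chart_mem_target _)) (by rwa [symm_chart])
  refine Eq.trans ?_ (dRaw_pullback (f := fun y => X.chart (p z) (p y)) hw hA' hp.2 v)
  refine congrFun (dRaw_congr ?_) v
  filter_upwards [hp.eventually,
    hp.1 ((X.chart (p z)).open_source.mem_nhds (X.mem_source _))] with y hy hy'
  ext u
  exact pb_chart w hy (p z) hy' u

variable {N : ℕ} {b : Prop}

theorem FormAt.pull {f : X ⟶ Y} {w : Y.X → (Fin q → Y.E) → ℝ} {x : X.X}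
    (h : FormAt N b q Y w (f.f x)) : FormAt N b q X (pullForm f.f w) x := by
  have hc := plotAt_symm x (chart_mem_target x)
  refine ⟨fun v => ?_, h.2.1.comp _ (f.smooth.T_add x) (f.smooth.T_smul x), fun hq => ?_,
    fun hb v hv => h.2.2.2 hb _ fun i => f.vert _ _ (hv i)⟩
  · have h1 := pb_smooth w (f.smooth x) (by rw [symm_chart]; exact h.1) v
    refine h1.congr ?_
    filter_upwards [(continuous_fst.tendsto (X.chart x x, v)).eventually
      hc.eventually] with r hr
    rw [pb_pull w f.smooth hr]
  · ext v
    simp [pullForm, h.2.2.1 hq]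

theorem dForm_congr {w w' : X.X → (Fin q → X.E) → ℝ} {x : X.X} (h : ∀ᶠ y in 𝓝 x, w y = w' y) :
    dForm w x = dForm w' x := by
  refine dRaw_congr ?_
  have hc := (plotAt_symm x (chart_mem_target x)).1
  rw [ContinuousAt, symm_chart] at hc
  filter_upwards [hc.eventually h] with z hz
  ext v
  simp [pb, hz]

theorem eventually_chart {P : X.X → Prop} {x : X.X} (h : ∀ᶠ y in 𝓝 x, P y) :
    ∀ᶠ z in 𝓝 (X.chart x x), z ∈ (X.chart x).target ∧ P ((X.chart x).symm z) := by
  have hc := (plotAt_symm x (chart_mem_target x)).1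
  rw [ContinuousAt, symm_chart] at hc
  exact Filter.Eventually.and ((X.chart x).open_target.mem_nhds (chart_mem_target x))
    (hc.eventually h)

theorem pb_dForm {w : X.X → (Fin q → X.E) → ℝ} {x : X.X}
    (h : ∀ᶠ y in 𝓝 x, FormAt N b q X w y) : ∀ᶠ z in 𝓝 (X.chart x x),
      pb (X.chart x).symm (dForm w) z = dRaw (pb (X.chart x).symm w) z := by
  filter_upwards [eventually_chart h] with z hz
  exact (dRaw_pb (plotAt_symm x hz.1) hz.2.1 hz.2.2.1).symm

theorem FormAt.d {w : X.X → (Fin q → X.E) → ℝ} {x : X.X} (hN : q + 1 ≤ N)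
    (h : ∀ᶠ y in 𝓝 x, FormAt N b q X w y) : FormAt N b (q + 1) X (dForm w) x := by
  have h0 := h.self_of_nhds
  have hev := eventually_chart h
  refine ⟨fun v => ?_, ?_, fun hq => absurd hq (by omega), fun hb v hv => ?_⟩
  · refine (dRaw_smooth h0.1 v).congr ?_
    filter_upwards [(continuous_fst.tendsto (X.chart x x, v)).eventually
      (pb_dForm h)] with r hr
    rw [hr]
  · refine dRaw_isAlt h0.1 ?_
    filter_upwards [hev] with z hz using pb_isAlt (plotAt_symm x hz.1) hz.2.2.1
  · unfold dForm dRaw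
    refine Finset.sum_eq_zero fun i _ => ?_
    rw [← D_const (0 : ℝ) (X.chart x x) (v i), D_congr (g := fun _ => 0), D_const, mul_zero]
    filter_upwards [hev] with z hz
    refine hz.2.2.2.2 hb _ fun j => ?_
    exact X.vert_mem x _ z (by simpa [hz.1] using X.mem_source _) _ (hv _)

theorem dForm_pull {f : X ⟶ Y} {w : Y.X → (Fin q → Y.E) → ℝ} {x : X.X}
    (h : FormAt N b q Y w (f.f x)) : dForm (pullForm f.f w) x = pullForm f.f (dForm w) x := by
  have h1 := dRaw_pb (p := fun z => f.f ((X.chart x).symm z)) (w := w) (z := X.chart x x)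
    (f.smooth x) (by rw [symm_chart]; exact h.1) (by rw [symm_chart]; exact h.2.1)
  have h2 : dForm (pullForm f.f w) x = dRaw (pb (fun z => f.f ((X.chart x).symm z)) w)
      (X.chart x x) := dRaw_congr (by
    filter_upwards [(plotAt_symm x (chart_mem_target x)).eventually] with z hz
      using pb_pull w f.smooth hz)
  rw [h2, h1]
  ext v
  simp only [pb, pullForm, T, symm_chart]

theorem dForm_dForm {w : X.X → (Fin q → X.E) → ℝ} {x : X.X}
    (h : ∀ᶠ y in 𝓝 x, FormAt N b q X w y) : dForm (dForm w) x = 0 := by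
  ext v
  exact (congrFun (dRaw_congr (pb_dForm h)) v).trans (dRaw_dRaw h.self_of_nhds.1 v)

theorem FormAt.add {w w' : X.X → (Fin q → X.E) → ℝ} {x : X.X} (h : FormAt N b q X w x)
    (h' : FormAt N b q X w' x) : FormAt N b q X (w + w') x :=
  ⟨fun v => (h.1 v).add (h'.1 v), h.2.1.add h'.2.1, fun hq => by
    rw [Pi.add_apply, h.2.2.1 hq, h'.2.2.1 hq, add_zero], fun hb v hv => by
    rw [Pi.add_apply, Pi.add_apply, h.2.2.2 hb v hv, h'.2.2.2 hb v hv, add_zero]⟩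

theorem FormAt.neg {w : X.X → (Fin q → X.E) → ℝ} {x : X.X} (h : FormAt N b q X w x) :
    FormAt N b q X (-w) x :=
  ⟨fun v => ((h.1 v).smul (-1 : ℝ)).congr (.of_forall fun _ => by simp [pb]), h.2.1.neg,
    fun hq => by rw [Pi.neg_apply, h.2.2.1 hq, neg_zero], fun hb v hv => by
    rw [Pi.neg_apply, Pi.neg_apply, h.2.2.2 hb v hv, neg_zero]⟩

theorem formAt_zero (x : X.X) : FormAt N b q X 0 x :=
  ⟨fun _ => SmoothAt.const (0 : ℝ) _, isAlt_zero, fun _ => rfl, fun _ _ _ => rfl⟩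

theorem FormAt.congr {w w' : X.X → (Fin q → X.E) → ℝ} {x : X.X} (h : FormAt N b q X w x)
    (he : ∀ᶠ y in 𝓝 x, w' y = w y) : FormAt N b q X w' x := by
  have e := he.self_of_nhds
  refine ⟨fun v => (h.1 v).congr ?_, by rw [e]; exact h.2.1, by rw [e]; exact h.2.2.1,
    by rw [e]; exact h.2.2.2⟩
  filter_upwards [(continuous_fst.tendsto (X.chart x x, v)).eventually
    (eventually_chart he)] with r hr
  simp [pb, hr.2]

theorem dForm_add {w w' : X.X → (Fin q → X.E) → ℝ} {x : X.X} (h : FormAt N b q X w x)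
    (h' : FormAt N b q X w' x) : dForm (w + w') x = dForm w x + dForm w' x := by
  ext v
  simp only [dForm, dRaw, Pi.add_apply, ← Finset.sum_add_distrib, ← mul_add]
  refine Finset.sum_congr rfl fun i _ => ?_
  congr 1
  exact D_fun_add (smooth_left h.1 _) (smooth_left h'.1 _) _

end Forms

end FMfd

/-! ### Presheaves of sections with local conditions -/

/-- A pair `(X, U)` of a manifold and an open subset. -/
structure OpenMfd : Type (u + 1) where
  X : FMfd.{u}
  U : Opens X.X

namespace OpenMfd

/-- A morphism `(X, U) → (Y, V)` is a morphism `X → Y` that maps `U` to `V`. -/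
@[ext]
structure Hom (A B : OpenMfd.{u}) : Type u where
  f : A.X ⟶ B.X
  mapsTo : ∀ x ∈ A.U, f.f x ∈ B.U

instance : Category.{u} OpenMfd.{u} where
  Hom := Hom
  id A := ⟨𝟙 A.X, fun _ hx => hx⟩
  comp F G := ⟨F.f ≫ G.f, fun x hx => G.mapsTo _ (F.mapsTo x hx)⟩

/-- The open subsets of one manifold. -/
def ofOpens (X : FMfd.{u}) : Opens X.X ⥤ OpenMfd.{u} where
  obj U := ⟨X, U⟩
  map i := ⟨𝟙 X, fun _ hx => i.le hx⟩
  map_id _ := rfl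
  map_comp _ _ := Hom.ext (Category.id_comp _).symm

end OpenMfd

/-- The extension by zero of a function on an open subset. -/
noncomputable def ext0 {X : Type u} [TopologicalSpace X] {A : Type v} [Zero A] (U : Opens X)
    (s : U → A) (x : X) : A :=
  open Classical in if h : x ∈ U then s ⟨x, h⟩ else 0

theorem ext0_mem {X : Type u} [TopologicalSpace X] {A : Type v} [Zero A] {U : Opens X}
    (s : U → A) {x : X} (h : x ∈ U) : ext0 U s x = s ⟨x, h⟩ := dif_pos h

/-- The data of a sheaf on all manifolds at once, functorial for pull-backs: its sections are the
functions `w` with values `w x ∈ A X` that satisfy a local condition `P`. -/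
structure LocSec : Type (u + 1) where
  A : FMfd.{u} → Type u
  [grp : ∀ X, AddCommGroup (A X)]
  P : ∀ X : FMfd.{u}, (X.X → A X) → X.X → Prop
  zero : ∀ X x, P X 0 x
  add : ∀ {X w w' x}, P X w x → P X w' x → P X (w + w') x
  neg : ∀ {X w x}, P X w x → P X (-w) x
  congr : ∀ {X w w' x}, P X w x → (∀ᶠ y in 𝓝 x, w' y = w y) → P X w' x
  pull : ∀ {X Y : FMfd.{u}}, (X ⟶ Y) → X.X → A Y →+ A X
  pull_id : ∀ {X : FMfd.{u}} (x : X.X) (a : A X), pull (𝟙 X) x a = a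
  pull_comp : ∀ {X Y Z : FMfd.{u}} (f : X ⟶ Y) (g : Y ⟶ Z) (x : X.X) (a : A Z),
    pull (f ≫ g) x a = pull f x (pull g (f.f x) a)
  P_pull : ∀ {X Y : FMfd.{u}} (f : X ⟶ Y) {w x}, P Y w (f.f x) →
    P X (fun x => pull f x (w (f.f x))) x

attribute [instance] LocSec.grp

namespace LocSec

variable (S S' S'' : LocSec.{u})

/-- The sections over an open subset. -/
def sec (B : OpenMfd.{u}) : AddSubgroup (B.U → S.A B.X) where
  carrier := {s | ∀ x ∈ B.U, S.P B.X (ext0 B.U s) x}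
  zero_mem' x _ := S.congr (S.zero _ x) (.of_forall fun y => by simp [ext0])
  add_mem' hs ht x hx := S.congr (S.add (hs x hx) (ht x hx)) (by
    filter_upwards [B.U.isOpen.mem_nhds hx] with y hy
    rw [Pi.add_apply, ext0_mem _ hy, ext0_mem _ hy, ext0_mem _ hy, Pi.add_apply])
  neg_mem' hs x hx := S.congr (S.neg (hs x hx)) (by
    filter_upwards [B.U.isOpen.mem_nhds hx] with y hy
    rw [Pi.neg_apply, ext0_mem _ hy, ext0_mem _ hy, Pi.neg_apply])

variable {S S' S''}

theorem sec_of {B : OpenMfd.{u}} {w : B.X.X → S.A B.X} (h : ∀ x ∈ B.U, S.P B.X w x) :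
    (fun x : B.U => w x) ∈ S.sec B := fun x hx => S.congr (h x hx) (by
  filter_upwards [B.U.isOpen.mem_nhds hx] with y hy using ext0_mem _ hy)

variable (S)

/-- The pull-back of sections. -/
def res {B C : OpenMfd.{u}} (F : B ⟶ C) : S.sec C →+ S.sec B where
  toFun s := ⟨fun x => S.pull F.f x (s.1 ⟨F.f.f x, F.mapsTo x x.2⟩), by
    have h := sec_of (S := S) (B := B) (w := fun x => S.pull F.f x (ext0 C.U s.1 (F.f.f x)))
      fun x hx => S.P_pull F.f (s.2 _ (F.mapsTo x hx))
    convert h using 2 with x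
    rw [ext0_mem _ (F.mapsTo x x.2)]⟩
  map_zero' := Subtype.ext (funext fun _ => map_zero _)
  map_add' _ _ := Subtype.ext (funext fun _ => map_add _ _ _)

/-- The presheaf of sections on all open subsets of all manifolds. -/
noncomputable def presheaf : OpenMfd.{u}ᵒᵖ ⥤ AddCommGrpCat.{u} where
  obj B := AddCommGrpCat.of (S.sec B.unop)
  map F := AddCommGrpCat.ofHom (S.res F.unop)
  map_id B := by
    refine AddCommGrpCat.hom_ext (AddMonoidHom.ext fun s => ?_)
    exact Subtype.ext (funext fun x => S.pull_id x.1 (s.1 x))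
  map_comp F G := by
    refine AddCommGrpCat.hom_ext (AddMonoidHom.ext fun s => ?_)
    exact Subtype.ext (funext fun x => S.pull_comp G.unop.f F.unop.f x.1 _)

theorem isSheaf (X : FMfd.{u}) : TopCat.Presheaf.IsSheaf (X := TopCat.of X.X)
    ((OpenMfd.ofOpens X).op ⋙ S.presheaf) := by
  rw [TopCat.Presheaf.isSheaf_iff_isSheafUniqueGluing]
  intro ι U sf hc
  have hval : ∀ (i j : ι) (x : X.X) (hi : x ∈ U i) (hj : x ∈ U j),
      (sf i).1 ⟨x, hi⟩ = (sf j).1 ⟨x, hj⟩ := by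
    intro i j x hi hj
    have h := congrFun (congrArg Subtype.val (hc i j)) ⟨x, hi, hj⟩
    exact ((S.pull_id x _).symm.trans h).trans (S.pull_id x _)
  have hx : ∀ x : (iSup U : Opens (TopCat.of X.X)), ∃ i, x.1 ∈ U i := fun x =>
    Opens.mem_iSup.1 x.2
  choose i hi using hx
  let w : ↥(iSup U) → S.A X := fun x => (sf (i x)).1 ⟨x.1, hi x⟩
  have hw : ∀ (j : ι) (x : X.X) (hj : x ∈ U j) (h : x ∈ iSup U), w ⟨x, h⟩ = (sf j).1 ⟨x, hj⟩ :=
    fun j x hj h => hval _ _ _ _ _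
  refine ⟨⟨w, fun x h => ?_⟩, fun j => ?_, fun t ht => ?_⟩
  · refine S.congr ((sf (i ⟨x, h⟩)).2 x (hi ⟨x, h⟩)) ?_
    filter_upwards [(U (i ⟨x, h⟩)).isOpen.mem_nhds (hi ⟨x, h⟩)] with y hy
    have hy' : y ∈ (iSup U : Opens (TopCat.of X.X)) := (le_iSup U _) hy
    exact (ext0_mem (U := iSup U) w hy').trans ((hw _ _ _ _).trans (ext0_mem _ hy).symm)
  · exact Subtype.ext (funext fun x => (S.pull_id x.1 _).trans (hw _ _ _ _))
  · refine Subtype.ext (funext fun x => ?_)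
    have h := congrFun (congrArg Subtype.val (ht (i x))) ⟨x.1, hi x⟩
    exact (S.pull_id x.1 _).symm.trans h

variable (S')

/-- A local operator between sheaves as above, compatible with pull-backs. -/
structure Op where
  op : ∀ X : FMfd.{u}, (X.X → S.A X) → X.X → S'.A X
  congr : ∀ {X w w' x}, (∀ᶠ y in 𝓝 x, w y = w' y) → op X w x = op X w' x
  mem : ∀ {X w x}, (∀ᶠ y in 𝓝 x, S.P X w y) → S'.P X (op X w) x
  add : ∀ {X w w' x}, S.P X w x → S.P X w' x → op X (w + w') x = op X w x + op X w' x
  pull : ∀ {X Y : FMfd.{u}} (f : X ⟶ Y) {w x}, S.P Y w (f.f x) →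
    op X (fun x => S.pull f x (w (f.f x))) x = S'.pull f x (op Y w (f.f x))

variable {S S'}

/-- The morphism of presheaves defined by a local operator. -/
noncomputable def Op.hom (d : Op S S') : S.presheaf ⟶ S'.presheaf where
  app B := AddCommGrpCat.ofHom (AddMonoidHom.mk' (fun s => ⟨fun x => d.op _ (ext0 B.unop.U s.1) x,
      sec_of fun x hx => d.mem (by
        filter_upwards [B.unop.U.isOpen.mem_nhds hx] with y hy using s.2 y hy)⟩)
    fun s t => Subtype.ext (funext fun x => by
      refine Eq.trans (d.congr ?_) (d.add (s.2 x.1 x.2) (t.2 x.1 x.2))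
      filter_upwards [B.unop.U.isOpen.mem_nhds x.2] with y hy
      rw [Pi.add_apply, ext0_mem _ hy, ext0_mem _ hy, ext0_mem _ hy]
      rfl))
  naturality B C F := by
    ext s
    refine Subtype.ext (funext fun x => ?_)
    refine Eq.trans (d.congr ?_) (d.pull F.unop.f (s.2 _ (F.unop.mapsTo x.1 x.2)))
    filter_upwards [C.unop.U.isOpen.mem_nhds x.2] with y hy
    rw [ext0_mem _ hy, ext0_mem _ (F.unop.mapsTo y hy)]
    rfl

theorem Op.comp_eq_zero (d : Op S S') (d' : Op S' S'')
    (h : ∀ X w x, (∀ᶠ y in 𝓝 x, S.P X w y) → d'.op X (d.op X w) x = 0) :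
    d.hom ≫ d'.hom = 0 := by
  ext B s
  refine Subtype.ext (funext fun x => ?_)
  refine Eq.trans (d'.congr ?_) (h _ (ext0 B.unop.U s.1) x.1 ?_)
  · filter_upwards [B.unop.U.isOpen.mem_nhds x.2] with y hy
    exact ext0_mem _ hy
  · filter_upwards [B.unop.U.isOpen.mem_nhds x.2] with y hy using s.2 y hy

end LocSec

/-! ### The sheaves in the Deligne complex -/

/-- The sheaf `A^q` of smooth `q`-forms (replaced by zero if `N < q`). If `vertical` holds: its
subsheaf `F¹A^q` of the forms that vanish on any `q` vertical vectors. -/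
noncomputable def formSheaf (N : ℕ) (vertical : Prop) (q : ℕ) : LocSec.{u} where
  A X := (Fin q → X.E) → ℝ
  P X := FMfd.FormAt N vertical q X
  zero _ x := FMfd.formAt_zero x
  add h h' := h.add h'
  neg h := h.neg
  congr h he := h.congr he
  pull f x := AddMonoidHom.mk' (fun a v => a fun i => FMfd.T f.f x (v i)) fun _ _ => rfl
  pull_id x a := funext fun v => congrArg a (funext fun i => FMfd.T_id x (v i))
  pull_comp f g x a := funext fun v =>
    congrArg a (funext fun i => FMfd.T_comp g.smooth f.smooth x (v i))
  P_pull f _ _ h := FMfd.FormAt.pull (f := f) h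

/-- The complex number of absolute value one given by an element of the circle group. -/
noncomputable def circleVal (a : ULift.{u} (Additive Circle)) : ℂ := (a.down.toMul : Circle)

theorem norm_circleVal (a : ULift.{u} (Additive Circle)) : ‖circleVal a‖ = 1 :=
  Circle.norm_coe _

theorem circle_plot {X : FMfd.{u}} {s : X.X → ULift.{u} (Additive Circle)} {E : Type u}
    [AddCommGroup E] [Module ℝ E] [TopologicalSpace E] {p : E → X.X} {z : E} (hp : X.PlotAt p z)
    (h : SmoothAt (fun y => circleVal (s ((X.chart (p z)).symm y))) (X.chart (p z) (p z))) :
    SmoothAt (fun y => circleVal (s (p y))) z := by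
  refine (SmoothAt.comp (f := fun y => X.chart (p z) (p y)) h hp.2).congr ?_
  filter_upwards [hp.1 ((X.chart (p z)).open_source.mem_nhds (X.mem_source _))] with y hy
    using by rw [(X.chart (p z)).left_inv hy]

/-- The sheaf `T` of smooth functions with values in the circle. -/
noncomputable def circleSheaf : LocSec.{u} where
  A _ := ULift.{u} (Additive Circle)
  P X s x := SmoothAt (fun z => circleVal (s ((X.chart x).symm z))) (X.chart x x)
  zero _ _ := SmoothAt.const _ _
  add h h' := (h.mul h').congr (.of_forall fun _ => by simp [circleVal])
  neg h := ((SmoothAt.linear (Complex.conjCLE : ℂ →L[ℝ] ℂ) _).comp h).congr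
    (.of_forall fun _ => by simp [circleVal, ← Circle.coe_inv_eq_conj])
  congr {X _ _ x} h he := h.congr (by
    filter_upwards [FMfd.eventually_chart he] with z hz using by rw [hz.2])
  pull _ _ := AddMonoidHom.id _
  pull_id _ _ := rfl
  pull_comp _ _ _ _ := rfl
  P_pull f _ x h := circle_plot (f.smooth x) (by rw [FMfd.symm_chart]; exact h)

/-- The form `(1 / 2πi) d log s`, computed at each point in the chart at that point. -/
noncomputable def dlogForm {X : FMfd.{u}} (s : X.X → ULift.{u} (Additive Circle)) (x : X.X) :
    (Fin 1 → X.E) → ℝ :=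
  dlogRaw (fun z => circleVal (s ((X.chart x).symm z))) (X.chart x x)

theorem pb_dlogForm {X : FMfd.{u}} {s : X.X → ULift.{u} (Additive Circle)} {E : Type u}
    [AddCommGroup E] [Module ℝ E] [TopologicalSpace E] [IsTopologicalAddGroup E]
    [ContinuousSMul ℝ E] {p : E → X.X} {z : E} (hp : X.PlotAt p z)
    (h : circleSheaf.P X s (p z)) :
    FMfd.pb p (dlogForm s) z = dlogRaw (fun y => circleVal (s (p y))) z := by
  ext v
  have e : (fun y => circleVal (s (p y))) =ᶠ[𝓝 z]
      fun y => circleVal (s ((X.chart (p z)).symm (X.chart (p z) (p y)))) := by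
    filter_upwards [hp.1 ((X.chart (p z)).open_source.mem_nhds (X.mem_source _))] with y hy
      using by rw [(X.chart (p z)).left_inv hy]
  unfold FMfd.pb dlogForm dlogRaw
  rw [D_congr e, D_comp (f := fun y => X.chart (p z) (p y)) h hp.2]
  simp only [FMfd.symm_chart]

theorem pb_dlogForm_chart {X : FMfd.{u}} {s : X.X → ULift.{u} (Additive Circle)} {x : X.X}
    (h : ∀ᶠ y in 𝓝 x, circleSheaf.P X s y) : ∀ᶠ z in 𝓝 (X.chart x x),
      FMfd.pb (X.chart x).symm (dlogForm s) z =
        dlogRaw (fun y => circleVal (s ((X.chart x).symm y))) z := by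
  filter_upwards [FMfd.eventually_chart h] with z hz
    using pb_dlogForm (FMfd.plotAt_symm x hz.1) hz.2

/-- The form `w` of degree `q`, replaced by zero if `N < q`. -/
noncomputable def trunc {E : Type u} (N q : ℕ) (w : (Fin q → E) → ℝ) : (Fin q → E) → ℝ :=
  if q ≤ N then w else 0

theorem trunc_zero {E : Type u} (N q : ℕ) : trunc N q (0 : (Fin q → E) → ℝ) = 0 := by
  simp [trunc]

theorem trunc_add {E : Type u} (N q : ℕ) (w w' : (Fin q → E) → ℝ) :
    trunc N q (w + w') = trunc N q w + trunc N q w' := by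
  unfold trunc
  split_ifs <;> simp

theorem trunc_pull {X Y : FMfd.{u}} (f : X.X → Y.X) (N q : ℕ) (w : Y.X → (Fin q → Y.E) → ℝ)
    (x : X.X) : trunc N q (FMfd.pullForm f w x) =
      FMfd.pullForm f (fun y => trunc N q (w y)) x := by
  ext v
  by_cases h : q ≤ N <;> simp [trunc, FMfd.pullForm, h]

theorem FMfd.FormAt.trunc {X : FMfd.{u}} {N q : ℕ} {b : Prop} {w : X.X → (Fin q → X.E) → ℝ}
    {x : X.X} (h : q ≤ N → FMfd.FormAt N b q X w x) :
    FMfd.FormAt N b q X (fun y => EquivDeligne.trunc N q (w y)) x := by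
  by_cases hq : q ≤ N
  · simpa [EquivDeligne.trunc, hq] using h hq
  · simp only [EquivDeligne.trunc, if_neg hq]
    exact FMfd.formAt_zero x

theorem dlogForm_congr {X : FMfd.{u}} {w w' : X.X → ULift.{u} (Additive Circle)} {x : X.X}
    (h : ∀ᶠ y in 𝓝 x, w y = w' y) : dlogForm w x = dlogForm w' x := by
  have e : (fun z => circleVal (w ((X.chart x).symm z))) =ᶠ[𝓝 (X.chart x x)]
      fun z => circleVal (w' ((X.chart x).symm z)) := by
    filter_upwards [FMfd.eventually_chart h] with z hz using by rw [hz.2]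
  ext v
  unfold dlogForm dlogRaw
  rw [D_congr e, e.self_of_nhds]

theorem dlogForm_mem {X : FMfd.{u}} {N : ℕ} (hN : 1 ≤ N)
    {w : X.X → ULift.{u} (Additive Circle)} {x : X.X}
    (h : ∀ᶠ y in 𝓝 x, circleSheaf.P X w y) : FMfd.FormAt N False 1 X (dlogForm w) x := by
  have h0 := h.self_of_nhds
  refine ⟨fun v => ?_, dlogRaw_isAlt h0, fun hq => absurd hq (by omega), fun hb => hb.elim⟩
  refine (dlogRaw_smooth h0 (fun _ => norm_circleVal _) v).congr ?_
  filter_upwards [(continuous_fst.tendsto (X.chart x x, v)).eventually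
    (pb_dlogForm_chart h)] with r hr
  exact congrFun hr _

theorem dlogForm_add {X : FMfd.{u}} {w w' : X.X → ULift.{u} (Additive Circle)} {x : X.X}
    (h : circleSheaf.P X w x) (h' : circleSheaf.P X w' x) :
    dlogForm (w + w') x = dlogForm w x + dlogForm w' x := by
  ext v
  refine Eq.trans ?_ (dlogRaw_mul h h' (norm_circleVal _) (norm_circleVal _) v)
  unfold dlogForm
  congr 1

theorem dlogForm_pull {X Y : FMfd.{u}} (f : X ⟶ Y) {w : Y.X → ULift.{u} (Additive Circle)}
    {x : X.X} (h : circleSheaf.P Y w (f.f x)) :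
    dlogForm (fun x => w (f.f x)) x = FMfd.pullForm f.f (dlogForm w) x := by
  have := pb_dlogForm (f.smooth x) (s := w) (by rw [FMfd.symm_chart]; exact h)
  refine this.symm.trans ?_
  ext v
  simp only [FMfd.pb, FMfd.symm_chart]
  rfl

/-- The map `(1 / 2πi) d log : T → A¹` (zero if `N = 0`). -/
noncomputable def dlogOp (N : ℕ) : circleSheaf.{u}.Op (formSheaf N False 1) where
  op _ s x := trunc N 1 (dlogForm s x)
  congr h := congrArg (trunc N 1) (dlogForm_congr h)
  mem h := FMfd.FormAt.trunc fun hN => dlogForm_mem hN h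
  add h h' := (congrArg (trunc N 1) (dlogForm_add h h')).trans (trunc_add _ _ _ _)
  pull f _ _ h := (congrArg (trunc N 1) (dlogForm_pull f h)).trans (trunc_pull _ _ _ _ _)

/-- The exterior derivative (zero in degrees above `N`). -/
noncomputable def dOp (N : ℕ) (vertical : Prop) (q : ℕ) :
    (formSheaf.{u} N vertical q).Op (formSheaf N vertical (q + 1)) where
  op _ w x := trunc N (q + 1) (FMfd.dForm w x)
  congr h := congrArg (trunc N (q + 1)) (FMfd.dForm_congr h)
  mem h := FMfd.FormAt.trunc fun hN => FMfd.FormAt.d hN h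
  add h h' := (congrArg (trunc N (q + 1)) (FMfd.dForm_add h h')).trans (trunc_add _ _ _ _)
  pull f _ _ h := (congrArg (trunc N (q + 1)) (FMfd.dForm_pull (f := f) h)).trans
    (trunc_pull _ _ _ _ _)

theorem trunc_dForm_trunc {X : FMfd.{u}} (N q : ℕ) (w : X.X → (Fin q → X.E) → ℝ) (x : X.X)
    (h : q + 1 ≤ N → FMfd.dForm w x = 0) :
    trunc N (q + 1) (FMfd.dForm (fun y => trunc N q (w y)) x) = 0 := by
  by_cases hN : q + 1 ≤ N
  · have hN' : q ≤ N := by omega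
    simpa [trunc, hN, hN'] using h hN
  · simp [trunc, hN]

/-- The inclusion of `F¹A^q` in `A^q`. -/
noncomputable def inclOp (N q : ℕ) : (formSheaf.{u} N True q).Op (formSheaf N False q) where
  op _ w := w
  congr h := h.self_of_nhds
  mem h := ⟨h.self_of_nhds.1, h.self_of_nhds.2.1, h.self_of_nhds.2.2.1, fun hb => hb.elim⟩
  add _ _ := rfl
  pull _ _ _ _ := rfl

/-- The sheaf in degree `q` of the Deligne complex. -/
noncomputable def deligneSheaf (N : ℕ) : ℕ → LocSec.{u}
  | 0 => circleSheaf
  | q + 1 => formSheaf N False (q + 1)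

/-- The differentials of the Deligne complex. -/
noncomputable def deligneOp (N : ℕ) : ∀ q : ℕ, (deligneSheaf.{u} N q).Op (deligneSheaf N (q + 1))
  | 0 => dlogOp N
  | q + 1 => dOp N False (q + 1)

theorem dOp_comp (N : ℕ) (vertical : Prop) (q : ℕ) :
    (dOp.{u} N vertical q).hom ≫ (dOp N vertical (q + 1)).hom = 0 :=
  LocSec.Op.comp_eq_zero _ _ fun _ _ _ h =>
    trunc_dForm_trunc N (q + 1) _ _ fun _ => FMfd.dForm_dForm h

theorem deligneOp_comp (N : ℕ) (q : ℕ) :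
    (deligneOp.{u} N q).hom ≫ (deligneOp N (q + 1)).hom = 0 := by
  cases q with
  | zero =>
    exact LocSec.Op.comp_eq_zero _ _ fun X w x h => trunc_dForm_trunc N 1 _ _ fun _ => funext fun v =>
      (congrFun (dRaw_congr (pb_dlogForm_chart h)) v).trans
        (dRaw_dlogRaw h.self_of_nhds (fun _ => norm_circleVal _) v)
  | succ q => exact dOp_comp N False (q + 1)

/-- The complex `F(N) : T → A¹ → ⋯ → A^N`, with `T` in degree zero. -/
noncomputable def deligneComplex (N : ℕ) : CochainComplex (OpenMfd.{u}ᵒᵖ ⥤ AddCommGrpCat.{u}) ℕ :=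
  CochainComplex.of (fun q => (deligneSheaf N q).presheaf) (fun q => (deligneOp N q).hom)
    (deligneOp_comp N)

/-- The complex `F¹F(N) : 0 → F¹A¹ → ⋯ → F¹A^N`. (A `0`-form that vanishes on the empty family of
vertical vectors is zero.) -/
noncomputable def verticalComplex (N : ℕ) :
    CochainComplex (OpenMfd.{u}ᵒᵖ ⥤ AddCommGrpCat.{u}) ℕ :=
  CochainComplex.of (fun q => (formSheaf N True q).presheaf) (fun q => (dOp N True q).hom)
    (dOp_comp N True)

/-- The inclusion `F¹F(N) → F(N)` in degree `q`. -/
noncomputable def verticalIncl (N : ℕ) :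
    ∀ q : ℕ, (formSheaf.{u} N True q).presheaf ⟶ (deligneSheaf N q).presheaf
  | 0 => 0
  | q + 1 => (inclOp N (q + 1)).hom

theorem sec_formSheaf_zero (N : ℕ) (B : OpenMfd.{u}) (s : (formSheaf N True 0).sec B) : s = 0 := by
  refine Subtype.ext (funext fun x => funext fun v => ?_)
  have := (s.2 x.1 x.2).2.2.2 trivial v fun i => i.elim0
  rwa [ext0_mem _ x.2] at this

theorem verticalIncl_comm (N q : ℕ) : verticalIncl.{u} N q ≫ (deligneOp N q).hom =
    (dOp N True q).hom ≫ verticalIncl N (q + 1) := by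
  cases q with
  | zero =>
    ext B s
    rw [sec_formSheaf_zero N B.unop s]
    exact (map_zero _).trans (map_zero _).symm
  | succ q =>
    ext B s
    refine Subtype.ext (funext fun x => ?_)
    refine ((dOp N False (q + 1)).congr (w := ext0 B.unop.U _) ?_).trans
      (ext0_mem (U := B.unop.U) (fun x => (dOp N True (q + 1)).op _ (ext0 B.unop.U s.1) x) x.2).symm
    filter_upwards [B.unop.U.isOpen.mem_nhds x.2] with y hy
    exact ext0_mem _ hy

/-- The inclusion `F¹F(N) → F(N)`. -/
noncomputable def verticalInclusion (N : ℕ) : verticalComplex.{u} N ⟶ deligneComplex N :=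
  CochainComplex.ofHom (verticalIncl N) fun q => by
    simpa only [deligneComplex, verticalComplex, CochainComplex.of_d] using verticalIncl_comm N q

/-! ### Sheaves on diagrams of manifolds -/

/-- A pair `(j, U)` of an object `j` of the index category and an open subset `U` of the manifold
`D j`. -/
structure DOpens {J : Type} [Category.{0} J] (D : J ⥤ FMfd.{u}) : Type u where
  j : J
  U : Opens (D.obj j).X

namespace DOpens

variable {J : Type} [Category.{0} J] (D : J ⥤ FMfd.{u})

variable {D} in
/-- A morphism `(i, U) → (j, V)` is a morphism `i → j` such that `D i → D j` maps `U` to `V`. -/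
@[ext]
structure Hom (A B : DOpens D) : Type u where
  φ : A.j ⟶ B.j
  mapsTo : ∀ x ∈ A.U, (D.map φ).f x ∈ B.U

theorem map_id_apply (j : J) (x : (D.obj j).X) : (D.map (𝟙 j)).f x = x := by
  rw [D.map_id]
  rfl

theorem map_comp_apply {i j k : J} (φ : i ⟶ j) (ψ : j ⟶ k) (x : (D.obj i).X) :
    (D.map (φ ≫ ψ)).f x = (D.map ψ).f ((D.map φ).f x) := by
  rw [D.map_comp]
  rfl

instance : Category.{u} (DOpens D) where
  Hom := Hom
  id A := ⟨𝟙 A.j, fun x hx => by rwa [map_id_apply]⟩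
  comp F G := ⟨F.φ ≫ G.φ, fun x hx => by
    rw [map_comp_apply]
    exact G.mapsTo _ (F.mapsTo x hx)⟩
  id_comp _ := Hom.ext (Category.id_comp _)
  comp_id _ := Hom.ext (Category.comp_id _)
  assoc _ _ _ := Hom.ext (Category.assoc _ _ _)

variable {D} in
/-- The inclusion of an open subset in a larger one. -/
def incl (j : J) {U V : Opens (D.obj j).X} (h : U ≤ V) : (⟨j, U⟩ : DOpens D) ⟶ ⟨j, V⟩ :=
  ⟨𝟙 j, fun x hx => by
    rw [map_id_apply]
    exact h hx⟩

/-- The functor to pairs of a manifold and an open subset. -/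
def toOpenMfd : DOpens D ⥤ OpenMfd.{u} where
  obj A := ⟨D.obj A.j, A.U⟩
  map F := ⟨D.map F.φ, F.mapsTo⟩
  map_id _ := OpenMfd.Hom.ext (D.map_id _)
  map_comp _ _ := OpenMfd.Hom.ext (D.map_comp _ _)

/-- The open subsets of `D j`. -/
def level (j : J) : Opens (D.obj j).X ⥤ DOpens D where
  obj U := ⟨j, U⟩
  map i := incl j i.le
  map_id _ := rfl
  map_comp _ _ := Hom.ext (Category.comp_id _).symm

/-- The topology on `DOpens D` whose coverings are the open coverings in each level `D j`. A sheaf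
for it consists of a sheaf `S_j` on each `D j` and, for each `φ : i → j`, compatible maps
`S_j(V) → S_i((D φ)⁻¹ V)`: for `J = Δᵒᵖ`, a simplicial sheaf on the simplicial manifold `D`. -/
def topology : GrothendieckTopology (DOpens D) where
  sieves A := {S | ∀ x ∈ A.U, ∃ (U : Opens (D.obj A.j).X) (h : U ≤ A.U), x ∈ U ∧
    S (incl A.j h : (⟨A.j, U⟩ : DOpens D) ⟶ A)}
  top_mem' A x hx := ⟨A.U, le_rfl, hx, trivial⟩
  pullback_stable' A B S F hS x hx := by
    obtain ⟨U, h, hxU, hU⟩ := hS _ (F.mapsTo x hx)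
    let V : Opens (D.obj B.j).X := ⟨B.U ∩ (D.map F.φ).f ⁻¹' U, B.U.isOpen.inter
      (U.isOpen.preimage (D.map F.φ).smooth.continuous)⟩
    let K : (⟨B.j, V⟩ : DOpens D) ⟶ ⟨A.j, U⟩ := ⟨F.φ, fun y hy => hy.2⟩
    have hV : V ≤ B.U := fun y hy => hy.1
    have e : (incl B.j hV : (⟨B.j, V⟩ : DOpens D) ⟶ B) ≫ F =
        K ≫ (incl A.j h : (⟨A.j, U⟩ : DOpens D) ⟶ A) := by
      apply Hom.ext
      exact (Category.id_comp F.φ).trans (Category.comp_id F.φ).symm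
    refine ⟨V, hV, ⟨hx, hxU⟩, ?_⟩
    change S ((incl B.j hV : (⟨B.j, V⟩ : DOpens D) ⟶ B) ≫ F)
    rw [e]
    exact S.downward_closed hU K
  transitive' A S hS R hR x hx := by
    obtain ⟨U, h, hxU, hU⟩ := hS x hx
    obtain ⟨V, h', hxV, hV⟩ := hR hU x hxU
    have e : (incl A.j (h'.trans h) : (⟨A.j, V⟩ : DOpens D) ⟶ A) =
        (incl A.j h' : (⟨A.j, V⟩ : DOpens D) ⟶ ⟨A.j, U⟩) ≫ incl A.j h := by
      apply Hom.ext
      exact (Category.comp_id (𝟙 A.j)).symm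
    refine ⟨V, h'.trans h, hxV, ?_⟩
    rw [e]
    exact hV

theorem mem_topology {A : DOpens D} {S : Sieve A} : S ∈ topology D A ↔
    ∀ x ∈ A.U, ∃ (U : Opens (D.obj A.j).X) (h : U ≤ A.U), x ∈ U ∧
      S (incl A.j h : (⟨A.j, U⟩ : DOpens D) ⟶ A) := Iff.rfl

instance (j : J) : (level D j).IsContinuous
    (Opens.grothendieckTopology (TopCat.of (D.obj j).X)) (topology D) := by
  refine Functor.isContinuous_of_coverPreserving ⟨?_⟩ ⟨?_⟩
  · intro S Z T x hx Y₁ Y₂ A f₁ f₂ g₁ g₂ hg₁ hg₂ e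
    have e' : f₁.φ = f₂.φ := by
      have := congrArg Hom.φ e
      exact (Category.comp_id _).symm.trans (this.trans (Category.comp_id _))
    let W : Opens (D.obj j).X := Y₁ ⊓ Y₂
    let F : A ⟶ (level D j).obj W :=
      ⟨f₁.φ, fun y hy => ⟨f₁.mapsTo y hy, by rw [e']; exact f₂.mapsTo y hy⟩⟩
    let i₁ : W ⟶ Y₁ := homOfLE inf_le_left
    let i₂ : W ⟶ Y₂ := homOfLE inf_le_right
    have h₁ : f₁ = F ≫ (level D j).map i₁ := Hom.ext (Category.comp_id _).symm
    have h₂ : f₂ = F ≫ (level D j).map i₂ := Hom.ext (e'.symm.trans (Category.comp_id _).symm)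
    have := hx i₁ i₂ hg₁ hg₂ (Subsingleton.elim _ _)
    rw [h₁, h₂, op_comp, op_comp, S.obj.map_comp, S.obj.map_comp]
    exact congrArg (S.obj.map F.op) this
  · intro U S hS x hx
    obtain ⟨V, f, hf, hV⟩ := hS x hx
    refine ⟨V, f.le, hV, ⟨V, f, 𝟙 _, hf, (Category.id_comp _).symm⟩⟩

theorem isSheaf_of_level (P : (DOpens D)ᵒᵖ ⥤ AddCommGrpCat.{u})
    (h : ∀ j, TopCat.Presheaf.IsSheaf (X := TopCat.of (D.obj j).X) ((level D j).op ⋙ P)) :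
    Presheaf.IsSheaf (topology D) P := by
  rw [Presheaf.isSheaf_iff_isSheaf_forget _ _ (forget AddCommGrpCat), isSheaf_iff_isSheaf_of_type]
  have h' : ∀ j, Presieve.IsSheaf (Opens.grothendieckTopology (TopCat.of (D.obj j).X))
      ((level D j).op ⋙ P ⋙ forget AddCommGrpCat) := fun j =>
    (isSheaf_iff_isSheaf_of_type _ _).1 ((Presheaf.isSheaf_iff_isSheaf_forget _
      ((level D j).op ⋙ P) (forget AddCommGrpCat)).1 (h j))
  intro A S hS x hx
  have hR : S.functorPullback (level D A.j) ∈
      Opens.grothendieckTopology (TopCat.of (D.obj A.j).X) A.U := fun y hy => by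
    obtain ⟨V, hV, hyV, hSV⟩ := hS y hy
    exact ⟨V, homOfLE hV, hSV, hyV⟩
  obtain ⟨t, ht, htu⟩ := h' A.j _ hR (x.functorPullback (level D A.j)) hx.functorPullback
  refine ⟨t, fun B F hF => ?_, fun t' ht' => htu t' fun V g hg => ht' _ hg⟩
  let T : Sieve (C := Opens (TopCat.of (D.obj B.j).X)) B.U :=
    { arrows := fun V _ => ∃ (W : Opens (D.obj A.j).X) (h : W ≤ A.U),
        S (incl A.j h : (⟨A.j, W⟩ : DOpens D) ⟶ A) ∧ ∀ y ∈ V, (D.map F.φ).f y ∈ W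
      downward_closed := fun ⟨W, h, hW, hV⟩ g => ⟨W, h, hW, fun y hy => hV y (g.le hy)⟩ }
  have hT : T ∈ Opens.grothendieckTopology (TopCat.of (D.obj B.j).X) B.U := fun y hy => by
    obtain ⟨W, h, hyW, hW⟩ := hS _ (F.mapsTo y hy)
    exact ⟨⟨B.U ∩ (D.map F.φ).f ⁻¹' W, B.U.isOpen.inter
      (W.isOpen.preimage (D.map F.φ).smooth.continuous)⟩, homOfLE fun z hz => hz.1,
      ⟨W, h, hW, fun z hz => hz.2⟩, hy, hyW⟩
  refine ((h' B.j).isSeparated _ hT).ext fun V g hg => ?_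
  obtain ⟨W, h, hW, hV⟩ := hg
  let K : (⟨B.j, V⟩ : DOpens D) ⟶ ⟨A.j, W⟩ := ⟨F.φ, hV⟩
  have e : K ≫ incl A.j h = (level D B.j).map g ≫ F := by
    apply Hom.ext
    exact (Category.comp_id F.φ).trans (Category.id_comp F.φ).symm
  have e1 := ht (homOfLE h) hW
  have e2 := hx K ((level D B.j).map g) hW hF e
  have e3 : (P ⋙ forget AddCommGrpCat).map ((level D B.j).map g).op
      ((P ⋙ forget AddCommGrpCat).map F.op t) =
      (P ⋙ forget AddCommGrpCat).map K.op ((P ⋙ forget AddCommGrpCat).map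
        ((level D A.j).map (homOfLE h)).op t) := by
    have e4 := congrArg (fun f => (P ⋙ forget AddCommGrpCat).map (Quiver.Hom.op f) t) e
    exact ((congrArg (fun f => f t) ((P ⋙ forget AddCommGrpCat).map_comp F.op
      ((level D B.j).map g).op)).symm.trans e4.symm).trans (congrArg (fun f => f t)
      ((P ⋙ forget AddCommGrpCat).map_comp (incl A.j h).op K.op))
  exact e3.trans ((congrArg _ e1).trans e2)

end DOpens

/-! ### Injective resolutions of complexes -/

section Resolutions

open Limits ComplexShape

variable {C : Type v} [Category.{w} C] [Abelian C]

/-- An injective resolution of a complex: a quasi-isomorphism to a complex of injective objects. -/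
structure InjRes (K : CochainComplex C ℕ) where
  I : CochainComplex C ℕ
  ι : K ⟶ I
  qis : QuasiIso ι
  inj : ∀ n, Injective (I.X n)

theorem nonempty_injRes [EnoughInjectives C] (K : CochainComplex C ℕ) : Nonempty (InjRes K) := by
  obtain ⟨L, i, hi, hL, hL0⟩ := CochainComplex.Plus.modelCategoryQuillen.exists_quasiIso_injective
    (K.extend embeddingUpNat) 0
  have hz : ∀ n : ℤ, n < 0 → IsZero (L.X n) := fun n hn => L.isZero_of_isStrictlyGE 0 n hn
  have hlift : embeddingUpNat.HasLift (𝟙 (L.restriction embeddingUpNat)) := by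
    intro j hj n hn
    have h0 : j = 0 := by
      by_contra h
      exact hj.2 (j - 1) (by simp; omega)
    subst h0
    exact (hz n (by simp at hn; omega)).eq_of_src _ _
  let u : L ⟶ (L.restriction embeddingUpNat).extend embeddingUpNat :=
    embeddingUpNat.liftExtend (𝟙 _) hlift
  have hu : ∀ n, IsIso (u.f n) := by
    intro n
    by_cases h : ∃ j, embeddingUpNat.f j = n
    · obtain ⟨j, hj⟩ := h
      rw [embeddingUpNat.isIso_liftExtend_f_iff _ _ hj]
      infer_instance
    · push Not at h
      have h1 : IsZero (L.X n) := hz n (by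
        by_contra h0
        exact h n.toNat (by simp; omega))
      have h2 := (L.restriction embeddingUpNat).isZero_extend_X embeddingUpNat n h
      exact ⟨0, h1.eq_of_src _ _, h2.eq_of_src _ _⟩
  have hu' : IsIso u := HomologicalComplex.Hom.isIso_of_components u
  obtain ⟨α, hα⟩ := (embeddingUpNat.extendFunctor C).map_surjective (i ≫ u)
  refine ⟨⟨L.restriction embeddingUpNat, α, ?_, fun n => hL _⟩⟩
  rw [← HomologicalComplex.quasiIso_extendMap_iff α embeddingUpNat]
  change QuasiIso ((embeddingUpNat.extendFunctor C).map α)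
  rw [hα]
  have hqu : QuasiIso u := inferInstance
  exact quasiIso_comp i u

/-- A morphism of complexes extends, up to homotopy, to injective resolutions. -/
theorem exists_lift {K I L : CochainComplex C ℕ} (ι : K ⟶ I) [QuasiIso ι]
    (hL : ∀ n, Injective (L.X n)) (f : K ⟶ L) : ∃ g : I ⟶ L, Nonempty (Homotopy (ι ≫ g) f) := by
  let := HasDerivedCategory.standard C
  let Q := HomotopyCategory.quotient C (ComplexShape.up ℤ)
  let e : CochainComplex C ℕ ⥤ CochainComplex C ℤ := embeddingUpNat.extendFunctor C
  have : QuasiIso (e.map ι) := (HomologicalComplex.quasiIso_extendMap_iff ι embeddingUpNat).2 ‹_›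
  have hι : IsIso (DerivedCategory.Qh.map (Q.map (e.map ι))) :=
    inferInstanceAs (IsIso (DerivedCategory.Q.map (e.map ι)))
  have : (e.obj L).IsKInjective :=
    inferInstanceAs (CochainComplex.IsKInjective (L.extend embeddingUpNat))
  obtain ⟨g, hg⟩ := (CochainComplex.IsKInjective.Qh_map_bijective (Q.obj (e.obj I))
    (e.obj L)).surjective (inv (DerivedCategory.Qh.map (Q.map (e.map ι))) ≫
      DerivedCategory.Qh.map (Q.map (e.map f)))
  obtain ⟨g, rfl⟩ := Q.map_surjective g
  obtain ⟨g, rfl⟩ := e.map_surjective g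
  refine ⟨g, ⟨Homotopy.ofExtend (e := embeddingUpNat) (HomotopyCategory.homotopyOfEq _ _ ?_)⟩⟩
  refine (CochainComplex.IsKInjective.Qh_map_bijective (Q.obj (e.obj K)) (e.obj L)).injective ?_
  change DerivedCategory.Qh.map (Q.map (e.map (ι ≫ g))) = DerivedCategory.Qh.map (Q.map (e.map f))
  rw [e.map_comp, Q.map_comp, Functor.map_comp, hg, IsIso.hom_inv_id_assoc]

end Resolutions

/-! ### Sheaf cohomology -/

/-- Sheaves of abelian groups on a topological space. -/
abbrev Sh (X : TopCat.{u}) : Type (u + 1) :=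
  Sheaf (Opens.grothendieckTopology X) AddCommGrpCat.{u}

section Cohomology

variable {X Y : TopCat.{u}}

/-- A chosen injective resolution. -/
noncomputable def injRes {C : Type v} [Category.{w} C] [Abelian C] [EnoughInjectives C]
    (K : CochainComplex C ℕ) : InjRes K := (nonempty_injRes K).some

/-- Global sections. -/
noncomputable def globalSections (X : TopCat.{u}) : Sh X ⥤ AddCommGrpCat.{u} :=
  (sheafSections _ _).obj (Opposite.op ⊤)

instance : (globalSections X).Additive where
  map_add := rfl

/-- The (hyper)cohomology `H^q(X, K)` of a complex of sheaves: the cohomology of the global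
sections of an injective resolution. -/
noncomputable def coh (K : CochainComplex (Sh X) ℕ) (q : ℕ) : AddCommGrpCat.{u} :=
  (((globalSections X).mapHomologicalComplex _).obj (injRes K).I).homology q

/-- The direct image of sheaves. -/
noncomputable def push (f : X ⟶ Y) : Sh X ⥤ Sh Y :=
  (Opens.map f).sheafPushforwardContinuous AddCommGrpCat.{u} _ _

instance (f : X ⟶ Y) : (push f).Additive where
  map_add := rfl

theorem push_injective (f : X ⟶ Y) (S : Sh X) [Injective S] : Injective ((push f).obj S) := by
  have : Limits.PreservesFiniteLimits ((Opens.map f).sheafPullback AddCommGrpCat.{u}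
    (Opens.grothendieckTopology Y) (Opens.grothendieckTopology X)) :=
      Functor.SmallCategories.instPreservesFiniteLimitsSheafSheafPullbackOfRepresentablyFlat _ _ _ _
  have : ((Opens.map f).sheafPullback AddCommGrpCat.{u} (Opens.grothendieckTopology Y)
    (Opens.grothendieckTopology X)).PreservesMonomorphisms :=
      preservesMonomorphisms_of_preservesLimitsOfShape _
  exact Injective.injective_of_adjoint ((Opens.map f).sheafAdjunctionContinuous AddCommGrpCat.{u}
    (Opens.grothendieckTopology Y) (Opens.grothendieckTopology X)) S

/-- The map `H^q(Y, K) → H^q(X, L)` induced by a map `f : X → Y` and a morphism `K → f_* L`: one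
extends `K → f_* L` to injective resolutions and takes global sections. -/
noncomputable def cohMap (f : X ⟶ Y) {K : CochainComplex (Sh Y) ℕ} {L : CochainComplex (Sh X) ℕ}
    (φ : K ⟶ ((push f).mapHomologicalComplex _).obj L) (q : ℕ) : coh K q ⟶ coh L q :=
  have := (injRes K).qis
  have := (injRes L).inj
  HomologicalComplex.homologyMap (((globalSections Y).mapHomologicalComplex _).map
    (exists_lift (injRes K).ι (L := ((push f).mapHomologicalComplex _).obj (injRes L).I)
      (fun n => push_injective f ((injRes L).I.X n))
      (φ ≫ ((push f).mapHomologicalComplex _).map (injRes L).ι)).choose) q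

end Cohomology

/-! ### The complexes of sheaves on manifolds and on diagrams of manifolds -/

section Complexes

/-- The underlying space of a manifold. -/
abbrev FMfd.space (X : FMfd.{u}) : TopCat.{u} := TopCat.of X.X

/-- The condition that a complex of presheaves on all manifolds consists of sheaves. -/
def IsSheafComplex (K : CochainComplex (OpenMfd.{u}ᵒᵖ ⥤ AddCommGrpCat.{u}) ℕ) : Prop :=
  ∀ (q : ℕ) (X : FMfd.{u}), TopCat.Presheaf.IsSheaf (X := X.space)
    ((OpenMfd.ofOpens X).op ⋙ K.X q)

theorem isSheafComplex_deligne (N : ℕ) : IsSheafComplex (deligneComplex.{u} N) :=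
  fun q X => (deligneSheaf N q).isSheaf X

theorem isSheafComplex_vertical (N : ℕ) : IsSheafComplex (verticalComplex.{u} N) :=
  fun q X => (formSheaf N True q).isSheaf X

variable {J : Type} [Category.{0} J]

/-- Sheaves of abelian groups on a diagram of manifolds. -/
abbrev DSh (D : J ⥤ FMfd.{u}) : Type (u + 1) := Sheaf (DOpens.topology D) AddCommGrpCat.{u}

theorem IsSheafComplex.diagram {K : CochainComplex (OpenMfd.{u}ᵒᵖ ⥤ AddCommGrpCat.{u}) ℕ}
    (h : IsSheafComplex K) (D : J ⥤ FMfd.{u}) (q : ℕ) :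
    Presheaf.IsSheaf (DOpens.topology D) ((DOpens.toOpenMfd D).op ⋙ K.X q) := by
  refine DOpens.isSheaf_of_level D _ fun j => TopCat.Presheaf.isSheaf_of_iso ?_ (h q (D.obj j))
  refine Functor.isoWhiskerRight (NatIso.op (NatIso.ofComponents
    (F := DOpens.level D j ⋙ DOpens.toOpenMfd D) (G := OpenMfd.ofOpens (D.obj j))
    (fun U => Iso.refl _) fun i => ?_)) (K.X q)
  refine (Category.comp_id _).trans (Eq.trans ?_ (Category.id_comp _).symm)
  exact OpenMfd.Hom.ext (D.map_id j)

/-- The restriction of a complex of sheaves on all manifolds to one manifold. -/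
def onSpace (K : CochainComplex (OpenMfd.{u}ᵒᵖ ⥤ AddCommGrpCat.{u}) ℕ) (h : IsSheafComplex K)
    (X : FMfd.{u}) : CochainComplex (Sh X.space) ℕ where
  X q := ⟨(OpenMfd.ofOpens X).op ⋙ K.X q, h q X⟩
  d i j := ⟨Functor.whiskerLeft _ (K.d i j)⟩
  shape i j hij := by
    rw [K.shape i j hij]
    rfl
  d_comp_d' i j k _ _ := Sheaf.hom_ext (by
    change Functor.whiskerLeft _ (K.d i j) ≫ Functor.whiskerLeft _ (K.d j k) = 0
    rw [← Functor.whiskerLeft_comp, K.d_comp_d]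
    rfl)

/-- The restriction of a complex of sheaves on all manifolds to a diagram. -/
def onDiagram (K : CochainComplex (OpenMfd.{u}ᵒᵖ ⥤ AddCommGrpCat.{u}) ℕ) (h : IsSheafComplex K)
    (D : J ⥤ FMfd.{u}) : CochainComplex (DSh D) ℕ where
  X q := ⟨(DOpens.toOpenMfd D).op ⋙ K.X q, h.diagram D q⟩
  d i j := ⟨Functor.whiskerLeft _ (K.d i j)⟩
  shape i j hij := by
    rw [K.shape i j hij]
    rfl
  d_comp_d' i j k _ _ := Sheaf.hom_ext (by
    change Functor.whiskerLeft _ (K.d i j) ≫ Functor.whiskerLeft _ (K.d j k) = 0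
    rw [← Functor.whiskerLeft_comp, K.d_comp_d]
    rfl)

/-- The restriction of a morphism of complexes to a diagram. -/
def onDiagramMap {K L : CochainComplex (OpenMfd.{u}ᵒᵖ ⥤ AddCommGrpCat.{u}) ℕ}
    (hK : IsSheafComplex K) (hL : IsSheafComplex L) (f : K ⟶ L) (D : J ⥤ FMfd.{u}) :
    onDiagram K hK D ⟶ onDiagram L hL D where
  f q := ⟨Functor.whiskerLeft _ (f.f q)⟩
  comm' i j _ := Sheaf.hom_ext (by
    change Functor.whiskerLeft _ (f.f i) ≫ Functor.whiskerLeft _ (L.d i j) =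
      Functor.whiskerLeft _ (K.d i j) ≫ Functor.whiskerLeft _ (f.f j)
    rw [← Functor.whiskerLeft_comp, ← Functor.whiskerLeft_comp, f.comm])

/-- The complex of sheaves `F̄(N) = F(N) / F¹F(N)` on a diagram of manifolds. -/
noncomputable def barDeligne (D : J ⥤ FMfd.{u}) (N : ℕ) : CochainComplex (DSh D) ℕ :=
  Limits.cokernel (onDiagramMap (isSheafComplex_vertical N) (isSheafComplex_deligne N)
    (verticalInclusion N) D)

/-- The component at `j` of a sheaf on a diagram. -/
noncomputable def component (D : J ⥤ FMfd.{u}) (j : J) : DSh D ⥤ Sh (D.obj j).space :=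
  (DOpens.level D j).sheafPushforwardContinuous AddCommGrpCat.{u} _ _

instance (D : J ⥤ FMfd.{u}) (j : J) : (component D j).Additive where
  map_add := rfl

/-- The continuous map underlying a smooth map. -/
def FMfd.toTop {X Y : FMfd.{u}} (f : X ⟶ Y) : X.space ⟶ Y.space :=
  TopCat.ofHom ⟨f.f, f.smooth.continuous⟩

/-- The structure map `S_j → (D φ)_* S_i` of a sheaf on a diagram, for `φ : i → j`. -/
noncomputable def structureMap (D : J ⥤ FMfd.{u}) {i j : J} (φ : i ⟶ j) :
    component D j ⟶ component D i ⋙ push (FMfd.toTop (D.map φ)) where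
  app S := ⟨{ app := fun V => S.obj.map (Quiver.Hom.op (⟨φ, fun _ hx => hx⟩ :
                (⟨i, (Opens.map (FMfd.toTop (D.map φ))).obj V.unop⟩ : DOpens D) ⟶ ⟨j, V.unop⟩))
              naturality := fun V W f => by
                refine (S.obj.map_comp _ _).symm.trans (Eq.trans ?_ (S.obj.map_comp _ _))
                refine congrArg (fun g => S.obj.map (Quiver.Hom.op g)) (DOpens.Hom.ext ?_)
                exact (Category.comp_id φ).trans (Category.id_comp φ).symm }⟩
  naturality S S' f := Sheaf.hom_ext (NatTrans.ext (funext fun V => (f.hom.naturality _).symm))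

instance (D : J ⥤ FMfd.{u}) {i j : J} (φ : i ⟶ j) :
    (component D i ⋙ push (FMfd.toTop (D.map φ))).Additive where
  map_add := rfl

/-- The cohomology `H^q(D j, K)` of the component at `j` of a complex of sheaves. -/
noncomputable def levelCoh (D : J ⥤ FMfd.{u}) (K : CochainComplex (DSh D) ℕ) (j : J) (q : ℕ) :
    AddCommGrpCat.{u} :=
  coh (((component D j).mapHomologicalComplex _).obj K) q

/-- The pull-back `(D φ)^* : H^q(D j, K) → H^q(D i, K)` for `φ : i → j`. -/
noncomputable def levelPullback (D : J ⥤ FMfd.{u}) (K : CochainComplex (DSh D) ℕ) {i j : J}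
    (φ : i ⟶ j) (q : ℕ) : levelCoh D K j q ⟶ levelCoh D K i q :=
  cohMap (FMfd.toTop (D.map φ))
    ((NatTrans.mapHomologicalComplex (structureMap D φ) _).app K) q

end Complexes

/-! ### Manifolds, Lie groups and the simplicial manifold `G^• × M` -/

section SimplicialManifold

variable {E : Type u} [AddCommGroup E] [Module ℝ E] [TopologicalSpace E]

/-- `M` is a smooth manifold modelled on the locally convex space `E`. -/
class LCManifold (E : Type u) [AddCommGroup E] [Module ℝ E] [TopologicalSpace E]
    (M : Type u) [TopologicalSpace M] [ChartedSpace E M] : Prop where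
  compat : ∀ e ∈ atlas E M, ∀ e' ∈ atlas E M, ∀ z ∈ (e.symm.trans e').source,
    SmoothAt (fun z => e' (e.symm z)) z

section

variable {E₁ E₂ F₁ F₂ : Type u} [AddCommGroup E₁] [Module ℝ E₁] [TopologicalSpace E₁]
  [AddCommGroup E₂] [Module ℝ E₂] [TopologicalSpace E₂]
  [AddCommGroup F₁] [Module ℝ F₁] [TopologicalSpace F₁]
  [AddCommGroup F₂] [Module ℝ F₂] [TopologicalSpace F₂]

theorem SmoothAt.prodMap {f : E₁ → F₁} {g : E₂ → F₂} {z : E₁ × E₂} (hf : SmoothAt f z.1)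
    (hg : SmoothAt g z.2) : SmoothAt (fun w : E₁ × E₂ => (f w.1, g w.2)) z :=
  (SmoothAt.comp (f := fun z : E₁ × E₂ => z.1) hf
    (SmoothAt.linear (ContinuousLinearMap.fst ℝ E₁ E₂) z)).prodMk
    (SmoothAt.comp (f := fun z : E₁ × E₂ => z.2) hg
    (SmoothAt.linear (ContinuousLinearMap.snd ℝ E₁ E₂) z))

theorem SmoothAt.piMap {p : ℕ} {f : Fin p → E₁ → F₁} {z : Fin p → E₁}
    (hf : ∀ i, SmoothAt (f i) (z i)) : SmoothAt (fun w : Fin p → E₁ => fun i => f i (w i)) z :=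
  SmoothAt.pi fun i => SmoothAt.comp (f := fun z : Fin p → E₁ => z i) (hf i)
    (SmoothAt.linear (ContinuousLinearMap.proj i) z)

variable [IsTopologicalAddGroup E₁] [ContinuousSMul ℝ E₁] [IsTopologicalAddGroup E₂]
  [ContinuousSMul ℝ E₂] [T2Space E₁] [T2Space E₂] [T2Space F₁] [T2Space F₂]

theorem D_prodMap {f : E₁ → F₁} {g : E₂ → F₂} {z : E₁ × E₂} (hf : SmoothAt f z.1)
    (hg : SmoothAt g z.2) (v : E₁ × E₂) :
    D (fun w : E₁ × E₂ => (f w.1, g w.2)) z v = (D f z.1 v.1, D g z.2 v.2) :=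
  D_eq ((hf.tendsto v.1).prodMk_nhds (hg.tendsto v.2))

theorem D_piMap {p : ℕ} {f : Fin p → E₁ → F₁} {z : Fin p → E₁}
    (hf : ∀ i, SmoothAt (f i) (z i)) (v : Fin p → E₁) :
    D (fun w : Fin p → E₁ => fun i => f i (w i)) z v = fun i => D (f i) (z i) (v i) :=
  D_eq (tendsto_pi_nhds.2 fun i => (hf i).tendsto (v i))

theorem D_fst_eq_zero [IsTopologicalAddGroup F₁] [ContinuousSMul ℝ F₁] [IsTopologicalAddGroup F₂]
    [ContinuousSMul ℝ F₂] {H : E₁ × E₂ → F₁ × F₂} {z v : E₁ × E₂} (hs : SmoothAt H z)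
    (h : ∀ w w', w.1 = w'.1 → (H w).1 = (H w').1) (hv : v.1 = 0) : (D H z v).1 = 0 := by
  refine Eq.trans (D_linear (ContinuousLinearMap.fst ℝ F₁ F₂) _ _).symm
    ((D_comp (SmoothAt.linear (ContinuousLinearMap.fst ℝ F₁ F₂) _) hs v).symm.trans
      (D_eq (Tendsto.congr (fun t => ?_) tendsto_const_nhds)))
  exact (smul_eq_zero_of_right _ (sub_eq_zero.2 (h _ _ (by simp [hv])))).symm

end

namespace FMfd

/-- The product of two manifolds. -/
def prod (X Y : FMfd.{u}) : FMfd.{u} where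
  E := X.E × Y.E
  X := X.X × Y.X
  chart x := (X.chart x.1).prod (Y.chart x.2)
  mem_source x := ⟨X.mem_source x.1, Y.mem_source x.2⟩
  compat x y z hz := (X.compat x.1 y.1 z.1 ⟨hz.1.1, hz.2.1⟩).prodMap
    (Y.compat x.2 y.2 z.2 ⟨hz.1.2, hz.2.2⟩)
  vert := X.vert.prod Y.vert
  vert_mem x y z hz v hv := by
    have e := D_prodMap (X.compat x.1 y.1 z.1 ⟨hz.1.1, hz.2.1⟩)
      (Y.compat x.2 y.2 z.2 ⟨hz.1.2, hz.2.2⟩) v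
    exact e ▸ ⟨X.vert_mem _ _ _ ⟨hz.1.1, hz.2.1⟩ _ hv.1, Y.vert_mem _ _ _ ⟨hz.1.2, hz.2.2⟩ _ hv.2⟩

/-- The power `X^p`. -/
def pow (X : FMfd.{u}) (p : ℕ) : FMfd.{u} where
  E := Fin p → X.E
  X := Fin p → X.X
  chart x := OpenPartialHomeomorph.pi fun i => X.chart (x i)
  mem_source x := fun i _ => X.mem_source (x i)
  compat x y z hz := SmoothAt.piMap fun i =>
    X.compat (x i) (y i) (z i) ⟨hz.1 i trivial, hz.2 i trivial⟩
  vert := Submodule.pi Set.univ fun _ => X.vert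
  vert_mem x y z hz v hv := by
    have e := D_piMap (fun i => X.compat (x i) (y i) (z i) ⟨hz.1 i trivial, hz.2 i trivial⟩) v
    exact e ▸ fun i _ => X.vert_mem _ _ _ ⟨hz.1 i trivial, hz.2 i trivial⟩ _ (hv i trivial)

variable {X Y Z : FMfd.{u}}

theorem plotAt_prod {p : E → (prod X Y).X} {z : E} : (prod X Y).PlotAt p z ↔
    X.PlotAt (fun y => (p y).1) z ∧ Y.PlotAt (fun y => (p y).2) z := by
  constructor
  · intro h
    exact ⟨⟨continuousAt_fst.comp h.1, (SmoothAt.linear (ContinuousLinearMap.fst ℝ X.E Y.E) _).comp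
      h.2⟩, ⟨continuousAt_snd.comp h.1, (SmoothAt.linear (ContinuousLinearMap.snd ℝ X.E Y.E) _).comp
      h.2⟩⟩
  · intro h
    exact ⟨h.1.1.prodMk h.2.1, h.1.2.prodMk h.2.2⟩

theorem plotAt_pow {n : ℕ} {p : E → (pow X n).X} {z : E} : (pow X n).PlotAt p z ↔
    ∀ i, X.PlotAt (fun y => p y i) z := by
  constructor
  · intro h i
    exact ⟨(continuous_apply i).continuousAt.comp h.1,
      (SmoothAt.linear (ContinuousLinearMap.proj i : (Fin n → X.E) →L[ℝ] X.E) _).comp h.2⟩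
  · intro h
    exact ⟨continuousAt_pi.2 fun i => (h i).1, SmoothAt.pi fun i => (h i).2⟩

theorem Smooth.prodMk {f : Z.X → X.X} {g : Z.X → Y.X} (hf : Smooth f) (hg : Smooth g) :
    Smooth (Y := prod X Y) fun z => (f z, g z) := fun z => plotAt_prod.2 ⟨hf z, hg z⟩

theorem smooth_fst : Smooth (X := prod X Y) (Y := X) Prod.fst :=
  fun z => (plotAt_prod.1 (plotAt_symm z (chart_mem_target z))).1

theorem smooth_snd : Smooth (X := prod X Y) (Y := Y) Prod.snd :=
  fun z => (plotAt_prod.1 (plotAt_symm z (chart_mem_target z))).2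

theorem smooth_proj {n : ℕ} (i : Fin n) : Smooth (X := pow X n) (Y := X) fun x => x i :=
  fun z => plotAt_pow.1 (plotAt_symm z (chart_mem_target z)) i

theorem Smooth.powMk {n : ℕ} {f : Z.X → Fin n → X.X} (hf : ∀ i, Smooth fun z => f z i) :
    Smooth (Y := pow X n) f := fun z => plotAt_pow.2 fun i => hf i z

theorem smooth_const (x : X.X) : Smooth fun _ : Z.X => x := fun _ =>
  ⟨continuousAt_const, SmoothAt.const (X.chart x x) _⟩

end FMfd

variable [IsTopologicalAddGroup E] [ContinuousSMul ℝ E] [T2Space E] [LocallyConvexSpace ℝ E]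

/-- The manifold `M`, as a submersion onto a point: all directions are vertical. -/
def fibreMfd (E : Type u) [AddCommGroup E] [Module ℝ E] [TopologicalSpace E]
    [IsTopologicalAddGroup E] [ContinuousSMul ℝ E] [T2Space E] [LocallyConvexSpace ℝ E]
    (M : Type u) [TopologicalSpace M] [ChartedSpace E M] [LCManifold E M] : FMfd.{u} where
  E := E
  X := M
  chart x := chartAt E x
  mem_source x := mem_chart_source E x
  compat x y := LCManifold.compat _ (chart_mem_atlas E x) _ (chart_mem_atlas E y)
  vert := ⊤
  vert_mem _ _ _ _ _ _ := trivial

/-- The manifold `M`, as a submersion onto itself: no direction is vertical. -/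
def baseMfd (E : Type u) [AddCommGroup E] [Module ℝ E] [TopologicalSpace E]
    [IsTopologicalAddGroup E] [ContinuousSMul ℝ E] [T2Space E] [LocallyConvexSpace ℝ E]
    (M : Type u) [TopologicalSpace M] [ChartedSpace E M] [LCManifold E M] : FMfd.{u} :=
  { fibreMfd E M with
    vert := ⊥
    vert_mem := fun x y z hz v hv => by
      rw [(Submodule.mem_bot ℝ).1 hv]
      exact (Submodule.mem_bot ℝ).2 (D_zero _ _) }

/-- `G` is a Lie group modelled on `E`. -/
class LCLieGroup (E : Type u) [AddCommGroup E] [Module ℝ E] [TopologicalSpace E]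
    [IsTopologicalAddGroup E] [ContinuousSMul ℝ E] [T2Space E] [LocallyConvexSpace ℝ E]
    (G : Type u) [TopologicalSpace G] [ChartedSpace E G] [Group G] : Prop
    extends LCManifold E G where
  smooth_mul : FMfd.Smooth (X := (baseMfd E G).prod (baseMfd E G)) (Y := baseMfd E G)
    fun p : G × G => p.1 * p.2
  smooth_inv : FMfd.Smooth (X := baseMfd E G) (Y := baseMfd E G) (Inv.inv : G → G)

variable {E' : Type u} [AddCommGroup E'] [Module ℝ E'] [TopologicalSpace E']
  [IsTopologicalAddGroup E'] [ContinuousSMul ℝ E'] [T2Space E'] [LocallyConvexSpace ℝ E']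

/-- The Lie group `G` acts smoothly on the manifold `M`. -/
class LCSmoothAction (E E' : Type u) [AddCommGroup E] [Module ℝ E] [TopologicalSpace E]
    [IsTopologicalAddGroup E] [ContinuousSMul ℝ E] [T2Space E] [LocallyConvexSpace ℝ E]
    [AddCommGroup E'] [Module ℝ E'] [TopologicalSpace E']
    [IsTopologicalAddGroup E'] [ContinuousSMul ℝ E'] [T2Space E'] [LocallyConvexSpace ℝ E']
    (G M : Type u) [TopologicalSpace G] [ChartedSpace E G] [TopologicalSpace M]
    [ChartedSpace E' M] [LCManifold E G] [LCManifold E' M] [SMul G M] : Prop where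
  smooth_smul : FMfd.Smooth (X := (baseMfd E G).prod (fibreMfd E' M)) (Y := fibreMfd E' M)
    fun p : G × M => p.1 • p.2

section Segments

variable {G : Type u} [Group G]

/-- The product `g_a g_{a+1} ⋯ g_{a+n-1}` (indices from `0`; factors out of range are omitted). -/
def iprod {p : ℕ} (g : Fin p → G) (a : ℕ) : ℕ → G
  | 0 => 1
  | n + 1 => iprod g a n * (if h : a + n < p then g ⟨a + n, h⟩ else 1)

/-- The product `g_a g_{a+1} ⋯ g_{b-1}` (indices from `0`). -/
def seg {p : ℕ} (g : Fin p → G) (a b : ℕ) : G := iprod g a (b - a)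

theorem iprod_add {p : ℕ} (g : Fin p → G) (a m n : ℕ) :
    iprod g a (m + n) = iprod g a m * iprod g (a + m) n := by
  induction n with
  | zero => simp [iprod]
  | succ n ih => rw [← add_assoc, iprod, ih, iprod, mul_assoc, add_assoc]

theorem seg_mul {p : ℕ} (g : Fin p → G) {a b c : ℕ} (h : a ≤ b) (h' : b ≤ c) :
    seg g a b * seg g b c = seg g a c := by
  have e := iprod_add g a (b - a) (c - b)
  rw [show b - a + (c - b) = c - a by omega, show a + (b - a) = b by omega] at e
  exact e.symm

theorem seg_self {p : ℕ} (g : Fin p → G) (a : ℕ) : seg g a a = 1 := by simp [seg, iprod]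

theorem seg_succ {p : ℕ} (g : Fin p → G) (j : Fin p) : seg g j (j + 1) = g j := by
  simp [seg, iprod]

theorem seg_seg {p q : ℕ} (g : Fin p → G) (h : Fin q → G) (F : ℕ → ℕ) (hF : Monotone F)
    (hh : ∀ j : Fin q, h j = seg g (F j) (F (j + 1))) (a n : ℕ) (hn : a + n ≤ q) :
    seg h a (a + n) = seg g (F a) (F (a + n)) := by
  induction n with
  | zero => simp [seg_self]
  | succ n ih =>
    have e := seg_succ h ⟨a + n, by omega⟩
    change seg h a (a + n).succ = seg g (F a) (F (a + n).succ)
    rw [← seg_mul h (Nat.le_add_right a n) (Nat.le_succ _), ih (by omega),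
      show seg h (a + n) (a + n).succ = h ⟨a + n, by omega⟩ from e, hh]
    exact seg_mul g (hF (Nat.le_add_right a n)) (hF (Nat.le_succ _))

end Segments

section

variable (E E') (G M : Type u) [TopologicalSpace G] [ChartedSpace E G] [Group G]
  [LCLieGroup E G] [TopologicalSpace M] [ChartedSpace E' M] [LCManifold E' M] [MulAction G M]
  [LCSmoothAction E E' G M]

/-- The manifold `G^p × M`; the vertical directions are those of the projection to `G^p`. -/
def levelMfd (E E' : Type u) [AddCommGroup E] [Module ℝ E] [TopologicalSpace E]
    [IsTopologicalAddGroup E] [ContinuousSMul ℝ E] [T2Space E] [LocallyConvexSpace ℝ E]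
    [AddCommGroup E'] [Module ℝ E'] [TopologicalSpace E']
    [IsTopologicalAddGroup E'] [ContinuousSMul ℝ E'] [T2Space E'] [LocallyConvexSpace ℝ E']
    (G M : Type u) [TopologicalSpace G] [ChartedSpace E G] [LCManifold E G] [TopologicalSpace M]
    [ChartedSpace E' M] [LCManifold E' M] (p : ℕ) : FMfd.{u} :=
  ((baseMfd E G).pow p).prod (fibreMfd E' M)

variable {E G} in
theorem smooth_seg (p a b : ℕ) : FMfd.Smooth (X := (baseMfd E G).pow p) (Y := baseMfd E G)
    fun g : Fin p → G => seg (G := G) g a b := by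
  unfold seg
  generalize b - a = n
  induction n with
  | zero => exact FMfd.smooth_const (X := baseMfd E G) (1 : G)
  | succ n ih =>
    have h : FMfd.Smooth (X := (baseMfd E G).pow p) (Y := baseMfd E G)
        fun g : Fin p → G => if h : a + n < p then g ⟨a + n, h⟩ else (1 : G) := by
      by_cases hn : a + n < p
      · have e : (fun g : Fin p → G => if h : a + n < p then g ⟨a + n, h⟩ else (1 : G)) =
            fun g => g ⟨a + n, hn⟩ := funext fun g => dif_pos hn
        exact e ▸ FMfd.smooth_proj (X := baseMfd E G) ⟨a + n, hn⟩
      · have e : (fun g : Fin p → G => if h : a + n < p then g ⟨a + n, h⟩ else (1 : G)) =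
            fun _ => 1 := funext fun g => dif_neg hn
        exact e ▸ FMfd.smooth_const (X := baseMfd E G) (1 : G)
    exact LCLieGroup.smooth_mul.comp (ih.prodMk h)

/-- The map `G^p × M → G^q × M` given by a map `φ : [q] → [p]`:
`(g₁, …, g_p, x) ↦ (h₁, …, h_q, y)` with `h_j = g_{φ(j-1)+1} ⋯ g_{φ(j)}` and
`y = g_{φ(q)+1} ⋯ g_p x`. -/
def simplexMap (G M : Type u) [Group G] [MulAction G M] {p q : ℕ}
    (φ : Fin (q + 1) →o Fin (p + 1)) (x : (Fin p → G) × M) :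
    (Fin q → G) × M :=
  (fun j => seg x.1 (φ j.castSucc) (φ j.succ), seg x.1 (φ (Fin.last q)) p • x.2)

theorem simplexMap_smooth {p q : ℕ} (φ : Fin (q + 1) →o Fin (p + 1)) :
    FMfd.Smooth (X := levelMfd E E' G M p) (Y := levelMfd E E' G M q) (simplexMap G M φ) := by
  have h : ∀ a b : ℕ, FMfd.Smooth (X := levelMfd E E' G M p) (Y := baseMfd E G)
      fun x : (Fin p → G) × M => seg (G := G) x.1 a b := fun a b =>
    (smooth_seg (E := E) (G := G) p a b).comp
      (FMfd.smooth_fst (X := (baseMfd E G).pow p) (Y := fibreMfd E' M))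
  exact FMfd.Smooth.prodMk (X := (baseMfd E G).pow q) (Y := fibreMfd E' M)
    (Z := levelMfd E E' G M p)
    (f := fun x : (Fin p → G) × M => fun j => seg (G := G) x.1 (φ j.castSucc) (φ j.succ))
    (g := fun x : (Fin p → G) × M => seg (G := G) x.1 (φ (Fin.last q)) p • x.2)
    (FMfd.Smooth.powMk (X := baseMfd E G) fun j => h _ _)
    ((LCSmoothAction.smooth_smul (E := E) (E' := E') (G := G) (M := M)).comp
      ((h _ _).prodMk (FMfd.smooth_snd (X := (baseMfd E G).pow p) (Y := fibreMfd E' M))))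

theorem simplexMap_vert {p q : ℕ} (φ : Fin (q + 1) →o Fin (p + 1)) (x : (levelMfd E E' G M p).X)
    (v : (levelMfd E E' G M p).E) (hv : v ∈ (levelMfd E E' G M p).vert) :
    FMfd.T (Y := levelMfd E E' G M q) (simplexMap G M φ) x v ∈ (levelMfd E E' G M q).vert := by
  refine ⟨?_, trivial⟩
  have hs := (simplexMap_smooth E E' G M φ x).smoothAt_chart (simplexMap G M φ x)
    (by rw [FMfd.symm_chart]; exact FMfd.mem_source _ _)
  have e : (FMfd.T (Y := levelMfd E E' G M q) (simplexMap G M φ) x v).1 = 0 :=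
    D_fst_eq_zero hs (fun w w' hw => congrArg (fun w : Fin p → E =>
      ((baseMfd E G).pow q).chart (simplexMap G M φ x).1
        fun j => seg (G := G) (((baseMfd E G).pow p).chart x.1 |>.symm w)
          (φ j.castSucc) (φ j.succ)) hw)
      (funext fun i => (Submodule.mem_bot ℝ).1 (hv.1 i trivial))
  exact e ▸ Submodule.zero_mem _

variable {G M} in
theorem simplexMap_comp {p q r : ℕ} (φ : Fin (q + 1) →o Fin (p + 1))
    (ψ : Fin (r + 1) →o Fin (q + 1)) (x : (Fin p → G) × M) :
    simplexMap G M (φ.comp ψ) x = simplexMap G M ψ (simplexMap G M φ x) := by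
  let F : ℕ → ℕ := fun n => φ ⟨min n q, by omega⟩
  have hF : Monotone F := fun a b hab => φ.monotone (Fin.mk_le_mk.2 (by omega))
  have hF' : ∀ i : Fin (q + 1), F i = φ i := fun i => by
    have : (⟨min (i : ℕ) q, by omega⟩ : Fin (q + 1)) = i := Fin.ext (by simp; omega)
    simp only [F, this]
  have key : ∀ a b : Fin (q + 1), a ≤ b → seg (simplexMap G M φ x).1 a b = seg x.1 (φ a) (φ b) := by
    intro a b hab
    have h := seg_seg x.1 (simplexMap G M φ x).1 F hF (fun j => by
      have h1 := hF' j.castSucc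
      have h2 := hF' j.succ
      simp only [Fin.val_castSucc, Fin.val_succ] at h1 h2
      rw [h1, h2]
      rfl) a (b - a) (by have := b.2; omega)
    rw [Nat.add_sub_cancel' hab, hF', hF'] at h
    exact h
  refine Prod.ext (funext fun j => ?_) ?_
  · exact (key _ _ (ψ.monotone (Fin.castSucc_le_succ j))).symm
  · have h := key (ψ (Fin.last r)) (Fin.last q) (Fin.le_last _)
    change _ = seg (simplexMap G M φ x).1 (ψ (Fin.last r)) (Fin.last q : Fin (q + 1)) •
      seg x.1 (φ (Fin.last q)) p • x.2
    rw [h, smul_smul, seg_mul x.1 (φ.monotone (Fin.le_last _)) (Nat.lt_succ_iff.1 (Fin.is_lt _))]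
    rfl

/-- The simplicial manifold `G^• × M`. -/
def simplicialMfd : SimplexCategoryᵒᵖ ⥤ FMfd.{u} where
  obj n := levelMfd E E' G M n.unop.len
  map φ := ⟨simplexMap G M φ.unop.toOrderHom, simplexMap_smooth E E' G M _,
    simplexMap_vert E E' G M _⟩
  map_id n := by
    refine FMfd.Hom.ext (funext fun x => Prod.ext (funext fun j => ?_) ?_)
    · exact seg_succ (G := G) x.1 j
    · exact (congrArg (fun g : G => (g • (show M from x.2) : M)) (seg_self (G := G) x.1 _)).trans
        (one_smul G (show M from x.2))
  map_comp φ ψ := FMfd.Hom.ext (funext fun x => simplexMap_comp (G := G) (M := M) _ _ x)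

end

end SimplicialManifold

/-! ### The cohomology of a simplicial manifold -/

section Hypercohomology

/-- The signs of the total complex of a double cochain complex: the total differential is
`d₁ + (-1)^p d₂` on the term of bidegree `(p, q)`. -/
instance : ComplexShape.TensorSigns (ComplexShape.up ℕ) where
  ε' := MonoidHom.mk' (fun i : ℕ => (-1 : ℤˣ) ^ i) (pow_add (-1 : ℤˣ))
  rel_add p q r (hpq : p + 1 = q) := show p + r + 1 = q + r by omega
  add_rel p q r (hpq : p + 1 = q) := show r + p + 1 = r + q by omega
  ε'_succ p q (hpq : p + 1 = q) := by
    subst hpq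
    exact (pow_succ (-1 : ℤˣ) p).trans (by rw [mul_neg, mul_one]; rfl)

variable (D : SimplexCategoryᵒᵖ ⥤ FMfd.{u})

/-- The functor `[p] ↦ ([p], D_p)`. -/
def wholeLevels : SimplexCategory ⥤ (DOpens D)ᵒᵖ where
  obj n := Opposite.op ⟨Opposite.op n, ⊤⟩
  map φ := Quiver.Hom.op (⟨φ.op, fun _ _ => trivial⟩ :
    (⟨Opposite.op _, ⊤⟩ : DOpens D) ⟶ ⟨Opposite.op _, ⊤⟩)
  map_id _ := rfl
  map_comp _ _ := rfl

/-- The cosimplicial abelian group `[p] ↦ Γ(D_p, S_p)` of a simplicial sheaf. -/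
noncomputable def cosimplicialSections : DSh D ⥤ CosimplicialObject AddCommGrpCat.{u} :=
  sheafToPresheaf _ _ ⋙ (Functor.whiskeringLeft _ _ _).obj (wholeLevels D)

/-- The complex `p ↦ Γ(D_p, S_p)` with differential the alternating sum of the pull-backs along the
face maps. -/
noncomputable def sectionsComplex : DSh D ⥤ CochainComplex AddCommGrpCat.{u} ℕ :=
  cosimplicialSections D ⋙ AlgebraicTopology.alternatingCofaceMapComplex AddCommGrpCat.{u}

instance : (sectionsComplex D).PreservesZeroMorphisms where
  map_zero _ _ := HomologicalComplex.Hom.ext (funext fun _ => rfl)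

/-- The double complex with term `Γ(D_p, (I^q)_p)` in bidegree `(p, q)`, for a complex `I` of
simplicial sheaves. -/
noncomputable def doubleComplex (I : CochainComplex (DSh D) ℕ) :
    HomologicalComplex₂ AddCommGrpCat.{u} (ComplexShape.up ℕ) (ComplexShape.up ℕ) :=
  HomologicalComplex₂.flip (((sectionsComplex D).mapHomologicalComplex (ComplexShape.up ℕ)).obj I)

/-- The total complex of the double complex of sections of an injective resolution. -/
noncomputable def totalComplex (K : CochainComplex (DSh D) ℕ) :
    CochainComplex AddCommGrpCat.{u} ℕ :=
  (doubleComplex D (injRes K).I).total (ComplexShape.up ℕ)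

/-- The cohomology `H^m(D_•, K)` of a complex of simplicial sheaves on a simplicial manifold: the
cohomology of the total complex of the double complex of sections of an injective resolution. -/
noncomputable def simplicialCoh (K : CochainComplex (DSh D) ℕ) (m : ℕ) : AddCommGrpCat.{u} :=
  (totalComplex D K).homology m

/-- The subgroup `F^p = ⨁_{i ≥ p} Γ(D_i, (I^j)_i)` (`i + j = m`) of the total complex in degree
`m`. -/
noncomputable def stage (K : CochainComplex (DSh D) ℕ) (m p : ℕ) :
    AddSubgroup ((totalComplex D K).X m) :=
  ⨆ (i : ℕ) (j : ℕ) (h : i + j = m) (_ : p ≤ i),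
    ((doubleComplex D (injRes K).I).ιTotal (ComplexShape.up ℕ) i j m h).hom.range

/-- The filtration of `H^m(D_•, K)` by the simplicial degree: `F^p` consists of the classes of the
cocycles that lie in `⨁_{i ≥ p} Γ(D_i, (I^j)_i)`. -/
noncomputable def simplicialFiltration (K : CochainComplex (DSh D) ℕ) (m p : ℕ) :
    AddSubgroup (simplicialCoh D K m) :=
  ((stage D K m p).comap ((totalComplex D K).iCycles m).hom).map
    ((totalComplex D K).homologyπ m).hom

/-- The alternating sum `∑ (-1)^i (∂_i)^* : H^q(D_p, K) → H^q(D_{p+1}, K)` of the pull-backs along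
the face maps. -/
noncomputable def faceSum (K : CochainComplex (DSh D) ℕ) (q p : ℕ) :
    levelCoh D K (Opposite.op (SimplexCategory.mk p)) q ⟶
      levelCoh D K (Opposite.op (SimplexCategory.mk (p + 1))) q :=
  ∑ i : Fin (p + 2), (-1 : ℤ) ^ (i : ℕ) • levelPullback D K (SimplexCategory.δ i).op q

end Hypercohomology

section Comparison

variable {J : Type} [Category.{0} J]

instance {X Y : FMfd.{u}} (f : X ⟶ Y) : (push (FMfd.toTop f)).Additive where
  map_add := rfl

/-- The pull-back of the sections of a complex of sheaves on all manifolds along `f : D j → Y`. -/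
noncomputable def pullComplex (K : CochainComplex (OpenMfd.{u}ᵒᵖ ⥤ AddCommGrpCat.{u}) ℕ)
    (h : IsSheafComplex K) (D : J ⥤ FMfd.{u}) (j : J) {Y : FMfd.{u}} (f : D.obj j ⟶ Y) :
    onSpace K h Y ⟶ ((push (FMfd.toTop f)).mapHomologicalComplex _).obj
      (((component D j).mapHomologicalComplex _).obj (onDiagram K h D)) where
  f q := ⟨{ app := fun V => (K.X q).map (Quiver.Hom.op (⟨f, fun _ hx => hx⟩ :
              (⟨D.obj j, (Opens.map (FMfd.toTop f)).obj V.unop⟩ : OpenMfd) ⟶ ⟨Y, V.unop⟩))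
            naturality := fun V W i => by
              refine ((K.X q).map_comp _ _).symm.trans (Eq.trans ?_ ((K.X q).map_comp _ _))
              refine congrArg (fun g => (K.X q).map (Quiver.Hom.op g)) (OpenMfd.Hom.ext ?_)
              refine (Category.comp_id f).trans ((Category.id_comp f).symm.trans ?_)
              exact congrArg (· ≫ f) (D.map_id j).symm }⟩
  comm' q q' _ := Sheaf.hom_ext (NatTrans.ext (funext fun V => (K.d q q').naturality _))

/-- The natural map `H^q(Y, F(N)) → H^q(D j, F̄(N))` for `f : D j → Y`. -/
noncomputable def barPullback (N : ℕ) (D : J ⥤ FMfd.{u}) (j : J) {Y : FMfd.{u}} (f : D.obj j ⟶ Y)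
    (q : ℕ) : coh (onSpace (deligneComplex N) (isSheafComplex_deligne N) Y) q ⟶
      levelCoh D (barDeligne D N) j q :=
  cohMap (FMfd.toTop f) (pullComplex (deligneComplex N) (isSheafComplex_deligne N) D j f ≫
    ((push (FMfd.toTop f)).mapHomologicalComplex _).map
      (((component D j).mapHomologicalComplex _).map (Limits.cokernel.π _))) q

end Comparison

section Equivariant

variable {E : Type u} [AddCommGroup E] [Module ℝ E] [TopologicalSpace E]
  [IsTopologicalAddGroup E] [ContinuousSMul ℝ E] [T2Space E] [LocallyConvexSpace ℝ E]
  {E' : Type u} [AddCommGroup E'] [Module ℝ E'] [TopologicalSpace E']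
  [IsTopologicalAddGroup E'] [ContinuousSMul ℝ E'] [T2Space E'] [LocallyConvexSpace ℝ E']
  (G M : Type u) [TopologicalSpace G] [ChartedSpace E G] [Group G]
  [LCLieGroup E G] [TopologicalSpace M] [ChartedSpace E' M] [LCManifold E' M] [MulAction G M]
  [LCSmoothAction E E' G M]

variable (E E')

/-- The complex `F̄(N)` of simplicial sheaves on `G^• × M`. -/
noncomputable def equivDeligne (N : ℕ) : CochainComplex (DSh (simplicialMfd E E' G M)) ℕ :=
  barDeligne (simplicialMfd E E' G M) N

/-- The Deligne cohomology `H^q(M, F(N))`. -/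
noncomputable def deligneCoh (M : Type u) [TopologicalSpace M] [ChartedSpace E' M]
    [LCManifold E' M] (N q : ℕ) : AddCommGrpCat.{u} :=
  coh (onSpace (deligneComplex N) (isSheafComplex_deligne N) (fibreMfd E' M)) q

/-- The equivariant Deligne cohomology `H^m(G^• × M, F̄(N))`. -/
noncomputable def equivDeligneCoh (N m : ℕ) : AddCommGrpCat.{u} :=
  simplicialCoh (simplicialMfd E E' G M) (equivDeligne E E' G M N) m

/-- The filtration of `H^m(G^• × M, F̄(N))` by the simplicial degree. -/
noncomputable def equivDeligneFiltration (N m : ℕ) :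
    ℕ → AddSubgroup (equivDeligneCoh E E' G M N m) :=
  simplicialFiltration (simplicialMfd E E' G M) (equivDeligne E E' G M N) m

/-- The cohomology `H^q(G^p × M, F̄(N))`. -/
noncomputable def deligneLevel (N p q : ℕ) : AddCommGrpCat.{u} :=
  levelCoh (simplicialMfd E E' G M) (equivDeligne E E' G M N) (Opposite.op (SimplexCategory.mk p)) q

/-- The map `∂ = ∑ (-1)^i (∂_i)^* : H^q(G^p × M, F̄(N)) → H^q(G^{p+1} × M, F̄(N))`. -/
noncomputable def faceDifferential (N q p : ℕ) :
    deligneLevel E E' G M N p q ⟶ deligneLevel E E' G M N (p + 1) q :=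
  faceSum (simplicialMfd E E' G M) (equivDeligne E E' G M N) q p

/-- The projection `G^0 × M → M`. -/
def levelZero : levelMfd E E' G M 0 ⟶ fibreMfd E' M :=
  ⟨fun x => x.2, FMfd.smooth_snd (X := (baseMfd E G).pow 0) (Y := fibreMfd E' M),
    fun _ _ _ => trivial⟩

/-- The natural map `H^q(M, F(N)) → H^q(G^0 × M, F̄(N))`. -/
noncomputable def deligneToLevelZero (N q : ℕ) :
    deligneCoh E' M N q ⟶ deligneLevel E E' G M N 0 q :=
  barPullback N (simplicialMfd E E' G M) (Opposite.op (SimplexCategory.mk 0))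
    (levelZero E E' G M) q

end Equivariant

/-- Convergence of a first quadrant spectral sequence to `H`, filtered by `F`: every
`H n = F⁰ ⊇ F¹ ⊇ ⋯ ⊇ F^{n+1} = 0`, and `F^p / F^{p+1}`, for `n = p + q`, is isomorphic to the
term `E_r^{p,q}` for all `r` so large that no non-zero differential enters or leaves it. -/
def ConvergesTo {r₀ : ℤ} (E : CohomologicalSpectralSequenceNat AddCommGrpCat.{u} r₀)
    (H : ℕ → AddCommGrpCat.{u}) (F : ∀ n, ℕ → AddSubgroup (H n)) : Prop :=
  (∀ n, Antitone (F n)) ∧ (∀ n, F n 0 = ⊤) ∧ (∀ n, F n (n + 1) = ⊥) ∧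
    ∀ (p q : ℕ) (r : ℤ) (hr : r₀ ≤ r), (p : ℤ) < r → (q : ℤ) + 1 < r →
      Nonempty ((E.page r hr).X (p, q) ≅ AddCommGrpCat.of
        (F (p + q) p ⧸ (F (p + q) (p + 1)).addSubgroupOf (F (p + q) p)))

end EquivDeligne

/-!
The spectral sequence is that of the double complex `K^{p,q} = Γ(G^p × M, I^{p,q})`, filtered by
the simplicial degree `p`, where `I` is the chosen injective resolution of `F̄(N)` by simplicial
sheaves.

For any double complex in the first quadrant the terms are built by hand as
`E_r^p = Z_r^p / (Z_{r-1}^{p+1} + d Z_{r-1}^{p-r+1})` from a filtered differential group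
(`FilteredDiff`); the first page is the cohomology of the columns, with the differential induced by
that of the rows (`firstPageIso`, `firstPageIso_d`), and the sequence converges to the cohomology of
the total complex (`doubleSpectralSequence_convergesTo`). It remains to identify the columns. The
component at one level of an injective simplicial sheaf is an injective sheaf
(`component_injective`): restriction to a level has a left adjoint on presheaves, and the latter
preserves monomorphisms because its values are direct sums of directed colimits
(`mono_colimMap`). Restriction to a level is also exact, so that the `p`-th column consists of the
global sections of an injective resolution of the `p`-th component of `F̄(N)`. As any two
injective resolutions compute the same cohomology, naturally in the sheaves and the spaces
(`InjRes.cohIso`, `InjRes.cohIso_naturality`), the cohomology of the `p`-th column is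
`H^q(G^p × M, F̄(N))`, and the differential becomes the alternating sum of the pull-backs along the
face maps (`columnIso`, `columnIso_faceSum`).

On `G^0 × M` every tangent vector is vertical, so that the subcomplex `F¹F(N)` is zero there and
`F(N) → F̄(N)` is an isomorphism; as `G^0 × M → M` is a diffeomorphism, the comparison map
`H^q(M, F(N)) → H^q(G^0 × M, F̄(N))` is an isomorphism (`isIso_deligneToLevelZero`).
-/

namespace EquivDeligne

/-! ### The spectral sequence of a filtered differential group -/

/-- A group `A` with a differential `d` and subgroups `W p n`, the `p`-th step of the filtration in
degree `n`. The filtration is that of a first quadrant double complex: `W p n` vanishes for `p > n`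
and is constant for `p ≤ 0`. Both indices are integers, so that no boundary case is special. -/
structure FilteredDiff (A : Type u) [AddCommGroup A] where
  d : A →+ A
  d_d : ∀ x, d (d x) = 0
  W : ℤ → ℤ → AddSubgroup A
  anti : ∀ {p p' : ℤ} (n : ℤ), p ≤ p' → W p' n ≤ W p n
  d_mem : ∀ {p n : ℤ} {x : A}, x ∈ W p n → d x ∈ W p (n + 1)
  eq_zero : ∀ {p n : ℤ} {x : A}, n < p → x ∈ W p n → x = 0
  W_of_nonpos : ∀ {p p' n : ℤ} {x : A}, p ≤ 0 → p' ≤ 0 → x ∈ W p n → x ∈ W p' n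

namespace FilteredDiff

variable {A : Type u} [AddCommGroup A] (F : FilteredDiff A)

/-- The approximate cycles `Z_r^p = {x ∈ W^p | d x ∈ W^{p+r}}`. -/
def cyc (r p n : ℤ) : AddSubgroup A := F.W p n ⊓ (F.W (p + r) (n + 1)).comap F.d

/-- The subgroup `Z_{r-1}^{p+1} + d Z_{r-1}^{p-r+1}` of `Z_r^p`. -/
def bd (r p n : ℤ) : AddSubgroup A :=
  F.cyc (r - 1) (p + 1) n ⊔ (F.cyc (r - 1) (p - r + 1) (n - 1)).map F.d

/-- The term `E_r^{p,n-p}` of the spectral sequence. -/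
abbrev Term (r p n : ℤ) : Type u := F.cyc r p n ⧸ (F.bd r p n).addSubgroupOf (F.cyc r p n)

variable {F} {r p n : ℤ} {x : A}

theorem mem_cyc {k m : ℤ} (hk : p + r = k) (hm : n + 1 = m) :
    x ∈ F.cyc r p n ↔ x ∈ F.W p n ∧ F.d x ∈ F.W k m := by
  subst hk hm
  rfl

/-- An element of `Z_{r-1}^{p+1} + d Z_{r-1}^{p-r+1}` as a sum `a + d y`: the condition on `d a` is
the condition on `d x`, as `d d y = 0`. -/
theorem mem_bd {k l m : ℤ} (hk : p + 1 = k) (hl : l + r = p + 1) (hm : m + 1 = n) :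
    x ∈ F.bd r p n ↔ ∃ a y, a ∈ F.W k n ∧ F.d x ∈ F.W (p + r) (n + 1) ∧ y ∈ F.W l m ∧
      F.d y ∈ F.W p n ∧ x = a + F.d y := by
  obtain rfl : l = p - r + 1 := by lia
  obtain rfl : m = n - 1 := by lia
  subst hk
  rw [bd, AddSubgroup.mem_sup]
  constructor
  · rintro ⟨a, ha, _, ⟨y, hy, rfl⟩, rfl⟩
    rw [mem_cyc (k := p + r) (m := n + 1) (by ring) (by ring)] at ha
    have hy' := (mem_cyc (k := p) (m := n) (by ring) (by ring)).1 hy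
    exact ⟨a, y, ha.1, by simpa [F.d_d] using ha.2, hy'.1, hy'.2, rfl⟩
  · rintro ⟨a, y, ha, hx, hy, hdy, rfl⟩
    refine ⟨a, (mem_cyc (k := p + r) (m := n + 1) (by ring) (by ring)).2
      ⟨ha, by simpa [F.d_d] using hx⟩, F.d y, ⟨y, ?_, rfl⟩, rfl⟩
    exact (mem_cyc (k := p) (m := n) (by ring) (by ring)).2 ⟨hy, hdy⟩

theorem d_mem_cyc {p' n' : ℤ} (hp : p + r = p') (hn : n + 1 = n') (hx : x ∈ F.cyc r p n) :
    F.d x ∈ F.cyc r p' n' :=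
  (mem_cyc rfl rfl).2 ⟨((mem_cyc hp hn).1 hx).2, by rw [F.d_d]; exact zero_mem _⟩

theorem d_mem_bd {p' n' : ℤ} (hp : p + r = p') (hn : n + 1 = n')
    (hx : x ∈ F.bd r p n) : F.d x ∈ F.bd r p' n' := by
  obtain ⟨a, y, ha, hx, hy, hdy, rfl⟩ := (mem_bd rfl (l := p - r + 1) (m := n - 1)
    (by ring) (by ring)).1 hx
  refine (mem_bd rfl (l := p + 1) (m := n) (by lia) hn).2 ⟨0, a, zero_mem _, ?_, ha, ?_, ?_⟩
  · rw [F.d_d]; exact zero_mem _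
  · subst hp hn; simpa [F.d_d] using hx
  · simp [F.d_d]

variable (F) in
/-- The differential `d_r` of the spectral sequence. -/
def termD (r p n p' n' : ℤ) (hp : p + r = p') (hn : n + 1 = n') :
    F.Term r p n →+ F.Term r p' n' :=
  QuotientAddGroup.map _ _ ((F.d.comp (F.cyc r p n).subtype).codRestrict (F.cyc r p' n')
    fun x => d_mem_cyc hp hn x.2) fun _ hx => d_mem_bd hp hn hx

theorem mk_eq_zero (x : F.cyc r p n) : (QuotientAddGroup.mk x : F.Term r p n) = 0 ↔
    (x : A) ∈ F.bd r p n :=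
  (QuotientAddGroup.eq_zero_iff _).trans AddSubgroup.mem_addSubgroupOf

/-- A class of `E_r^p` is killed by `d_r` if and only if it has a representative in `Z_{r+1}^p`. -/
theorem d_mem_bd_iff {p' n' : ℤ} (hp : p + r = p') (hn : n + 1 = n')
    (hx : x ∈ F.cyc r p n) : F.d x ∈ F.bd r p' n' ↔
      ∃ y ∈ F.cyc (r + 1) p n, x - y ∈ F.bd r p n := by
  constructor
  · intro h
    obtain ⟨a, v, ha, -, hv, hdv, e⟩ := (mem_bd rfl (l := p + 1) (m := n) (by lia) hn).1 h
    have hx' := (mem_cyc hp hn).1 hx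
    -- `d x = a + d v` with `a` one step deeper than required, so that `x - v` lies in `Z_{r+1}^p`
    refine ⟨x - v, (mem_cyc (k := p' + 1) (by lia) hn).2
      ⟨sub_mem hx'.1 (F.anti n (by lia) hv), by rw [map_sub, e]; simpa using ha⟩, ?_⟩
    refine (mem_bd rfl (l := p - r + 1) (m := n - 1) (by ring) (by ring)).2
      ⟨v, 0, hv, ?_, zero_mem _, by simp, by simp⟩
    subst hp hn
    simpa using hdv
  · rintro ⟨y, hy, h⟩
    obtain ⟨a, z, ha, hxy, hz, hdz, e⟩ := (mem_bd rfl (l := p - r + 1) (m := n - 1)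
      (by ring) (by ring)).1 h
    have hy' := (mem_cyc (k := p' + 1) (m := n') (by lia) hn).1 hy
    refine (mem_bd rfl (l := p + 1) (m := n) (by lia) hn).2 ⟨F.d y, a, hy'.2, ?_, ha, ?_, ?_⟩
    · rw [F.d_d]; exact zero_mem _
    · have : F.d (x - y) = F.d a := by rw [e]; simp [F.d_d]
      subst hp hn
      rwa [← this]
    · have : F.d (x - y) = F.d a := by rw [e]; simp [F.d_d]
      rw [map_sub] at this
      rw [← this]; abel

/-- An element of `Z_{r+1}^p` represents a boundary for `d_r` if and only if it represents zero
in `E_{r+1}^p`. -/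
theorem mem_bd_succ_iff {p' n' : ℤ} (hp : p' + r = p) (hn : n' + 1 = n)
    (hx : x ∈ F.cyc (r + 1) p n) : x ∈ F.bd (r + 1) p n ↔
      ∃ y ∈ F.cyc r p' n', x - F.d y ∈ F.bd r p n := by
  constructor
  · intro h
    obtain ⟨a, y, ha, hdx, hy, hdy, rfl⟩ := (mem_bd rfl (l := p') (m := n')
      (by lia) hn).1 h
    refine ⟨y, (mem_cyc hp hn).2 ⟨hy, hdy⟩, (mem_bd rfl (l := p - r + 1) (m := n - 1)
      (by ring) (by ring)).2 ⟨a, 0, ha, ?_, zero_mem _, by simp, by simp⟩⟩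
    simpa [F.d_d] using F.anti (n + 1) (by lia : p + r ≤ p + (r + 1)) hdx
  · rintro ⟨y, hy, h⟩
    obtain ⟨a, z, ha, -, hz, hdz, e⟩ := (mem_bd rfl (l := p - r + 1) (m := n')
      (by ring) hn).1 h
    have hy' := (mem_cyc hp hn).1 hy
    refine (mem_bd rfl (l := p') (m := n') (by lia) hn).2
      ⟨a, y + z, ha, ((mem_cyc rfl rfl).1 hx).2, add_mem hy'.1 (F.anti n' (by lia) hz), ?_, ?_⟩
    · rw [map_add]; exact add_mem hy'.2 hdz
    · rw [map_add, ← add_assoc, add_right_comm, ← e]; abel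

variable (F) in
/-- The `r`-th page of the spectral sequence, in the first quadrant. -/
noncomputable def page (r : ℤ) : HomologicalComplex AddCommGrpCat.{u}
    (ComplexShape.spectralSequenceNat (⟨r, 1 - r⟩ : ℤ × ℤ)) where
  X a := AddCommGrpCat.of (F.Term r a.1 (a.1 + a.2))
  d a b := open Classical in
    if h : (a.1 : ℤ) + r = b.1 ∧ (a.2 : ℤ) + (1 - r) = b.2 then
      AddCommGrpCat.ofHom (F.termD r a.1 (a.1 + a.2) b.1 (b.1 + b.2) h.1 (by lia)) else 0
  shape a b h := dif_neg h
  d_comp_d' a b c hab hbc := by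
    rw [dif_pos ⟨hab.1, hab.2⟩, dif_pos ⟨hbc.1, hbc.2⟩]
    ext x
    refine (mk_eq_zero _).2 ?_
    change F.d (F.d x) ∈ _
    rw [F.d_d]
    exact zero_mem _

theorem page_d {a b : ℕ × ℕ} (hp : (a.1 : ℤ) + r = b.1)
    (hn : (a.1 + a.2 : ℤ) + 1 = b.1 + b.2) :
    (F.page r).d a b =
      AddCommGrpCat.ofHom (F.termD r a.1 (a.1 + a.2) b.1 (b.1 + b.2) hp hn) :=
  dif_pos ⟨hp, by lia⟩

/-- The kernel of the differential of the page that leaves `a`. If the target lies outside of the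
first quadrant, the differential is zero, and every class has a representative in `Z_{r+1}`. -/
theorem page_d_next_eq_zero_iff (hr : 1 ≤ r) (a : ℕ × ℕ) (x : F.cyc r a.1 (a.1 + a.2)) :
    (F.page r).d a ((ComplexShape.spectralSequenceNat (⟨r, 1 - r⟩ : ℤ × ℤ)).next a)
      (QuotientAddGroup.mk x : F.Term r a.1 (a.1 + a.2)) = 0 ↔
    ∃ y ∈ F.cyc (r + 1) a.1 (a.1 + a.2), (x : A) - y ∈ F.bd r a.1 (a.1 + a.2) := by
  by_cases h : ∃ b, (ComplexShape.spectralSequenceNat (⟨r, 1 - r⟩ : ℤ × ℤ)).Rel a b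
  · obtain ⟨b, hb⟩ := h
    obtain ⟨hb1, hb2⟩ := id hb
    dsimp only at hb1 hb2
    rw [ComplexShape.next_eq' _ hb, page_d hb1 (by lia)]
    exact (mk_eq_zero _).trans (d_mem_bd_iff hb1 (by lia) x.2)
  · rw [(F.page r).shape _ _ fun hb => h ⟨_, hb⟩]
    refine ⟨fun _ => ⟨x, ?_, by simp⟩, fun _ => rfl⟩
    have hx := (mem_cyc rfl rfl).1 x.2
    -- the target lies below the quadrant, where the filtration has ended
    have : F.d x = 0 := F.eq_zero (by
      by_contra hlt
      refine h ⟨⟨(a.1 + r).toNat, (a.2 + (1 - r)).toNat⟩, ?_, ?_⟩ <;> dsimp only <;> lia) hx.2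
    exact (mem_cyc rfl rfl).2 ⟨hx.1, this ▸ zero_mem _⟩

/-- The image of the differential of the page that arrives at `a`. If the source lies outside of the
first quadrant, the differential is zero, and the boundaries that are new on the next page are
already zero on this one. -/
theorem page_d_prev_mem_range_iff (hr : 1 ≤ r) (a : ℕ × ℕ) (x : F.cyc r a.1 (a.1 + a.2))
    (hx : (x : A) ∈ F.cyc (r + 1) a.1 (a.1 + a.2)) :
    (∃ z, (F.page r).d ((ComplexShape.spectralSequenceNat (⟨r, 1 - r⟩ : ℤ × ℤ)).prev a) a z =
      (QuotientAddGroup.mk x : F.Term r a.1 (a.1 + a.2))) ↔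
    (x : A) ∈ F.bd (r + 1) a.1 (a.1 + a.2) := by
  by_cases h : ∃ b, (ComplexShape.spectralSequenceNat (⟨r, 1 - r⟩ : ℤ × ℤ)).Rel b a
  · obtain ⟨b, hb⟩ := h
    obtain ⟨hb1, hb2⟩ := id hb
    dsimp only at hb1 hb2
    rw [ComplexShape.prev_eq' _ hb, page_d hb1 (by lia),
      mem_bd_succ_iff hb1 (n' := b.1 + b.2) (by lia) hx]
    constructor
    · rintro ⟨z, hz⟩
      obtain ⟨z, rfl⟩ := QuotientAddGroup.mk_surjective z
      refine ⟨z, z.2, ?_⟩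
      have e : (QuotientAddGroup.mk (x - ⟨F.d z, d_mem_cyc hb1 (by lia) z.2⟩) :
          F.Term r a.1 (a.1 + a.2)) = 0 := sub_eq_zero.2 hz.symm
      exact (mk_eq_zero _).1 e
    · rintro ⟨y, hy, hxy⟩
      refine ⟨(QuotientAddGroup.mk ⟨y, hy⟩ : F.Term r b.1 (b.1 + b.2)), ?_⟩
      have e : (QuotientAddGroup.mk (x - ⟨F.d y, d_mem_cyc hb1 (by lia) hy⟩) :
          F.Term r a.1 (a.1 + a.2)) = 0 := (mk_eq_zero _).2 hxy
      exact (sub_eq_zero.1 e).symm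
  · have ha : (a.1 : ℤ) - r < 0 := by
      by_contra hlt
      refine h ⟨⟨(a.1 - r).toNat, (a.2 - (1 - r)).toNat⟩, ?_, ?_⟩ <;> dsimp only <;> lia
    -- the source lies to the left of the quadrant, where the filtration is constant
    rw [(F.page r).shape _ _ fun hb => h ⟨_, hb⟩, mem_bd_succ_iff (p' := a.1 - r)
      (n' := a.1 + a.2 - 1) (by ring) (by ring) hx]
    constructor
    · rintro ⟨z, hz⟩
      refine ⟨0, zero_mem _, ?_⟩
      have e : (QuotientAddGroup.mk x : F.Term r a.1 (a.1 + a.2)) = 0 := hz.symm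
      simpa using (mk_eq_zero _).1 e
    · rintro ⟨y, hy, hxy⟩
      have hy' := (mem_cyc (k := a.1) (m := a.1 + a.2) (by ring) (by ring)).1 hy
      have hdy : F.d y ∈ F.bd r a.1 (a.1 + a.2) :=
        (mem_bd rfl (l := a.1 - r + 1) (m := a.1 + a.2 - 1) (by ring) (by ring)).2
          ⟨0, y, zero_mem _, by rw [F.d_d]; exact zero_mem _,
            F.W_of_nonpos (by lia) (by lia) hy'.1, hy'.2, by simp⟩
      refine ⟨0, ((mk_eq_zero x).2 ?_).symm⟩
      simpa using add_mem hxy hdy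

/-- The isomorphism `B ≃ C` given by surjections of `Z` onto `B` and `C` with the same kernel. -/
noncomputable def equivOfSurjective {Z B C : Type u} [AddCommGroup Z] [AddCommGroup B]
    [AddCommGroup C] (f : Z →+ B) (g : Z →+ C) (hf : Function.Surjective f)
    (hg : Function.Surjective g) (h : ∀ x, f x = 0 ↔ g x = 0) : B ≃+ C :=
  (QuotientAddGroup.quotientKerEquivOfSurjective f hf).symm.trans
    ((QuotientAddGroup.quotientAddEquivOfEq (AddSubgroup.ext fun x => h x)).trans
      (QuotientAddGroup.quotientKerEquivOfSurjective g hg))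

theorem equivOfSurjective_apply {Z B C : Type u} [AddCommGroup Z] [AddCommGroup B]
    [AddCommGroup C] (f : Z →+ B) (g : Z →+ C) (hf : Function.Surjective f)
    (hg : Function.Surjective g) (h : ∀ x, f x = 0 ↔ g x = 0) (x : Z) :
    equivOfSurjective f g hf hg h (f x) = g x := by
  have : (QuotientAddGroup.quotientKerEquivOfSurjective f hf).symm (f x) = QuotientAddGroup.mk x :=
    (AddEquiv.symm_apply_eq _).2 rfl
  simp only [equivOfSurjective, AddEquiv.trans_apply, this]
  rfl

/-- A surjection from the kernel of `S.g` whose kernel is the image of `S.f` computes the homology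
of `S`. -/
theorem nonempty_homology_iso (S : ShortComplex AddCommGrpCat.{u}) {Z C : Type u} [AddCommGroup Z]
    [AddCommGroup C] (f : Z →+ S.X₂) (g : Z →+ C) (hg : Function.Surjective g)
    (hf : ∀ z, S.g (f z) = 0) (hf' : ∀ x, S.g x = 0 → ∃ z y, x - f z = S.f y)
    (h : ∀ z, (∃ y, S.f y = f z) ↔ g z = 0) : Nonempty (S.homology ≅ AddCommGrpCat.of C) := by
  let k : Z →+ AddMonoidHom.ker S.g.hom := f.codRestrict _ hf
  refine ⟨S.abHomologyIso ≪≫ AddEquiv.toAddCommGrpIso (equivOfSurjective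
    ((QuotientAddGroup.mk' (AddMonoidHom.range S.abToCycles)).comp k) g ?_ hg ?_)⟩
  · intro x
    obtain ⟨⟨x, hx⟩, rfl⟩ := QuotientAddGroup.mk_surjective x
    obtain ⟨z, y, e⟩ := hf' x hx
    refine ⟨z, QuotientAddGroup.eq_iff_sub_mem.2 ⟨-y, Subtype.ext ?_⟩⟩
    change S.f (-y) = f z - x
    rw [map_neg, ← e]
    abel
  · intro z
    rw [← h]
    refine (QuotientAddGroup.eq_zero_iff _).trans (exists_congr fun y => ?_)
    exact Subtype.ext_iff

theorem nonempty_page_homology_iso (r : ℤ) (hr : 1 ≤ r) (a : ℕ × ℕ) :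
    Nonempty ((F.page r).homology a ≅ (F.page (r + 1)).X a) := by
  have hle : F.cyc (r + 1) a.1 (a.1 + a.2) ≤ F.cyc r a.1 (a.1 + a.2) := fun x hx =>
    ⟨hx.1, F.anti _ (by lia) hx.2⟩
  refine nonempty_homology_iso ((F.page r).sc a)
    ((QuotientAddGroup.mk' ((F.bd r a.1 (a.1 + a.2)).addSubgroupOf _)).comp
      (AddSubgroup.inclusion hle)) (QuotientAddGroup.mk' _) QuotientAddGroup.mk_surjective ?_ ?_ ?_
  · intro z
    exact (page_d_next_eq_zero_iff hr a _).2 ⟨z, z.2, by simp⟩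
  · intro x hx
    obtain ⟨x, rfl⟩ := QuotientAddGroup.mk_surjective x
    obtain ⟨y, hy, hxy⟩ := (page_d_next_eq_zero_iff hr a _).1 hx
    refine ⟨⟨y, hy⟩, 0, Eq.trans ?_ (map_zero ((F.page r).sc a).f.hom).symm⟩
    exact (mk_eq_zero (x - ⟨y, hle hy⟩)).2 hxy
  · intro z
    exact (page_d_prev_mem_range_iff hr a (AddSubgroup.inclusion hle z) z.2).trans
      (mk_eq_zero z).symm

variable (F) in
/-- The spectral sequence of a filtered differential group. -/
noncomputable def spectralSequence : CohomologicalSpectralSequenceNat AddCommGrpCat.{u} 1 where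
  page r _ := F.page r
  iso r r' a hrr' hr := by
    subst hrr'
    exact (nonempty_page_homology_iso r hr a).some

/-- For large `r`, the approximate cycles are the cycles in `W^p`. -/
theorem mem_cyc_of_lt (h : n - p + 1 < r) : x ∈ F.cyc r p n ↔ x ∈ F.W p n ∧ F.d x = 0 := by
  rw [mem_cyc rfl rfl]
  refine and_congr_right fun _ => ⟨fun h' => F.eq_zero (by lia) h', fun h' => h' ▸ zero_mem _⟩

/-- For large `r`, a cycle in `W^p` represents zero in `E_r^p` if and only if it is the sum of an
element of `W^{p+1}` and a boundary. -/
theorem mem_bd_of_lt (h : n - p + 1 < r) (h' : p < r) (hx : x ∈ F.cyc r p n) :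
    x ∈ F.bd r p n ↔ ∃ y ∈ F.W 0 (n - 1), x - F.d y ∈ F.W (p + 1) n := by
  have hx' := (mem_cyc_of_lt h).1 hx
  rw [mem_bd rfl (l := p - r + 1) (m := n - 1) (by ring) (by ring)]
  constructor
  · rintro ⟨a, y, ha, -, hy, hdy, rfl⟩
    exact ⟨y, F.W_of_nonpos (by lia) le_rfl hy, by simpa using ha⟩
  · rintro ⟨y, hy, hxy⟩
    refine ⟨x - F.d y, y, hxy, hx'.2 ▸ zero_mem _, F.W_of_nonpos le_rfl (by lia) hy, ?_, by simp⟩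
    simpa using sub_mem hx'.1 (F.anti n (by lia) hxy)

end FilteredDiff

/-! ### The spectral sequence of a double complex -/

section CycleClass

variable (L L' : CochainComplex AddCommGrpCat.{u} ℕ) (q : ℕ)

/-- The cohomology class of a cocycle. -/
noncomputable def cycleClass : AddMonoidHom.ker (L.d q (q + 1)).hom →+ L.homology q :=
  (L.liftCycles (A := AddCommGrpCat.of (AddMonoidHom.ker (L.d q (q + 1)).hom))
    (AddCommGrpCat.ofHom (AddMonoidHom.ker (L.d q (q + 1)).hom).subtype) (q + 1) (by simp)
    (by ext z; exact z.2) ≫ L.homologyπ q).hom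

variable {L L' q}

theorem homologyπ_eq_cycleClass (c : L.cycles q) (hc : L.d q (q + 1) (L.iCycles q c) = 0) :
    L.homologyπ q c = cycleClass L q ⟨L.iCycles q c, hc⟩ := by
  refine congrArg (L.homologyπ q) ?_
  refine (AddCommGrpCat.mono_iff_injective (L.iCycles q)).1 inferInstance ?_
  exact (ConcreteCategory.congr_hom (L.liftCycles_i (A := AddCommGrpCat.of
    (AddMonoidHom.ker (L.d q (q + 1)).hom)) (AddCommGrpCat.ofHom
    (AddMonoidHom.ker (L.d q (q + 1)).hom).subtype) (q + 1) (by simp)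
    (by ext z; exact z.2)) ⟨L.iCycles q c, hc⟩).symm

theorem d_iCycles_apply (c : L.cycles q) : L.d q (q + 1) (L.iCycles q c) = 0 :=
  ConcreteCategory.congr_hom (L.iCycles_d q (q + 1)) c

theorem exists_iCycles_eq (z : AddMonoidHom.ker (L.d q (q + 1)).hom) :
    ∃ c : L.cycles q, L.iCycles q c = z :=
  ⟨_, (ConcreteCategory.congr_hom (L.liftCycles_i (A := AddCommGrpCat.of
    (AddMonoidHom.ker (L.d q (q + 1)).hom)) (AddCommGrpCat.ofHom
    (AddMonoidHom.ker (L.d q (q + 1)).hom).subtype) (q + 1) (by simp)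
    (by ext z; exact z.2)) z)⟩

theorem cycleClass_surjective : Function.Surjective (cycleClass L q) := by
  intro x
  obtain ⟨c, rfl⟩ := (AddCommGrpCat.epi_iff_surjective (L.homologyπ q)).1 inferInstance x
  exact ⟨_, (homologyπ_eq_cycleClass c (d_iCycles_apply c)).symm⟩

/-- A cocycle is cohomologous to zero if and only if it is a coboundary. In degree `q = 0` the
truncated subtraction makes the differential `L.d 0 0`, which vanishes. -/
theorem cycleClass_eq_zero_iff (z : AddMonoidHom.ker (L.d q (q + 1)).hom) :
    cycleClass L q z = 0 ↔ ∃ w, L.d (q - 1) q w = z := by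
  have hp : (ComplexShape.up ℕ).prev q = q - 1 := by cases q <;> simp
  let S := ShortComplex.mk _ _ (L.toCycles_comp_homologyπ (q - 1) q)
  have hS : S.Exact := S.exact_of_g_is_cokernel (L.homologyIsCokernel (q - 1) q hp)
  obtain ⟨c, hc⟩ := exists_iCycles_eq z
  have hz : cycleClass L q z = L.homologyπ q c := by
    rw [homologyπ_eq_cycleClass c (d_iCycles_apply c)]
    exact congrArg _ (Subtype.ext hc.symm)
  rw [hz, ← hc]
  constructor
  · intro h
    obtain ⟨w, hw⟩ := S.ab_exact_iff.1 hS c h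
    refine ⟨w, ?_⟩
    rw [← show L.toCycles (q - 1) q w = c from hw]
    exact (ConcreteCategory.congr_hom (L.toCycles_i (q - 1) q) w).symm
  · rintro ⟨w, hw⟩
    have : L.toCycles (q - 1) q w = c := by
      refine (AddCommGrpCat.mono_iff_injective (L.iCycles q)).1 inferInstance ?_
      rw [← hw]
      exact ConcreteCategory.congr_hom (L.toCycles_i (q - 1) q) w
    rw [← this]
    exact ConcreteCategory.congr_hom (L.toCycles_comp_homologyπ (q - 1) q) w

theorem homologyMap_cycleClass (φ : L ⟶ L') (z : AddMonoidHom.ker (L.d q (q + 1)).hom)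
    (hz : L'.d q (q + 1) (φ.f q z) = 0) : HomologicalComplex.homologyMap φ q (cycleClass L q z) =
      cycleClass L' q ⟨φ.f q z, hz⟩ := by
  obtain ⟨c, hc⟩ := exists_iCycles_eq z
  obtain rfl : ⟨L.iCycles q c, d_iCycles_apply c⟩ = z := Subtype.ext hc
  rw [← homologyπ_eq_cycleClass]
  refine (ConcreteCategory.congr_hom (HomologicalComplex.homologyπ_naturality φ q) c).trans ?_
  have e : L'.iCycles q (HomologicalComplex.cyclesMap φ q c) = φ.f q (L.iCycles q c) :=
    ConcreteCategory.congr_hom (HomologicalComplex.cyclesMap_i φ q) c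
  refine (homologyπ_eq_cycleClass _ (e ▸ hz)).trans (congrArg _ (Subtype.ext e))

end CycleClass

theorem map_units_smul {A B : AddCommGrpCat.{u}} (f : A ⟶ B) (a : ℤˣ) (x : A) :
    f (a • x) = a • f x := map_zsmul f.hom a.1 x

theorem units_smul_mem {A : Type u} [AddCommGroup A] (S : AddSubgroup A) (a : ℤˣ) {x : A}
    (hx : x ∈ S) : a • x ∈ S := zsmul_mem hx a.1

section DoubleComplex

variable (K : HomologicalComplex₂ AddCommGrpCat.{u} (ComplexShape.up ℕ) (ComplexShape.up ℕ))

/-- The total complex. -/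
noncomputable abbrev tot : CochainComplex AddCommGrpCat.{u} ℕ := K.total (ComplexShape.up ℕ)

/-- The inclusion of the summand of bidegree `(i, j)`. -/
noncomputable abbrev inj (i j m : ℕ) (h : i + j = m) : (K.X i).X j ⟶ (tot K).X m :=
  K.ιTotal (ComplexShape.up ℕ) i j m h

/-- The projection to the summand of bidegree `(i, j)`. -/
noncomputable def proj (i j m : ℕ) : (tot K).X m ⟶ (K.X i).X j :=
  K.totalDesc fun i' j' _ =>
    if h : i' = i ∧ j' = j then (K.XXIsoOfEq _ _ _ h.1 h.2).hom else 0

variable {K}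

theorem inj_proj (i j m : ℕ) (h : i + j = m) (z : (K.X i).X j) :
    proj K i j m (inj K i j m h z) = z := by
  refine (ConcreteCategory.congr_hom (K.ι_totalDesc _ i j h) z).trans ?_
  rw [dif_pos ⟨rfl, rfl⟩]
  simp

theorem inj_proj_of_ne (i j i' j' m : ℕ) (h : i + j = m) (hi : i ≠ i') (z : (K.X i).X j) :
    proj K i' j' m (inj K i j m h z) = 0 := by
  refine (ConcreteCategory.congr_hom (K.ι_totalDesc _ i j h) z).trans ?_
  rw [dif_neg fun h => hi h.1]
  rfl

/-- Every element of the total complex is the sum of its components. -/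
theorem exists_sum_inj (m : ℕ) (x : (tot K).X m) :
    x = ∑ a ∈ (Finset.HasAntidiagonal.antidiagonal m).attach, inj K a.1.1 a.1.2 m
      (Finset.HasAntidiagonal.mem_antidiagonal.1 a.2) (proj K a.1.1 a.1.2 m x) := by
  have key : 𝟙 ((tot K).X m) = ∑ a ∈ (Finset.HasAntidiagonal.antidiagonal m).attach,
      proj K a.1.1 a.1.2 m ≫
        inj K a.1.1 a.1.2 m (Finset.HasAntidiagonal.mem_antidiagonal.1 a.2) := by
    refine HomologicalComplex₂.total.hom_ext _ fun i j h => ?_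
    ext z
    have h' : i + j = m := h
    rw [Preadditive.comp_sum, Finset.sum_eq_single
      ⟨(i, j), Finset.HasAntidiagonal.mem_antidiagonal.2 h'⟩]
    · exact (congrArg (inj K i j m h) (inj_proj i j m h z)).symm
    · rintro ⟨⟨i', j'⟩, hij⟩ - hne
      have hij' : i' + j' = m := Finset.HasAntidiagonal.mem_antidiagonal.1 hij
      ext z
      refine (congrArg (inj K i' j' m hij') (inj_proj_of_ne i j i' j' m h ?_ z)).trans (map_zero _)
      rintro rfl
      obtain rfl : j = j' := by lia
      exact hne rfl
    · exact fun h => absurd (Finset.mem_attach _ _) h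
  have := ConcreteCategory.congr_hom key x
  exact this.trans (map_sum (AddMonoidHom.mk' (fun f : (tot K).X m ⟶ (tot K).X m => f x)
    fun _ _ => rfl) _ _)

theorem tot_d_inj (i j m : ℕ) (h : i + j = m) (z : (K.X i).X j) :
    (tot K).d m (m + 1) (inj K i j m h z) =
      inj K (i + 1) j (m + 1) (by lia) ((K.d i (i + 1)).f j z) +
        ((-1 : ℤˣ) ^ i) • inj K i (j + 1) (m + 1) (by lia) ((K.X i).d j (j + 1) z) := by
  have key : inj K i j m h ≫ (tot K).d m (m + 1) =
      (K.d i (i + 1)).f j ≫ inj K (i + 1) j (m + 1) (by lia) +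
        ((-1 : ℤˣ) ^ i) • ((K.X i).d j (j + 1) ≫ inj K i (j + 1) (m + 1) (by lia)) := by
    rw [HomologicalComplex₂.total_d, Preadditive.comp_add, K.ι_D₁, K.ι_D₂,
      K.d₁_eq (ComplexShape.up ℕ) (show (ComplexShape.up ℕ).Rel i (i + 1) from rfl) j (m + 1)
        (show i + 1 + j = m + 1 by lia),
      K.d₂_eq (ComplexShape.up ℕ) i (show (ComplexShape.up ℕ).Rel j (j + 1) from rfl) (m + 1)
        (show i + (j + 1) = m + 1 by lia)]
    congr 1
    exact one_smul _ _
  exact ConcreteCategory.congr_hom key z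

variable (K) in
/-- The filtration of the total complex by the first degree. -/
noncomputable def colFilt (m p : ℕ) : AddSubgroup ((tot K).X m) :=
  ⨆ (i : ℕ) (j : ℕ) (h : i + j = m) (_ : p ≤ i), (inj K i j m h).hom.range

theorem inj_mem_colFilt {i j m p : ℕ} (h : i + j = m) (hp : p ≤ i) (z : (K.X i).X j) :
    inj K i j m h z ∈ colFilt K m p :=
  AddSubgroup.mem_iSup_of_mem i (AddSubgroup.mem_iSup_of_mem j (AddSubgroup.mem_iSup_of_mem h
    (AddSubgroup.mem_iSup_of_mem hp ⟨z, rfl⟩)))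

theorem colFilt_le {m p : ℕ} {S : AddSubgroup ((tot K).X m)}
    (h : ∀ i j (h : i + j = m), p ≤ i → ∀ z, inj K i j m h z ∈ S) : colFilt K m p ≤ S :=
  iSup_le fun i => iSup_le fun j => iSup_le fun e => iSup_le fun hp => by
    rintro _ ⟨z, rfl⟩
    exact h i j e hp z

/-- The filtration in terms of components. -/
theorem mem_colFilt {m p : ℕ} {x : (tot K).X m} :
    x ∈ colFilt K m p ↔ ∀ i j, i + j = m → i < p → proj K i j m x = 0 := by
  constructor
  · intro hx i j h hi
    have : colFilt K m p ≤ (proj K i j m).hom.ker := colFilt_le fun i' j' h' hp z =>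
      inj_proj_of_ne i' j' i j m h' (by lia) z
    exact this hx
  · intro h
    rw [exists_sum_inj m x]
    refine sum_mem fun a _ => ?_
    have ha := Finset.HasAntidiagonal.mem_antidiagonal.1 a.2
    by_cases hp : a.1.1 < p
    · rw [h _ _ ha hp, map_zero]
      exact zero_mem _
    · exact inj_mem_colFilt _ (by lia) _

theorem colFilt_anti (m : ℕ) : Antitone (colFilt K m) := fun _ _ h =>
  colFilt_le fun _ _ e hp z => inj_mem_colFilt e (h.trans hp) z

theorem colFilt_zero (m : ℕ) : colFilt K m 0 = ⊤ :=
  top_unique fun _ _ => mem_colFilt.2 fun _ _ _ hi => absurd hi (Nat.not_lt_zero _)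

theorem colFilt_eq_bot {m p : ℕ} (h : m < p) : colFilt K m p = ⊥ :=
  bot_unique (colFilt_le fun _ _ _ _ _ => by lia)

theorem d_mem_colFilt {m p : ℕ} {x : (tot K).X m} (hx : x ∈ colFilt K m p) :
    (tot K).d m (m + 1) x ∈ colFilt K (m + 1) p := by
  have : colFilt K m p ≤ (colFilt K (m + 1) p).comap ((tot K).d m (m + 1)).hom :=
    colFilt_le fun i j h hp z => by
      change (tot K).d m (m + 1) (inj K i j m h z) ∈ colFilt K (m + 1) p
      rw [tot_d_inj]
      refine add_mem (inj_mem_colFilt _ (by lia) _) ?_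
      exact units_smul_mem _ _ (inj_mem_colFilt _ hp _)
  exact this hx

/-- The leading component of the total differential is the differential of the second direction,
up to sign. -/
theorem proj_d {m p q : ℕ} (h : p + q = m) {x : (tot K).X m} (hx : x ∈ colFilt K m p) :
    proj K p (q + 1) (m + 1) ((tot K).d m (m + 1) x) =
      ((-1 : ℤˣ) ^ p) • (K.X p).d q (q + 1) (proj K p q m x) := by
  have : colFilt K m p ≤ AddMonoidHom.eqLocus
      ((proj K p (q + 1) (m + 1)).hom.comp ((tot K).d m (m + 1)).hom)
      (((-1 : ℤˣ) ^ p) • ((K.X p).d q (q + 1)).hom.comp (proj K p q m).hom) :=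
    colFilt_le fun i j e hp z => by
      change proj K p (q + 1) (m + 1) ((tot K).d m (m + 1) (inj K i j m e z)) =
        ((-1 : ℤˣ) ^ p) • (K.X p).d q (q + 1) (proj K p q m (inj K i j m e z))
      rw [tot_d_inj, map_add, inj_proj_of_ne (i + 1) j _ _ _ _ (by lia), zero_add]
      rw [map_units_smul]
      rcases hp.eq_or_lt with rfl | hlt
      · obtain rfl : q = j := by lia
        rw [inj_proj, inj_proj]
      · rw [inj_proj_of_ne i _ _ _ _ _ (by lia), inj_proj_of_ne i _ _ _ _ _ (by lia), map_zero,
          smul_zero, smul_zero]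
  exact this hx

variable (K) in
/-- The total complex, filtered by the first degree, as a filtered differential group: the elements
are the families of elements of all degrees, and those of `W p n` are concentrated in degree `n`.
The value of `d` in degree `0` is that of `(tot K).d 0 0`, which is zero. -/
noncomputable def filteredTot : FilteredDiff (∀ m, (tot K).X m) where
  d := AddMonoidHom.mk' (fun x m => (tot K).d (m - 1) m (x (m - 1))) fun x y =>
    funext fun m => map_add _ _ _
  d_d x := funext fun m => ConcreteCategory.congr_hom ((tot K).d_comp_d (m - 1 - 1) (m - 1) m) _
  W p n :=
    { carrier := {x | ∀ m : ℕ, x m ∈ colFilt K m p.toNat ∧ ((m : ℤ) ≠ n → x m = 0)}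
      zero_mem' := fun m => ⟨zero_mem _, fun _ => rfl⟩
      add_mem' := fun hx hy m => ⟨add_mem (hx m).1 (hy m).1, fun h =>
        (congrArg₂ (· + ·) ((hx m).2 h) ((hy m).2 h)).trans (add_zero _)⟩
      neg_mem' := fun hx m => ⟨neg_mem (hx m).1, fun h =>
        (congrArg (- ·) ((hx m).2 h)).trans neg_zero⟩ }
  anti n h x hx m := ⟨colFilt_anti m (Int.toNat_le_toNat h) (hx m).1, (hx m).2⟩
  d_mem {p n x} hx m := by
    change (tot K).d (m - 1) m (x (m - 1)) ∈ colFilt K m p.toNat ∧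
      (_ → (tot K).d (m - 1) m (x (m - 1)) = 0)
    cases m with
    | zero =>
      rw [(tot K).shape _ _ (by simp)]
      exact ⟨zero_mem _, fun _ => rfl⟩
    | succ m =>
      refine ⟨d_mem_colFilt (hx m).1, fun h => ?_⟩
      rw [show x (m + 1 - 1) = 0 from (hx m).2 (by lia), map_zero]
  eq_zero {p n x} h hx := funext fun m => by
    by_cases hm : (m : ℤ) = n
    · have := (hx m).1
      rwa [colFilt_eq_bot (by lia)] at this
    · exact (hx m).2 hm
  W_of_nonpos {p p' n x} hp hp' hx := by
    rw [← Int.toNat_eq_zero] at hp hp'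
    intro m
    rw [hp', ← hp]
    exact hx m

theorem mem_W {p : ℕ} {n : ℤ} {x : ∀ m, (tot K).X m} : x ∈ (filteredTot K).W p n ↔
    ∀ m : ℕ, x m ∈ colFilt K m p ∧ ((m : ℤ) ≠ n → x m = 0) := Iff.rfl

theorem single_mem_W {p m : ℕ} {n : ℤ} (hn : n = m) {x : (tot K).X m} :
    Pi.single m x ∈ (filteredTot K).W p n ↔ x ∈ colFilt K m p := by
  subst hn
  rw [mem_W]
  constructor
  · intro h
    simpa using (h m).1
  · intro h k
    by_cases hk : k = m
    · subst hk
      simpa using h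
    · rw [Pi.single_eq_of_ne hk]
      exact ⟨zero_mem _, fun _ => rfl⟩

theorem eq_single {p n : ℤ} {m : ℕ} (hm : n = m) {x : ∀ m, (tot K).X m}
    (hx : x ∈ (filteredTot K).W p n) : x = Pi.single m (x m) := funext fun k => by
  by_cases hk : k = m
  · subst hk
    simp
  · rw [Pi.single_eq_of_ne hk]
    exact (hx k).2 (by lia)

theorem filteredTot_d_single {m : ℕ} (x : (tot K).X m) :
    (filteredTot K).d (Pi.single m x) = Pi.single (m + 1) ((tot K).d m (m + 1) x) := by
  funext k
  change (tot K).d (k - 1) k (Pi.single (M := fun m => (tot K).X m) m x (k - 1)) = _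
  by_cases hk : k = m + 1
  · subst hk
    simp
  · rw [Pi.single_eq_of_ne hk]
    by_cases hk' : k - 1 = m
    · obtain rfl : k = 0 := by lia
      rw [(tot K).shape _ _ (by simp)]
      rfl
    · rw [Pi.single_eq_of_ne hk', map_zero]

variable (K) in
/-- The spectral sequence of a double complex, filtered by the first degree. -/
noncomputable def doubleSpectralSequence : CohomologicalSpectralSequenceNat AddCommGrpCat.{u} 1 :=
  (filteredTot K).spectralSequence

/-- A cocycle of the `p`-th column is an approximate cycle of the total complex. -/
theorem single_inj_mem_cyc (p q : ℕ) (z : (K.X p).X q) (hz : (K.X p).d q (q + 1) z = 0) :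
    Pi.single (p + q) (inj K p q (p + q) rfl z) ∈ (filteredTot K).cyc 1 p (p + q) := by
  refine (FilteredDiff.mem_cyc (k := (p + 1 : ℕ)) (m := (p + q + 1 : ℕ)) (by push_cast; rfl)
    (by push_cast; rfl)).2
      ⟨(single_mem_W (by push_cast; ring)).2 (inj_mem_colFilt rfl le_rfl z), ?_⟩
  rw [filteredTot_d_single, tot_d_inj, hz, map_zero, smul_zero, add_zero]
  exact (single_mem_W (by push_cast; ring)).2 (inj_mem_colFilt _ le_rfl _)

variable (K) in
/-- The class in `E_1^{p,q}` of a cocycle of the `p`-th column. -/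
noncomputable def columnClass (p q : ℕ) : AddMonoidHom.ker ((K.X p).d q (q + 1)).hom →+
    (filteredTot K).Term 1 p (p + q) :=
  (QuotientAddGroup.mk' _).comp (((AddMonoidHom.single (fun m => (tot K).X m) (p + q)).comp
    ((inj K p q (p + q) rfl).hom.comp (AddSubgroup.subtype _))).codRestrict _
      fun z => single_inj_mem_cyc p q z.1 z.2)

theorem columnClass_apply (p q : ℕ) (z : AddMonoidHom.ker ((K.X p).d q (q + 1)).hom) :
    columnClass K p q z = QuotientAddGroup.mk ⟨_, single_inj_mem_cyc p q z.1 z.2⟩ := rfl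

/-- An approximate cycle of filtration `p` differs from its leading component by an element of
filtration `p + 1`. -/
theorem columnClass_surjective (p q : ℕ) : Function.Surjective (columnClass K p q) := by
  intro x
  obtain ⟨⟨x, hx⟩, rfl⟩ := QuotientAddGroup.mk_surjective x
  have hx' := (FilteredDiff.mem_cyc (k := (p + 1 : ℕ)) (m := (p + q + 1 : ℕ)) (by push_cast; rfl)
    (by push_cast; rfl)).1 hx
  obtain ⟨y, rfl⟩ : ∃ y, x = Pi.single (p + q) y :=
    ⟨_, eq_single (m := p + q) (by push_cast; rfl) hx'.1⟩
  rw [filteredTot_d_single] at hx'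
  have h1 : y ∈ colFilt K (p + q) p := (single_mem_W (by push_cast; ring)).1 hx'.1
  have h2 := mem_colFilt.1 ((single_mem_W (by push_cast; ring)).1 hx'.2) p (q + 1) (by lia) (by lia)
  rw [proj_d rfl h1] at h2
  have hz : (K.X p).d q (q + 1) (proj K p q (p + q) y) = 0 := (smul_eq_zero_iff_eq _).1 h2
  refine ⟨⟨_, hz⟩, ?_⟩
  rw [columnClass_apply, eq_comm, ← sub_eq_zero]
  refine (FilteredDiff.mk_eq_zero (⟨_, hx⟩ - ⟨_, single_inj_mem_cyc p q _ hz⟩)).2 ?_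
  refine (FilteredDiff.mem_bd (k := (p + 1 : ℕ)) (l := p) (m := (p + q : ℤ) - 1)
    (by push_cast; rfl) rfl (by ring)).2
    ⟨Pi.single (p + q) (y - inj K p q (p + q) rfl (proj K p q (p + q) y)), 0, ?_, ?_,
      zero_mem _, by rw [map_zero]; exact zero_mem _, ?_⟩
  · refine (single_mem_W (by push_cast; ring)).2 (mem_colFilt.2 fun i j e hi => ?_)
    rw [map_sub]
    by_cases hip : i = p
    · subst hip
      obtain rfl : j = q := by lia
      rw [inj_proj, sub_self]
    · rw [mem_colFilt.1 h1 i j e (by lia), inj_proj_of_ne _ _ _ _ _ _ (Ne.symm hip), sub_zero]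
  · exact (sub_mem (H := (filteredTot K).cyc 1 p (p + q)) hx (single_inj_mem_cyc p q _ hz)).2
  · rw [map_zero, add_zero]
    exact (Pi.single_sub (p + q) _ _).symm

/-- The leading component of a boundary `d y`, for `y` of filtration `p`, is a boundary of the
column. Conversely, a boundary of the column is, up to sign and an element of filtration `p + 1`, a
boundary of the total complex. -/
theorem columnClass_eq_zero_iff (p q : ℕ) (z : AddMonoidHom.ker ((K.X p).d q (q + 1)).hom) :
    columnClass K p q z = 0 ↔ cycleClass (K.X p) q z = 0 := by
  rw [columnClass_apply, FilteredDiff.mk_eq_zero, cycleClass_eq_zero_iff,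
    FilteredDiff.mem_bd (k := (p + 1 : ℕ)) (l := p) (m := (p + q : ℤ) - 1)
    (by push_cast; rfl) rfl (by ring)]
  obtain ⟨z, hz⟩ := z
  dsimp only
  constructor
  · rintro ⟨a, y, ha, -, hy, -, e⟩
    have e' := congrArg (fun x => proj K p q (p + q) (x (p + q))) e
    dsimp only at e'
    rw [Pi.single_eq_same, inj_proj, Pi.add_apply, map_add,
      mem_colFilt.1 (ha (p + q)).1 p q rfl (by lia), zero_add] at e'
    cases q with
    | zero =>
      rw [(filteredTot K).eq_zero (by simp) hy, map_zero] at e'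
      exact ⟨0, by rw [map_zero, e']; exact (map_zero _).symm⟩
    | succ q =>
      refine ⟨((-1 : ℤˣ) ^ p) • proj K p q (p + q) (y (p + q)), ?_⟩
      rw [map_units_smul]
      exact (proj_d rfl (hy (p + q)).1).symm.trans e'.symm
  · rintro ⟨w, hw⟩
    cases q with
    | zero =>
      rw [(K.X p).shape _ _ (by simp)] at hw
      obtain rfl : 0 = z := hw
      refine ⟨0, 0, zero_mem _, ?_, zero_mem _, by rw [map_zero]; exact zero_mem _, ?_⟩
      · simp
      · simp
    | succ q =>
      have key : Pi.single (p + q + 1) (inj K p (q + 1) (p + q + 1) rfl z) =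
          Pi.single (p + q + 1) (-(((-1 : ℤˣ) ^ p) •
            inj K (p + 1) q (p + q + 1) (by lia) ((K.d p (p + 1)).f q w))) +
          (filteredTot K).d (Pi.single (p + q) (((-1 : ℤˣ) ^ p) • inj K p q (p + q) rfl w)) := by
        rw [filteredTot_d_single, ← Pi.single_add, map_units_smul, tot_d_inj, smul_add, smul_smul,
          Int.units_mul_self, one_smul, neg_add_cancel_left, ← hw]
        rfl
      refine ⟨_, _, (single_mem_W (by push_cast; ring)).2 (neg_mem (units_smul_mem _ _
        (inj_mem_colFilt _ le_rfl _))), (single_inj_mem_cyc p (q + 1) z hz).2,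
        (single_mem_W (by push_cast; ring)).2 (units_smul_mem _ _ (inj_mem_colFilt _ le_rfl _)),
        ?_, key⟩
      rw [filteredTot_d_single]
      exact (single_mem_W (by push_cast; ring)).2 (d_mem_colFilt (units_smul_mem _ _
        (inj_mem_colFilt _ le_rfl _)))

variable (K) in
/-- The term `E_1^{p,q}` is the `q`-th cohomology group of the `p`-th column. -/
noncomputable def firstPageIso (p q : ℕ) :
    ((doubleSpectralSequence K).page 1 le_rfl).X (p, q) ≅ (K.X p).homology q :=
  AddEquiv.toAddCommGrpIso (FilteredDiff.equivOfSurjective (columnClass K p q)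
    (cycleClass (K.X p) q) (columnClass_surjective p q) cycleClass_surjective
    (columnClass_eq_zero_iff p q))

theorem firstPageIso_columnClass (p q : ℕ)
    (z : AddMonoidHom.ker ((K.X p).d q (q + 1)).hom) :
    (firstPageIso K p q).hom (columnClass K p q z) = cycleClass (K.X p) q z :=
  FilteredDiff.equivOfSurjective_apply _ _ _ _ _ z

/-- On the first page, the differential is induced by the first differential of the double
complex. -/
theorem firstPageIso_d (p q : ℕ) :
    ((doubleSpectralSequence K).page 1 le_rfl).d (p, q) (p + 1, q) ≫
      (firstPageIso K (p + 1) q).hom =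
    (firstPageIso K p q).hom ≫ HomologicalComplex.homologyMap (K.d p (p + 1)) q := by
  ext x
  obtain ⟨z, rfl⟩ := columnClass_surjective p q x
  have hz : (K.X (p + 1)).d q (q + 1) ((K.d p (p + 1)).f q z) = 0 := by
    refine (ConcreteCategory.congr_hom ((K.d p (p + 1)).comm q (q + 1)) z.1).trans ?_
    exact (congrArg ((K.d p (p + 1)).f (q + 1)) z.2).trans (map_zero _)
  have e : ((doubleSpectralSequence K).page 1 le_rfl).d (p, q) (p + 1, q) (columnClass K p q z) =
      columnClass K (p + 1) q ⟨(K.d p (p + 1)).f q z, hz⟩ := by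
    refine (ConcreteCategory.congr_hom (FilteredDiff.page_d (F := filteredTot K) (r := 1)
      (a := (p, q)) (b := (p + 1, q)) (by push_cast; rfl) (by push_cast; ring)) _).trans ?_
    refine congrArg QuotientAddGroup.mk (Subtype.ext ?_)
    refine (filteredTot_d_single (inj K p q (p + q) rfl z.1)).trans ?_
    rw [tot_d_inj, show (K.X p).d q (q + 1) z.1 = 0 from z.2, map_zero, smul_zero, add_zero]
    -- `p + q + 1` and `p + 1 + q` are equal, but not by definition
    have key : ∀ (m : ℕ) (h : p + 1 + q = m) (y : (K.X (p + 1)).X q),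
        (Pi.single m (inj K (p + 1) q m h y) : ∀ m, (tot K).X m) =
          Pi.single (p + 1 + q) (inj K (p + 1) q (p + 1 + q) rfl y) := by
      rintro m rfl y
      rfl
    exact key (p + q + 1) (by lia) _
  refine (congrArg (firstPageIso K (p + 1) q).hom e).trans ?_
  refine (firstPageIso_columnClass _ _ _).trans ?_
  refine (homologyMap_cycleClass _ _ hz).symm.trans ?_
  exact congrArg (HomologicalComplex.homologyMap (K.d p (p + 1)) q)
    (firstPageIso_columnClass p q z).symm

variable (K) in
/-- The filtration of the cohomology of the total complex: `F^p` consists of the classes of the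
cocycles in the `p`-th step of the filtration of the total complex. -/
noncomputable def homologyFilt (m p : ℕ) : AddSubgroup ((tot K).homology m) :=
  ((colFilt K m p).comap ((tot K).iCycles m).hom).map ((tot K).homologyπ m).hom

theorem mem_homologyFilt {m p : ℕ} {x : (tot K).homology m} : x ∈ homologyFilt K m p ↔
    ∃ z : AddMonoidHom.ker ((tot K).d m (m + 1)).hom, z.1 ∈ colFilt K m p ∧
      cycleClass (tot K) m z = x := by
  constructor
  · rintro ⟨c, hc, rfl⟩
    exact ⟨⟨_, d_iCycles_apply c⟩, hc, (homologyπ_eq_cycleClass c (d_iCycles_apply c)).symm⟩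
  · rintro ⟨z, hz, rfl⟩
    obtain ⟨c, hc⟩ := exists_iCycles_eq z
    obtain rfl : ⟨(tot K).iCycles m c, d_iCycles_apply c⟩ = z := Subtype.ext hc
    exact ⟨c, hz, homologyπ_eq_cycleClass c (d_iCycles_apply c)⟩

/-- The spectral sequence of a double complex converges to the cohomology of the total complex. -/
theorem doubleSpectralSequence_convergesTo :
    ConvergesTo (doubleSpectralSequence K) (fun m => (tot K).homology m) (homologyFilt K) := by
  refine ⟨fun n p p' h => ?_, fun n => ?_, fun n => ?_, fun p q r hr hp hq => ?_⟩
  · exact AddSubgroup.map_mono (AddSubgroup.comap_mono (colFilt_anti n h))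
  · refine top_unique fun x _ => mem_homologyFilt.2 ?_
    obtain ⟨z, rfl⟩ := cycleClass_surjective x
    exact ⟨z, by rw [colFilt_zero]; trivial, rfl⟩
  · refine bot_unique fun x hx => ?_
    obtain ⟨z, hz, rfl⟩ := mem_homologyFilt.1 hx
    rw [colFilt_eq_bot (Nat.lt_succ_self n)] at hz
    obtain rfl : z = 0 := Subtype.ext hz
    exact map_zero _
  · -- `x ↦ [x]` maps the cycles in `W^p` onto `F^p / F^{p+1}`, with the same kernel as onto `E_r^p`
    have hlt : ((p + q : ℤ)) - p + 1 < r := by lia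
    have hcyc : ∀ x : (filteredTot K).cyc r p (p + q),
        (tot K).d (p + q) (p + q + 1) (x.1 (p + q)) = 0 := fun x =>
      congrFun ((FilteredDiff.mem_cyc_of_lt hlt).1 x.2).2 (p + q + 1)
    let g₀ : (filteredTot K).cyc r p (p + q) →+ homologyFilt K (p + q) p :=
      AddMonoidHom.codRestrict ((cycleClass (tot K) (p + q)).comp
        (((Pi.evalAddMonoidHom (fun m => (tot K).X m) (p + q)).comp
          (AddSubgroup.subtype _)).codRestrict _ hcyc)) _ fun x => mem_homologyFilt.2
            ⟨⟨_, hcyc x⟩, (x.2.1 (p + q)).1, rfl⟩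
    refine ⟨AddEquiv.toAddCommGrpIso (FilteredDiff.equivOfSurjective (QuotientAddGroup.mk' _)
      ((QuotientAddGroup.mk' _).comp g₀) QuotientAddGroup.mk_surjective
      (QuotientAddGroup.mk_surjective.comp ?_) fun x => ?_)⟩
    · rintro ⟨_, hx⟩
      obtain ⟨z, hz, rfl⟩ := mem_homologyFilt.1 hx
      refine ⟨⟨Pi.single (p + q) z.1, (FilteredDiff.mem_cyc_of_lt hlt).2
        ⟨(single_mem_W (by push_cast; ring)).2 hz, ?_⟩⟩, Subtype.ext ?_⟩
      · rw [filteredTot_d_single, show (tot K).d (p + q) (p + q + 1) z.1 = 0 from z.2,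
          Pi.single_zero]
      · exact congrArg (cycleClass (tot K) (p + q)) (Subtype.ext
          (Pi.single_eq_same (M := fun m => (tot K).X m) (p + q) z.1))
    · refine (FilteredDiff.mk_eq_zero x).trans (Iff.trans ?_
        ((QuotientAddGroup.eq_zero_iff (g₀ x)).trans AddSubgroup.mem_addSubgroupOf).symm)
      rw [FilteredDiff.mem_bd_of_lt hlt hp x.2]
      refine Iff.trans ?_ mem_homologyFilt.symm
      change _ ↔ ∃ z : AddMonoidHom.ker ((tot K).d (p + q) (p + q + 1)).hom, _ ∧
        _ = cycleClass (tot K) (p + q) ⟨x.1 (p + q), hcyc x⟩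
      constructor
      · rintro ⟨w, hw, hyw⟩
        refine ⟨⟨x.1 (p + q) - (tot K).d (p + q - 1) (p + q) (w (p + q - 1)), ?_⟩,
          (hyw (p + q)).1, ?_⟩
        · refine (map_sub _ _ _).trans ((congrArg₂ (· - ·) (hcyc x) (ConcreteCategory.congr_hom
            ((tot K).d_comp_d (p + q - 1) (p + q) (p + q + 1)) _)).trans (sub_zero 0))
        · rw [eq_comm, ← sub_eq_zero, ← map_sub, cycleClass_eq_zero_iff]
          exact ⟨w (p + q - 1), (sub_sub_cancel _ _).symm⟩
      · rintro ⟨z, hz, e⟩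
        rw [eq_comm, ← sub_eq_zero, ← map_sub, cycleClass_eq_zero_iff] at e
        obtain ⟨w, hw⟩ := e
        obtain ⟨w', hw', e'⟩ : ∃ w' ∈ (filteredTot K).W 0 ((p + q : ℤ) - 1),
            (tot K).d (p + q - 1) (p + q) (w' (p + q - 1)) = x.1 (p + q) - z.1 := by
          -- in total degree zero the preimage has to be zero, as `p + q - 1` is truncated
          by_cases h0 : p + q = 0
          · refine ⟨0, zero_mem _, Eq.trans ?_ hw⟩
            rw [(tot K).shape _ _ (by simp [h0])]
            rfl
          · refine ⟨Pi.single (p + q - 1) w, (single_mem_W (p := 0) (by lia)).2 ?_, ?_⟩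
            · rw [colFilt_zero]
              trivial
            · rw [Pi.single_eq_same]
              exact hw
        refine ⟨w', hw', fun m => ?_⟩
        have h0 : x.1 - (filteredTot K).d w' ∈ (filteredTot K).W 0 (p + q) := by
          refine sub_mem ((filteredTot K).anti _ (by lia) x.2.1) ?_
          have := (filteredTot K).d_mem hw'
          rwa [sub_add_cancel] at this
        by_cases hm : m = p + q
        · subst hm
          refine ⟨?_, fun h => absurd (by push_cast; rfl) h⟩
          have : (x.1 - (filteredTot K).d w') (p + q) = z.1 :=
            (congrArg (x.1 (p + q) - ·) e').trans (sub_sub_cancel _ _)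
          rw [this]
          exact hz
        · rw [(h0 m).2 (by lia)]
          exact ⟨zero_mem _, fun _ => rfl⟩

end DoubleComplex

/-! ### Colimits over disjoint unions of directed categories -/

section Colimits

open Limits

variable {C : Type u} [Category.{u} C] {I : Type w} (π : C → I)

/-- The part of `C` over `i`. -/
abbrev FibreOver (i : I) : Type u := ObjectProperty.FullSubcategory fun c : C => π c = i

variable {π}

theorem isFilteredOrEmpty_fibreOver [Quiver.IsThin C]
    (hd : ∀ c d : C, π c = π d → ∃ e, π e = π d ∧ Nonempty (c ⟶ e) ∧ Nonempty (d ⟶ e)) (i : I) :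
    IsFilteredOrEmpty (FibreOver π i) where
  cocone_objs c d := by
    obtain ⟨e, he, ⟨f⟩, ⟨g⟩⟩ := hd c.1 d.1 (c.2.trans d.2.symm)
    exact ⟨⟨e, he.trans d.2⟩, ObjectProperty.homMk f, ObjectProperty.homMk g, trivial⟩
  cocone_maps c d f g := ⟨d, 𝟙 d, by ext; exact Subsingleton.elim _ _⟩

theorem mono_whiskerLeft {C' : Type u} [Category.{u} C'] (F : C' ⥤ C)
    {A B : C ⥤ AddCommGrpCat.{u}} (α : A ⟶ B) [Mono α] : Mono (Functor.whiskerLeft F α) := by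
  have (c : C') : Mono ((Functor.whiskerLeft F α).app c) := inferInstanceAs (Mono (α.app (F.obj c)))
  exact NatTrans.mono_of_mono_app _

open Classical in
/-- The projection of a colimit over `C` to the colimit over the part over `i`. -/
noncomputable def toFibre (hπ : ∀ c d : C, (c ⟶ d) → π c = π d) (A : C ⥤ AddCommGrpCat.{u})
    (i : I) : colimit A ⟶ colimit (ObjectProperty.ι (fun c : C => π c = i) ⋙ A) :=
  colimit.desc A
    { pt := _
      ι :=
        { app := fun c => if h : π c = i then
            colimit.ι (ObjectProperty.ι (fun c : C => π c = i) ⋙ A) ⟨c, h⟩ else 0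
          naturality := fun c d f => by
            by_cases h : π d = i
            · have h' : π c = i := (hπ c d f).trans h
              rw [dif_pos h, dif_pos h']
              exact (colimit.w (ObjectProperty.ι (fun c : C => π c = i) ⋙ A)
                (j' := ⟨c, h'⟩) (j := ⟨d, h⟩) (ObjectProperty.homMk f)).trans
                  (Category.comp_id _).symm
            · have h' : ¬ π c = i := fun h' => h ((hπ c d f).symm.trans h')
              rw [dif_neg h, dif_neg h', comp_zero, zero_comp] } }

theorem ι_toFibre (hπ : ∀ c d : C, (c ⟶ d) → π c = π d) (A : C ⥤ AddCommGrpCat.{u}) (c : C) :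
    colimit.ι A c ≫ toFibre hπ A (π c) =
      colimit.ι (ObjectProperty.ι (fun d : C => π d = π c) ⋙ A) ⟨c, rfl⟩ :=
  (colimit.ι_desc _ _).trans (dif_pos rfl)

theorem ι_toFibre_of_ne (hπ : ∀ c d : C, (c ⟶ d) → π c = π d) (A : C ⥤ AddCommGrpCat.{u}) {c : C}
    {i : I} (h : π c ≠ i) : colimit.ι A c ≫ toFibre hπ A i = 0 :=
  (colimit.ι_desc _ _).trans (dif_neg h)

/-- A colimit of abelian groups is generated by the images of the terms. -/
theorem closure_range_colimit (A : C ⥤ AddCommGrpCat.{u}) (x : (colimit A : AddCommGrpCat.{u})) :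
    x ∈ AddSubgroup.closure {y | ∃ c a, y = colimit.ι A c a} := by
  let H : AddSubgroup (colimit A : AddCommGrpCat.{u}) :=
    AddSubgroup.closure {y | ∃ c a, y = colimit.ι A c a}
  have h : AddCommGrpCat.ofHom (QuotientAddGroup.mk' H) = 0 := colimit.hom_ext fun c => by
    ext a
    exact (QuotientAddGroup.eq_zero_iff _).2 (AddSubgroup.subset_closure ⟨c, a, rfl⟩)
  exact (QuotientAddGroup.eq_zero_iff x).1 (ConcreteCategory.congr_hom h x)

/-- An element of the colimit is determined by its projections to the parts. -/
theorem eq_zero_of_toFibre (hπ : ∀ c d : C, (c ⟶ d) → π c = π d) (A : C ⥤ AddCommGrpCat.{u})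
    (x : (colimit A : AddCommGrpCat.{u})) (hx : ∀ i, toFibre hπ A i x = 0) : x = 0 := by
  classical
  -- every element is the sum of its projections to finitely many parts; larger sums are allowed
  -- to make the claim stable under addition
  have key : ∃ s : Finset I, ∀ t, s ⊆ t → x = ∑ i ∈ t,
      colimit.pre A (ObjectProperty.ι (fun c : C => π c = i)) (toFibre hπ A i x) := by
    clear hx
    induction closure_range_colimit A x using AddSubgroup.closure_induction with
    | mem x hx =>
      obtain ⟨c, a, rfl⟩ := hx
      refine ⟨{π c}, fun t ht => ?_⟩
      rw [Finset.sum_eq_single (π c)]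
      · rw [← ConcreteCategory.comp_apply (colimit.ι A c), ι_toFibre,
          ← ConcreteCategory.comp_apply, colimit.ι_pre]
        rfl
      · intro i _ hi
        rw [← ConcreteCategory.comp_apply (colimit.ι A c), ι_toFibre_of_ne hπ A hi.symm]
        exact map_zero _
      · exact fun h => absurd (ht (Finset.mem_singleton_self _)) h
    | zero => exact ⟨∅, fun t _ => by simp⟩
    | add x y _ _ hx hy =>
      obtain ⟨s, hs⟩ := hx
      obtain ⟨s', hs'⟩ := hy
      refine ⟨s ∪ s', fun t ht => ?_⟩
      simp only [map_add, Finset.sum_add_distrib]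
      rw [← hs t (Finset.union_subset_left ht), ← hs' t (Finset.union_subset_right ht)]
    | neg x _ hx =>
      obtain ⟨s, hs⟩ := hx
      refine ⟨s, fun t ht => ?_⟩
      simp only [map_neg, Finset.sum_neg_distrib]
      rw [← hs t ht]
  obtain ⟨s, hs⟩ := key
  rw [hs s subset_rfl]
  exact Finset.sum_eq_zero fun i _ => by rw [hx i, map_zero]

/-- Colimits of abelian groups over a disjoint union of directed categories preserve
monomorphisms. -/
theorem mono_colimMap [Quiver.IsThin C] (hπ : ∀ c d : C, (c ⟶ d) → π c = π d)
    (hd : ∀ c d : C, π c = π d → ∃ e, π e = π d ∧ Nonempty (c ⟶ e) ∧ Nonempty (d ⟶ e))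
    {A B : C ⥤ AddCommGrpCat.{u}} (α : A ⟶ B) [Mono α] : Mono (colimMap α) := by
  rw [AddCommGrpCat.mono_iff_injective, injective_iff_map_eq_zero (colimMap α).hom]
  intro x hx
  refine eq_zero_of_toFibre hπ A x fun i => ?_
  have := isFilteredOrEmpty_fibreOver hd i
  by_cases hne : Nonempty (FibreOver π i)
  · have : IsFiltered (FibreOver π i) := {}
    let P : ObjectProperty C := fun c => π c = i
    have hm : Mono (Functor.whiskerLeft P.ι α) := mono_whiskerLeft _ _
    have hc : Mono (colimMap (Functor.whiskerLeft P.ι α)) :=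
      inferInstanceAs (Mono (colim.map (Functor.whiskerLeft P.ι α)))
    refine (injective_iff_map_eq_zero (colimMap (Functor.whiskerLeft P.ι α)).hom).1
      ((AddCommGrpCat.mono_iff_injective _).1 hc) _ ?_
    have e : toFibre hπ A i ≫ colimMap (Functor.whiskerLeft P.ι α) =
        colimMap α ≫ toFibre hπ B i := by
      refine colimit.hom_ext fun c => ?_
      rw [ι_colimMap_assoc]
      by_cases h : π c = i
      · subst h
        rw [ι_toFibre, reassoc_of% (ι_toFibre hπ A c)]
        exact ι_colimMap _ _
      · rw [ι_toFibre_of_ne hπ B h, reassoc_of% (ι_toFibre_of_ne hπ A h), zero_comp, comp_zero]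
    refine (ConcreteCategory.congr_hom e x).trans ?_
    exact (congrArg (toFibre hπ B i) hx).trans (map_zero _)
  · -- a colimit over the empty category is zero
    have h : AddSubgroup.closure {y | ∃ c a, y = colimit.ι
        (ObjectProperty.ι (fun c : C => π c = i) ⋙ A) c a} ≤ ⊥ := by
      rw [AddSubgroup.closure_le]
      rintro _ ⟨c, -, -⟩
      exact absurd ⟨c⟩ hne
    exact h (closure_range_colimit _ _)

end Colimits

/-! ### Components of injective sheaves on a diagram -/

section Component

open Limits Opposite

variable {J : Type} [Category.{0} J] (D : J ⥤ FMfd.{u}) (j : J)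

instance (A : (DOpens D)ᵒᵖ) : Quiver.IsThin (CostructuredArrow (DOpens.level D j).op A) :=
  fun X Y => ⟨fun f g => by ext; exact Subsingleton.elim _ _⟩

/-- The left Kan extension of presheaves along the inclusion of one level preserves
monomorphisms: an object over `(i, U)` is a morphism `φ : i → j` with a neighbourhood of
`(D φ) U`, so that its values are direct sums over `φ` of directed colimits. -/
instance : ((DOpens.level D j).op.lan :
    ((Opens (D.obj j).X)ᵒᵖ ⥤ AddCommGrpCat.{u}) ⥤ _).PreservesMonomorphisms where
  preserves {P Q} α _ := by
    rw [NatTrans.mono_iff_mono_app]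
    intro A
    let e := lanEvaluationIsoColim AddCommGrpCat.{u} (DOpens.level D j).op A
    have : Mono (((Functor.whiskeringLeft _ _ AddCommGrpCat.{u}).obj
        (CostructuredArrow.proj (DOpens.level D j).op A) ⋙ colim).map α) := by
      have h : Mono (Functor.whiskerLeft (CostructuredArrow.proj (DOpens.level D j).op A) α) :=
        mono_whiskerLeft _ _
      refine mono_colimMap (π := fun X => (X.hom.unop.φ : A.unop.j ⟶ j)) ?_ ?_ _
      · intro X Y f
        have e := congrArg (fun g => (g.unop.φ : A.unop.j ⟶ j)) (CostructuredArrow.w f)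
        exact e.symm.trans (Category.comp_id (Y.hom.unop.φ : A.unop.j ⟶ j))
      · intro X Y h
        -- two neighbourhoods over the same `φ` are dominated by their intersection
        let V : Opens (D.obj j).X := X.left.unop ⊓ Y.left.unop
        let F : A.unop ⟶ (DOpens.level D j).obj V :=
          ⟨X.hom.unop.φ, fun x hx => ⟨X.hom.unop.mapsTo x hx, by
            have := Y.hom.unop.mapsTo x hx
            rwa [← show (X.hom.unop.φ : A.unop.j ⟶ j) = Y.hom.unop.φ from h] at this⟩⟩
        refine ⟨CostructuredArrow.mk (Y := op V) F.op, h, ⟨CostructuredArrow.homMk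
          (homOfLE inf_le_left : V ⟶ X.left.unop).op (Quiver.Hom.unop_inj (DOpens.Hom.ext ?_))⟩,
          ⟨CostructuredArrow.homMk (homOfLE inf_le_right : V ⟶ Y.left.unop).op
            (Quiver.Hom.unop_inj (DOpens.Hom.ext ?_))⟩⟩
        · exact Category.comp_id (X.hom.unop.φ : A.unop.j ⟶ j)
        · exact (Category.comp_id (X.hom.unop.φ : A.unop.j ⟶ j)).trans h
    exact ((MorphismProperty.monomorphisms _).arrow_mk_iso_iff
      (((Functor.mapArrowFunctor _ _).mapIso e).app (Arrow.mk α))).2 this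

/-- The component at `j` of an injective sheaf on a diagram is injective: it is even an injective
presheaf. -/
instance component_injective (S : DSh D) [Injective S] : Injective ((component D j).obj S) := by
  have h1 : Injective S.obj :=
    Injective.injective_of_adjoint (sheafificationAdjunction (DOpens.topology D) _) S
  have h2 : Injective ((DOpens.level D j).op ⋙ S.obj) :=
    Injective.injective_of_adjoint ((DOpens.level D j).op.lanAdjunction AddCommGrpCat.{u}) S.obj
  refine ⟨fun {A B} g f _ => ?_⟩
  have hf : Mono ((sheafToPresheaf _ _).map f) := inferInstance
  obtain ⟨h, hh⟩ := h2.factors ((sheafToPresheaf _ _).map g) ((sheafToPresheaf _ _).map f)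
  exact ⟨⟨h⟩, Sheaf.hom_ext hh⟩

instance : (DOpens.level D j).IsCocontinuous
    (Opens.grothendieckTopology (TopCat.of (D.obj j).X)) (DOpens.topology D) where
  cover_lift {U} S hS x hx := by
    obtain ⟨V, hV, hxV, hSV⟩ := hS x hx
    exact ⟨V, homOfLE hV, hSV, hxV⟩

instance : (component D j).IsLeftAdjoint :=
  ((DOpens.level D j).sheafAdjunctionCocontinuous AddCommGrpCat.{u} _ _).isLeftAdjoint

instance : (component D j).IsRightAdjoint :=
  ((DOpens.level D j).sheafAdjunctionContinuous AddCommGrpCat.{u} _ _).isRightAdjoint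

instance : (component D j).PreservesHomology := inferInstance

end Component

/-! ### Independence of the injective resolution -/

section Resolutions

open Limits ComplexShape

variable {C : Type v} [Category.{w} C] [Abelian C]

/-- Extensions of a morphism to injective resolutions are unique up to homotopy. -/
theorem lift_unique {K I L : CochainComplex C ℕ} (ι : K ⟶ I) [QuasiIso ι]
    (hL : ∀ n, Injective (L.X n)) (g g' : I ⟶ L) (h : Nonempty (Homotopy (ι ≫ g) (ι ≫ g'))) :
    Nonempty (Homotopy g g') := by
  let := HasDerivedCategory.standard C
  let Q := HomotopyCategory.quotient C (ComplexShape.up ℤ)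
  let e : CochainComplex C ℕ ⥤ CochainComplex C ℤ := embeddingUpNat.extendFunctor C
  have : QuasiIso (e.map ι) := (HomologicalComplex.quasiIso_extendMap_iff ι embeddingUpNat).2 ‹_›
  have hι : IsIso (DerivedCategory.Qh.map (Q.map (e.map ι))) :=
    inferInstanceAs (IsIso (DerivedCategory.Q.map (e.map ι)))
  have : (e.obj L).IsKInjective :=
    inferInstanceAs (CochainComplex.IsKInjective (L.extend embeddingUpNat))
  refine ⟨Homotopy.ofExtend (e := embeddingUpNat) (HomotopyCategory.homotopyOfEq _ _ ?_)⟩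
  refine (CochainComplex.IsKInjective.Qh_map_bijective (Q.obj (e.obj I)) (e.obj L)).injective ?_
  change DerivedCategory.Qh.map (Q.map (e.map g)) = DerivedCategory.Qh.map (Q.map (e.map g'))
  rw [← cancel_epi (DerivedCategory.Qh.map (Q.map (e.map ι))), ← Functor.map_comp,
    ← Functor.map_comp, ← Functor.map_comp, ← Functor.map_comp, ← Functor.map_comp,
    ← Functor.map_comp]
  exact congrArg _ (HomotopyCategory.eq_of_homotopy _ _ (h.some.extend embeddingUpNat))

end Resolutions

section Comparison

variable {X Y : TopCat.{u}}

/-- The cohomology of the global sections of a complex of sheaves. -/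
noncomputable abbrev sectionsCoh (I : CochainComplex (Sh X) ℕ) (q : ℕ) : AddCommGrpCat.{u} :=
  (((globalSections X).mapHomologicalComplex _).obj I).homology q

/-- The map on the cohomology of the global sections. -/
noncomputable def sectionsCohMap {I I' : CochainComplex (Sh X) ℕ} (g : I ⟶ I') (q : ℕ) :
    sectionsCoh I q ⟶ sectionsCoh I' q :=
  HomologicalComplex.homologyMap (((globalSections X).mapHomologicalComplex _).map g) q

theorem sectionsCohMap_comp {I I' I'' : CochainComplex (Sh X) ℕ} (g : I ⟶ I') (g' : I' ⟶ I'')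
    (q : ℕ) : sectionsCohMap (g ≫ g') q = sectionsCohMap g q ≫ sectionsCohMap g' q := by
  rw [sectionsCohMap, Functor.map_comp, HomologicalComplex.homologyMap_comp]
  rfl

theorem sectionsCohMap_id (I : CochainComplex (Sh X) ℕ) (q : ℕ) :
    sectionsCohMap (𝟙 I) q = 𝟙 _ := by
  rw [sectionsCohMap, CategoryTheory.Functor.map_id, HomologicalComplex.homologyMap_id]

theorem sectionsCohMap_congr {I I' : CochainComplex (Sh X) ℕ} {g g' : I ⟶ I'}
    (h : Nonempty (Homotopy g g')) (q : ℕ) : sectionsCohMap g q = sectionsCohMap g' q :=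
  ((globalSections X).mapHomotopy h.some).homologyMap_eq q

/-- A comparison map of injective resolutions. -/
noncomputable def InjRes.lift {K : CochainComplex (Sh X) ℕ} (R R' : InjRes K) : R.I ⟶ R'.I :=
  have := R.qis
  (exists_lift R.ι R'.inj R'.ι).choose

theorem InjRes.ι_lift {K : CochainComplex (Sh X) ℕ} (R R' : InjRes K) :
    Nonempty (Homotopy (R.ι ≫ R.lift R') R'.ι) :=
  have := R.qis
  (exists_lift R.ι R'.inj R'.ι).choose_spec

theorem InjRes.lift_lift {K : CochainComplex (Sh X) ℕ} (R R' : InjRes K) :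
    Nonempty (Homotopy (R.lift R' ≫ R'.lift R) (𝟙 _)) := by
  have := R.qis
  refine lift_unique R.ι R.inj _ _ ⟨?_⟩
  refine (Homotopy.ofEq (Category.assoc _ _ _).symm).trans ((((R.ι_lift R').some).compRight _).trans
    ((R'.ι_lift R).some.trans (Homotopy.ofEq (Category.comp_id _).symm)))

/-- Any injective resolution computes the cohomology. -/
noncomputable def InjRes.cohIso {K : CochainComplex (Sh X) ℕ} (R : InjRes K) (q : ℕ) :
    sectionsCoh R.I q ≅ coh K q where
  hom := sectionsCohMap (R.lift (injRes K)) q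
  inv := sectionsCohMap ((injRes K).lift R) q
  hom_inv_id := by
    refine (sectionsCohMap_comp _ _ _).symm.trans ?_
    rw [sectionsCohMap_congr (R.lift_lift _), sectionsCohMap_id]
  inv_hom_id := by
    refine (sectionsCohMap_comp _ _ _).symm.trans ?_
    rw [sectionsCohMap_congr ((injRes K).lift_lift _), sectionsCohMap_id]
    rfl

/-- The map induced on the cohomology can be computed from any extension of the given morphism to
injective resolutions. -/
theorem InjRes.cohIso_naturality (f : X ⟶ Y) {K : CochainComplex (Sh Y) ℕ}
    {L : CochainComplex (Sh X) ℕ} (φ : K ⟶ ((push f).mapHomologicalComplex _).obj L)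
    (R : InjRes K) (S : InjRes L) (ψ : R.I ⟶ ((push f).mapHomologicalComplex _).obj S.I)
    (h : Nonempty (Homotopy (R.ι ≫ ψ) (φ ≫ ((push f).mapHomologicalComplex _).map S.ι))) (q : ℕ) :
    (R.cohIso q).hom ≫ cohMap f φ q =
      (show sectionsCoh R.I q ⟶ sectionsCoh S.I q from sectionsCohMap ψ q) ≫ (S.cohIso q).hom := by
  have := R.qis
  have := (injRes K).qis
  have hL (n : ℕ) : Injective ((((push f).mapHomologicalComplex _).obj (injRes L).I).X n) :=
    have := (injRes L).inj n
    push_injective f _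
  let c := exists_lift (injRes K).ι hL (φ ≫ ((push f).mapHomologicalComplex _).map (injRes L).ι)
  have key : Nonempty (Homotopy (R.lift (injRes K) ≫ c.choose)
      (ψ ≫ ((push f).mapHomologicalComplex _).map (S.lift (injRes L)))) := by
    refine lift_unique R.ι hL _ _ ⟨?_⟩
    have h1 : Homotopy (R.ι ≫ R.lift (injRes K) ≫ c.choose)
        (φ ≫ ((push f).mapHomologicalComplex _).map (injRes L).ι) :=
      (Homotopy.ofEq (Category.assoc _ _ _).symm).trans
        ((((R.ι_lift (injRes K)).some).compRight _).trans c.choose_spec.some)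
    have h2 : Homotopy (R.ι ≫ ψ ≫ ((push f).mapHomologicalComplex _).map (S.lift (injRes L)))
        (φ ≫ ((push f).mapHomologicalComplex _).map (injRes L).ι) :=
      (Homotopy.ofEq (Category.assoc _ _ _).symm).trans ((h.some.compRight _).trans
        ((Homotopy.ofEq ((Category.assoc _ _ _).trans
          (congrArg (φ ≫ ·) (Functor.map_comp _ _ _).symm))).trans
          (((push f).mapHomotopy (S.ι_lift (injRes L)).some).compLeft _)))
    exact h1.trans h2.symm
  exact (sectionsCohMap_comp _ _ _).symm.trans
    ((sectionsCohMap_congr key q).trans (sectionsCohMap_comp _ _ _))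

end Comparison

/-! ### The columns of the double complex -/

section Columns

variable {J : Type} [Category.{0} J] (D : J ⥤ FMfd.{u}) {K : CochainComplex (DSh D) ℕ}

/-- The component at `j` of an injective resolution is an injective resolution. -/
noncomputable def InjRes.component (R : InjRes K) (j : J) :
    InjRes (((component D j).mapHomologicalComplex _).obj K) where
  I := ((EquivDeligne.component D j).mapHomologicalComplex _).obj R.I
  ι := ((EquivDeligne.component D j).mapHomologicalComplex _).map R.ι
  qis := have := R.qis; inferInstance
  inj n := have := R.inj n; inferInstanceAs (Injective ((EquivDeligne.component D j).obj (R.I.X n)))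

/-- The pull-back of sections. -/
noncomputable def sectionsPullback (I : CochainComplex (DSh D) ℕ) {i j : J} (φ : i ⟶ j) (q : ℕ) :
    sectionsCoh (((component D j).mapHomologicalComplex _).obj I) q ⟶
      sectionsCoh (((component D i).mapHomologicalComplex _).obj I) q :=
  sectionsCohMap ((NatTrans.mapHomologicalComplex (structureMap D φ) _).app I) q

/-- The structure map of the resolution extends that of the complex, so that it computes the
pull-back. -/
theorem cohIso_levelPullback (R : InjRes K) {i j : J} (φ : i ⟶ j) (q : ℕ) :
    ((R.component D j).cohIso q).hom ≫ levelPullback D K φ q =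
      sectionsPullback D R.I φ q ≫ ((R.component D i).cohIso q).hom :=
  InjRes.cohIso_naturality _ _ (R.component D j) (R.component D i)
    ((NatTrans.mapHomologicalComplex (structureMap D φ) _).app R.I)
    ⟨Homotopy.ofEq ((NatTrans.mapHomologicalComplex (structureMap D φ) _).naturality R.ι)⟩ q

end Columns

section DoubleComplexColumns

variable (D : SimplexCategoryᵒᵖ ⥤ FMfd.{u}) (I : CochainComplex (DSh D) ℕ)

/-- The pull-back of sections along the `i`-th face map, as a map of columns of the double
complex. -/
noncomputable def columnFace (p : ℕ) (i : Fin (p + 2)) :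
    (doubleComplex D I).X p ⟶ (doubleComplex D I).X (p + 1) :=
  ((globalSections _).mapHomologicalComplex _).map
    ((NatTrans.mapHomologicalComplex (structureMap D (SimplexCategory.δ i).op) _).app I)

/-- The rows carry the alternating sum of the pull-backs along the face maps. -/
theorem column_d (p : ℕ) : (doubleComplex D I).d p (p + 1) =
    ∑ i : Fin (p + 2), (-1 : ℤ) ^ (i : ℕ) • columnFace D I p i := by
  refine HomologicalComplex.hom_ext _ _ fun q => ?_
  refine (CochainComplex.of_d (fun n => ((cosimplicialSections D).obj (I.X q)).obj
    (SimplexCategory.mk n)) _ p).trans ?_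
  let ev : ((doubleComplex D I).X p ⟶ (doubleComplex D I).X (p + 1)) →+
      (((doubleComplex D I).X p).X q ⟶ ((doubleComplex D I).X (p + 1)).X q) :=
    HomologicalComplex.Hom.fAddMonoidHom q
  refine Eq.trans ?_ (map_sum ev (fun i : Fin (p + 2) => (-1 : ℤ) ^ (i : ℕ) • columnFace D I p i)
    Finset.univ).symm
  exact Finset.sum_congr rfl fun i _ => (map_zsmul ev ((-1 : ℤ) ^ (i : ℕ))
    (columnFace D I p i)).symm

theorem homologyMap_column_d (p q : ℕ) :
    HomologicalComplex.homologyMap ((doubleComplex D I).d p (p + 1)) q =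
      ∑ i : Fin (p + 2), (-1 : ℤ) ^ (i : ℕ) •
        HomologicalComplex.homologyMap (columnFace D I p i) q := by
  let F := HomologicalComplex.homologyFunctor AddCommGrpCat.{u} (ComplexShape.up ℕ) q
  refine (congrArg F.map (column_d D I p)).trans ?_
  refine (F.map_sum (fun i : Fin (p + 2) => (-1 : ℤ) ^ (i : ℕ) • columnFace D I p i)
    Finset.univ).trans (Finset.sum_congr rfl fun i _ => ?_)
  exact F.map_zsmul

variable {D} {K : CochainComplex (DSh D) ℕ}

/-- The cohomology of a column of the double complex of an injective resolution. -/
noncomputable def columnIso (R : InjRes K) (p q : ℕ) : ((doubleComplex D R.I).X p).homology q ≅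
    levelCoh D K (Opposite.op (SimplexCategory.mk p)) q :=
  (R.component D (Opposite.op (SimplexCategory.mk p))).cohIso q

theorem columnIso_levelPullback (R : InjRes K) (p q : ℕ) (i : Fin (p + 2)) :
    HomologicalComplex.homologyMap (columnFace D R.I p i) q ≫ (columnIso R (p + 1) q).hom =
      (columnIso R p q).hom ≫ levelPullback D K (SimplexCategory.δ i).op q :=
  (cohIso_levelPullback D R (SimplexCategory.δ i).op q).symm

/-- The differential of the rows induces the alternating sum of the pull-backs along the face
maps. -/
theorem columnIso_faceSum (R : InjRes K) (p q : ℕ) :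
    HomologicalComplex.homologyMap ((doubleComplex D R.I).d p (p + 1)) q ≫
      (columnIso R (p + 1) q).hom = (columnIso R p q).hom ≫ faceSum D K q p := by
  rw [homologyMap_column_d, faceSum, Preadditive.sum_comp, Preadditive.comp_sum]
  refine Finset.sum_congr rfl fun i _ => ?_
  rw [Preadditive.zsmul_comp, Preadditive.comp_zsmul, columnIso_levelPullback]

end DoubleComplexColumns

/-! ### Pull-back along isomorphisms -/

section Homeomorphisms

open Limits

variable {X Y : TopCat.{u}}

/-- The direct image under a homeomorphism is exact: it is adjoint on both sides to the direct image
under the inverse. -/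
theorem push_preservesHomology (f : X ⟶ Y) [IsIso f] : (push f).PreservesHomology := by
  have h1 : (push f).IsRightAdjoint :=
    ((Opens.map f).sheafAdjunctionContinuous AddCommGrpCat.{u}
    (Opens.grothendieckTopology Y) (Opens.grothendieckTopology X)).isRightAdjoint
  have h2 : (push f).IsLeftAdjoint :=
    (Adjunction.sheafPushforwardContinuous (E := AddCommGrpCat.{u}) (F := Opens.map f)
      (G := Opens.map (inv f)) (Opens.mapMapIso (asIso f)).toAdjunction
      (Opens.grothendieckTopology Y) (Opens.grothendieckTopology X)).isLeftAdjoint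
  infer_instance

/-- The direct image of an injective resolution under a homeomorphism, as an injective
resolution. -/
noncomputable def InjRes.push {K : CochainComplex (Sh Y) ℕ} {L : CochainComplex (Sh X) ℕ}
    (S : InjRes L) (f : X ⟶ Y) [IsIso f]
    (φ : K ⟶ ((push f).mapHomologicalComplex _).obj L) [IsIso φ] : InjRes K where
  I := ((EquivDeligne.push f).mapHomologicalComplex _).obj S.I
  ι := φ ≫ ((EquivDeligne.push f).mapHomologicalComplex _).map S.ι
  qis := by
    have := S.qis
    have := push_preservesHomology f
    infer_instance
  inj n := have := S.inj n; push_injective f (S.I.X n)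

/-- Replacing the resolution on `Y` by the direct image of that on `X` makes the induced map on
global sections an identity. -/
theorem isIso_cohMap (f : X ⟶ Y) [IsIso f] {K : CochainComplex (Sh Y) ℕ}
    {L : CochainComplex (Sh X) ℕ} (φ : K ⟶ ((push f).mapHomologicalComplex _).obj L) [IsIso φ]
    (q : ℕ) : IsIso (cohMap f φ q) := by
  let S := injRes L
  let R := S.push f φ
  have h := InjRes.cohIso_naturality f φ R S (𝟙 _) ⟨Homotopy.ofEq (Category.comp_id _)⟩ q
  have e : sectionsCohMap (𝟙 R.I) q = 𝟙 _ := sectionsCohMap_id _ _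
  have h' : (R.cohIso q).hom ≫ cohMap f φ q = (S.cohIso q).hom :=
    h.trans ((congrArg (fun g : sectionsCoh S.I q ⟶ sectionsCoh S.I q => g ≫ (S.cohIso q).hom)
      e).trans (Category.id_comp _))
  have hS : IsIso (S.cohIso q).hom := (S.cohIso q).isIso_hom
  have : IsIso ((R.cohIso q).hom ≫ cohMap f φ q) := h' ▸ hS
  exact IsIso.of_isIso_comp_left (R.cohIso q).hom _

end Homeomorphisms

section Manifolds

open Limits

variable {J : Type} [Category.{0} J] (D : J ⥤ FMfd.{u}) (j : J)

instance {X Y : FMfd.{u}} (f : X ⟶ Y) [IsIso f] : IsIso (FMfd.toTop f) :=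
  ⟨FMfd.toTop (inv f), congrArg FMfd.toTop (IsIso.hom_inv_id f),
    congrArg FMfd.toTop (IsIso.inv_hom_id f)⟩

/-- The morphism `(X, f⁻¹ V) → (Y, V)`. -/
def OpenMfd.homMap {X Y : FMfd.{u}} (f : X ⟶ Y) (V : Opens Y.X) :
    (⟨X, (Opens.map (FMfd.toTop f)).obj V⟩ : OpenMfd) ⟶ ⟨Y, V⟩ :=
  ⟨f, fun _ hx => hx⟩

instance {X Y : FMfd.{u}} (f : X ⟶ Y) [IsIso f] (V : Opens Y.X) :
    IsIso (OpenMfd.homMap f V) := by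
  have h : f ≫ inv f = 𝟙 X := IsIso.hom_inv_id f
  have h' : inv f ≫ f = 𝟙 Y := IsIso.inv_hom_id f
  refine ⟨⟨inv f, fun x hx => ?_⟩, OpenMfd.Hom.ext h, OpenMfd.Hom.ext h'⟩
  have e : f.f ((inv f).f x) = x := congrFun (congrArg FMfd.Hom.f h') x
  exact show f.f ((inv f).f x) ∈ V from e.symm ▸ hx

instance isIso_pullComplex (K : CochainComplex (OpenMfd.{u}ᵒᵖ ⥤ AddCommGrpCat.{u}) ℕ)
    (h : IsSheafComplex K) {Y : FMfd.{u}} (f : D.obj j ⟶ Y) [IsIso f] :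
    IsIso (pullComplex K h D j f) := by
  have (q : ℕ) : IsIso ((pullComplex K h D j f).f q) := by
    have : IsIso ((sheafToPresheaf _ _).map ((pullComplex K h D j f).f q)) := by
      have (V : (Opens Y.X)ᵒᵖ) :
          IsIso (((sheafToPresheaf _ _).map ((pullComplex K h D j f).f q)).app V) :=
        inferInstanceAs (IsIso ((K.X q).map (OpenMfd.homMap f V.unop).op))
      exact NatIso.isIso_of_isIso_app _
    exact isIso_of_reflects_iso _ (sheafToPresheaf _ _)
  exact HomologicalComplex.Hom.isIso_of_components _

variable {j} in
/-- If all directions are vertical, the only vertical form is zero. -/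
theorem component_verticalInclusion (hv : (D.obj j).vert = ⊤) (N q : ℕ) :
    (component D j).map ((onDiagramMap (isSheafComplex_vertical N) (isSheafComplex_deligne N)
      (verticalInclusion N) D).f q) = 0 := by
  refine Sheaf.hom_ext (NatTrans.ext (funext fun V => ?_))
  change ((verticalInclusion N).f q).app (Opposite.op ⟨D.obj j, V.unop⟩) = 0
  ext s
  have hs : (show (formSheaf N True q).sec ⟨D.obj j, V.unop⟩ from s) = 0 := by
    refine Subtype.ext (funext fun x => funext fun v => ?_)
    have := (s.2 x.1 x.2).2.2.2 trivial v fun i => hv ▸ trivial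
    rwa [ext0_mem _ x.2] at this
  exact (congrArg _ hs).trans (map_zero _)

theorem isIso_map_cokernel_π {A B : Type*} [Category* A] [Category* B] [HasZeroMorphisms A]
    [HasZeroMorphisms B] (F : A ⥤ B) [F.PreservesZeroMorphisms] {X Y : A} (m : X ⟶ Y)
    [HasCokernel m] [HasCokernel (F.map m)] [PreservesColimit (parallelPair m 0) F]
    (h : F.map m = 0) : IsIso (F.map (cokernel.π m)) := by
  have : IsIso (F.map (cokernel.π m) ≫ (PreservesCokernel.iso F m).hom) := by
    rw [PreservesCokernel.π_iso_hom]
    exact cokernel.π_of_zero h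
  exact IsIso.of_isIso_comp_right _ (PreservesCokernel.iso F m).hom

variable {j} in
theorem isIso_component_cokernel_π (hv : (D.obj j).vert = ⊤) (N : ℕ) :
    IsIso (((component D j).mapHomologicalComplex (ComplexShape.up ℕ)).map
      (cokernel.π (onDiagramMap (isSheafComplex_vertical N) (isSheafComplex_deligne N)
        (verticalInclusion N) D))) := by
  let m := onDiagramMap (isSheafComplex_vertical N) (isSheafComplex_deligne N)
    (verticalInclusion N) D
  have (q : ℕ) : IsIso ((((component D j).mapHomologicalComplex (ComplexShape.up ℕ)).map
      (cokernel.π m)).f q) :=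
    isIso_map_cokernel_π (HomologicalComplex.eval _ (ComplexShape.up ℕ) q ⋙ component D j) m
      (component_verticalInclusion D hv N q)
  exact HomologicalComplex.Hom.isIso_of_components _

/-- The comparison with a manifold on which all directions are vertical. -/
theorem isIso_barPullback (hv : (D.obj j).vert = ⊤) (N : ℕ) {Y : FMfd.{u}} (f : D.obj j ⟶ Y)
    [IsIso f] (q : ℕ) : IsIso (barPullback N D j f q) := by
  have := isIso_component_cokernel_π D hv N
  exact isIso_cohMap _ _ q

end Manifolds

section LevelZero

variable {E : Type u} [AddCommGroup E] [Module ℝ E] [TopologicalSpace E]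
  [IsTopologicalAddGroup E] [ContinuousSMul ℝ E] [T2Space E] [LocallyConvexSpace ℝ E]
  {E' : Type u} [AddCommGroup E'] [Module ℝ E'] [TopologicalSpace E']
  [IsTopologicalAddGroup E'] [ContinuousSMul ℝ E'] [T2Space E'] [LocallyConvexSpace ℝ E']
  (G M : Type u) [TopologicalSpace G] [ChartedSpace E G] [Group G]
  [LCLieGroup E G] [TopologicalSpace M] [ChartedSpace E' M] [LCManifold E' M]

variable (E E')

theorem levelMfd_zero_vert : (levelMfd E E' G M 0).vert = ⊤ :=
  top_unique fun _ _ => ⟨fun i => i.elim0, trivial⟩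

/-- The projection `G^0 × M → M` is a diffeomorphism, as `G^0` is a point. -/
theorem isIso_levelZero : IsIso (levelZero E E' G M) := by
  have hs : FMfd.Smooth (X := fibreMfd E' M) (Y := levelMfd E E' G M 0) fun x => (Fin.elim0, x) :=
    FMfd.Smooth.prodMk (X := (baseMfd E G).pow 0) (Y := fibreMfd E' M)
      (FMfd.Smooth.powMk fun i => i.elim0) FMfd.smooth_id
  refine ⟨⟨fun x => (Fin.elim0, x), hs, fun _ _ _ => ?_⟩, ?_, rfl⟩
  · rw [levelMfd_zero_vert]
    trivial
  · exact FMfd.Hom.ext (funext fun x => Prod.ext (funext fun i => i.elim0) rfl)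

variable [MulAction G M] [LCSmoothAction E E' G M]

theorem isIso_deligneToLevelZero (N q : ℕ) : IsIso (deligneToLevelZero E E' G M N q) :=
  have : IsIso (X := (simplicialMfd E E' G M).obj (Opposite.op (SimplexCategory.mk 0)))
      (levelZero E E' G M) := isIso_levelZero E E' G M
  isIso_barPullback (simplicialMfd E E' G M) (Opposite.op (SimplexCategory.mk 0))
    (levelMfd_zero_vert E E' G M) N (levelZero E E' G M) q

end LevelZero

/-! ### The second page -/

section SecondPage

/-- Homology can be compared along a map of indices that respects predecessors and successors. -/
theorem nonempty_homology_iso_of_prev_next {C : Type u} [Category.{v} C] [Abelian C]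
    {ι ι' : Type*} {c : ComplexShape ι} {c' : ComplexShape ι'} (K : HomologicalComplex C c')
    (L : HomologicalComplex C c) (f : ι → ι') (e : ∀ i, K.X (f i) ≅ L.X i)
    (he : ∀ i j, K.d (f i) (f j) ≫ (e j).hom = (e i).hom ≫ L.d i j) (i : ι)
    (hp : c'.prev (f i) = f (c.prev i)) (hn : c'.next (f i) = f (c.next i)) :
    Nonempty (K.homology (f i) ≅ L.homology i) :=
  ⟨ShortComplex.homologyMapIso (K.isoSc' _ _ _ hp hn ≪≫
    (ShortComplex.isoMk (e _) (e _) (e _) (he _ _).symm (he _ _).symm :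
      K.sc' (f (c.prev i)) (f i) (f (c.next i)) ≅ L.sc i))⟩

theorem next_spectralSequenceNat_one (p q : ℕ) :
    (ComplexShape.spectralSequenceNat (1, 0)).next (p, q) = (p + 1, q) :=
  ComplexShape.next_eq' _ (by simp)

/-- For `p = 0` both sides are `(0, q)`, as an index without predecessor is its own predecessor. -/
theorem prev_spectralSequenceNat_one (p q : ℕ) :
    (ComplexShape.spectralSequenceNat (1, 0)).prev (p, q) =
      ((ComplexShape.up ℕ).prev p, q) := by
  cases p with
  | zero =>
    rw [CochainComplex.prev_nat_zero]
    exact ComplexShape.prev_eq_self _ _ fun h => by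
      rw [ComplexShape.spectralSequenceNat_rel_iff] at h
      lia
  | succ p =>
    rw [CochainComplex.prev_nat_succ]
    exact ComplexShape.prev_eq' _ (by simp)

/-- If the rows of the first page are identified with complexes, the second page consists of the
cohomology of these complexes. -/
theorem nonempty_secondPage_iso {C : Type u} [Category.{v} C] [Abelian C]
    (S : CohomologicalSpectralSequenceNat C 1) (q : ℕ) (X : ℕ → C) (d : ∀ p, X p ⟶ X (p + 1))
    (hd : ∀ p, d p ≫ d (p + 1) = 0) (e : ∀ p, (S.page 1 le_rfl).X (p, q) ≅ X p)
    (he : ∀ p, (S.page 1 le_rfl).d (p, q) (p + 1, q) ≫ (e (p + 1)).hom = (e p).hom ≫ d p)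
    (p : ℕ) :
    Nonempty ((S.page 2 one_le_two).X (p, q) ≅ (CochainComplex.of X d hd).homology p) := by
  have he' (a b : ℕ) : (S.page 1 le_rfl).d (a, q) (b, q) ≫ (e b).hom =
      (e a).hom ≫ (CochainComplex.of X d hd).d a b := by
    by_cases h : a + 1 = b
    · subst h
      exact (he a).trans (congrArg ((e a).hom ≫ ·) (CochainComplex.of_d X d a).symm)
    · rw [HomologicalComplex.shape (CochainComplex.of X d hd) _ _ h, HomologicalComplex.shape,
        Limits.comp_zero, Limits.zero_comp]
      intro h'
      rw [ComplexShape.spectralSequenceNat_rel_iff] at h'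
      exact h (by lia)
  obtain ⟨i⟩ := nonempty_homology_iso_of_prev_next (S.page 1 le_rfl) (CochainComplex.of X d hd)
    (fun p => (p, q)) e he' p (prev_spectralSequenceNat_one p q)
    ((next_spectralSequenceNat_one p q).trans (by rw [CochainComplex.next]))
  exact ⟨(S.iso 1 2 (p, q)).symm ≪≫ i⟩

end SecondPage

end EquivDeligne

theorem mainTheorem4 {E E' G M : Type u}
    [AddCommGroup E] [Module ℝ E] [TopologicalSpace E] [IsTopologicalAddGroup E]
    [ContinuousSMul ℝ E] [T2Space E] [LocallyConvexSpace ℝ E]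
    [AddCommGroup E'] [Module ℝ E'] [TopologicalSpace E'] [IsTopologicalAddGroup E']
    [ContinuousSMul ℝ E'] [T2Space E'] [LocallyConvexSpace ℝ E']
    [TopologicalSpace G] [ChartedSpace E G] [Group G] [EquivDeligne.LCLieGroup E G]
    [TopologicalSpace M] [ChartedSpace E' M] [EquivDeligne.LCManifold E' M]
    [MulAction G M] [EquivDeligne.LCSmoothAction E E' G M] (N : ℕ) :
    ∃ (hd : ∀ q p, EquivDeligne.faceDifferential E E' G M N q p ≫
        EquivDeligne.faceDifferential E E' G M N q (p + 1) = 0)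
      (S : CohomologicalSpectralSequenceNat AddCommGrpCat.{u} 1),
      (∃ e : ∀ p q, (S.page 1 le_rfl).X (p, q) ≅ EquivDeligne.deligneLevel E E' G M N p q,
        ∀ p q, (S.page 1 le_rfl).d (p, q) (p + 1, q) ≫ (e (p + 1) q).hom =
          (e p q).hom ≫ EquivDeligne.faceDifferential E E' G M N q p) ∧
      (∀ p q, Nonempty ((S.page 2 one_le_two).X (p, q) ≅
        (CochainComplex.of (fun p => EquivDeligne.deligneLevel E E' G M N p q)
          (EquivDeligne.faceDifferential E E' G M N q) (hd q)).homology p)) ∧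
      (∀ q, IsIso (EquivDeligne.deligneToLevelZero E E' G M N q)) ∧
      EquivDeligne.ConvergesTo S (EquivDeligne.equivDeligneCoh E E' G M N)
        (EquivDeligne.equivDeligneFiltration E E' G M N) := by
  let R := EquivDeligne.injRes (EquivDeligne.equivDeligne E E' G M N)
  let K := EquivDeligne.doubleComplex (EquivDeligne.simplicialMfd E E' G M) R.I
  let S := EquivDeligne.doubleSpectralSequence K
  let e (p q : ℕ) : (S.page 1 le_rfl).X (p, q) ≅ EquivDeligne.deligneLevel E E' G M N p q :=
    EquivDeligne.firstPageIso K p q ≪≫ EquivDeligne.columnIso R p q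
  have he (p q : ℕ) : (S.page 1 le_rfl).d (p, q) (p + 1, q) ≫ (e (p + 1) q).hom =
      (e p q).hom ≫ EquivDeligne.faceDifferential E E' G M N q p := by
    refine (Category.assoc _ _ _).symm.trans ?_
    refine (congrArg (· ≫ _) (EquivDeligne.firstPageIso_d p q)).trans ?_
    refine (Category.assoc _ _ _).trans (Eq.trans ?_ (Category.assoc _ _ _).symm)
    exact congrArg (_ ≫ ·) (EquivDeligne.columnIso_faceSum R p q)
  -- `e` is an isomorphism of the rows of the first page with the face complexes, so that the face
  -- differential inherits `d ∘ d = 0`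
  have hd (q p : ℕ) : EquivDeligne.faceDifferential E E' G M N q p ≫
      EquivDeligne.faceDifferential E E' G M N q (p + 1) = 0 := by
    rw [← cancel_epi (e p q).hom, ← Category.assoc, ← he, Category.assoc, ← he, ← Category.assoc,
      HomologicalComplex.d_comp_d, Limits.zero_comp, Limits.comp_zero]
  exact ⟨hd, S, ⟨e, he⟩, fun p q => EquivDeligne.nonempty_secondPage_iso S q _ _ (hd q)
    (fun p => e p q) (fun p => he p q) p, EquivDeligne.isIso_deligneToLevelZero E E' G M N,
    EquivDeligne.doubleSpectralSequence_convergesTo⟩
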